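/- Let $n\ge 2$ and let $1<p<\frac{n+2}{n-2}$ (that is, $1<p<\infty$ when $n=2$). Let $G\subset SO(n)$ be a subgroup that acts transitively on the unit sphere $S^{n-1}\subset\mathbb R^n$, and let $\pi$ be a continuous unitary representation of $G$ on a finite-dimensional complex inner product space $V$. Let $H^1(\mathbb R^n,V)$ be the space of $u\in L^2(\mathbb R^n,V)$ with weak partial derivatives in $L^2(\mathbb R^n,V)$, and put $$H^1_\pi(\mathbb R^n)=\{u\in H^1(\mathbb R^n,V):\ \text{for every } g\in G,\ u(gx)=\pi(g)u(x)\ \text{for a.e. } x\in\mathbb R^n\}.$$ Assume $H^1_\pi(\mathbb R^n)\neq 0$. Let $$\alpha=2-\frac{(n-2)(p-1)}2,\qquad \beta=\frac{n(p-1)}2,\qquad W(u)=\frac{\|u\|_{L^{p+1}}^{p+1}}{\|u\|_{L^2}^{\alpha}\,\|\nabla u\|_{L^2}^{\beta}},\qquad \mathcal W(\pi)=\sup\{W(u):0\neq u\in H^1_\pi(\mathbb R^n)\}.$$ Then $\mathcal W(\pi)<\infty$ and there is a nonzero $u\in H^1_\pi(\mathbb R^n)$ with $W(u)=\mathcal W(\pi)$.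 Moreover, every nonzero $u\in H^1_\pi(\mathbb R^n)$ with $W(u)=\mathcal W(\pi)$ solves, in the sense of distributions on $\mathbb R^n$, $$\Delta u-\lambda u+K|u|^{p-1}u=0,\qquad \lambda=\frac{\alpha}{\beta}\,\frac{\|\nabla u\|_{L^2}^2}{\|u\|_{L^2}^2},\qquad K=\frac{p+1}{\beta}\,\frac{\|\nabla u\|_{L^2}^2}{\|u\|_{L^{p+1}}^{p+1}};$$ in particular, $\lambda=\frac{\alpha}{\beta}$ and $K=\frac{p+1}{\beta\,\mathcal W(\pi)}$ if in addition $\|u\|_{L^2}=\|\nabla u\|_{L^2}=1$. -/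

import Mathlib

open MeasureTheory
open scoped ContDiff

noncomputable section

namespace SphericalVortex

/-- Euclidean space `ℝⁿ`. -/
abbrev E (n : ℕ) := EuclideanSpace ℝ (Fin n)

/-- The action of a rotation `g ∈ SO(n)` on `ℝⁿ` (matrix times vector). -/
def rot {n : ℕ} (g : Matrix.specialOrthogonalGroup (Fin n) ℝ) (x : E n) : E n :=
  WithLp.toLp 2 (Matrix.mulVec (g : Matrix (Fin n) (Fin n) ℝ) (WithLp.ofLp x))

/-- The subgroup `G` of `SO(n)` acts transitively on the unit sphere of `ℝⁿ`. -/
def ActsTransitivelyOnSphere {n : ℕ}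
    (G : Subgroup (Matrix.specialOrthogonalGroup (Fin n) ℝ)) : Prop :=
  ∀ x ∈ Metric.sphere (0 : E n) 1, ∀ y ∈ Metric.sphere (0 : E n) 1, ∃ g ∈ G, rot g x = y

variable {n : ℕ} {V : Type*} [NormedAddCommGroup V] [InnerProductSpace ℂ V]

/-- `w` is the weak partial derivative `∂ᵢ u`: integration by parts holds against every
real-valued test function. -/
def IsWeakPartial (i : Fin n) (u w : E n → V) : Prop :=
  ∀ φ : E n → ℝ, ContDiff ℝ ∞ φ → HasCompactSupport φ →
    ∫ x, (fderiv ℝ φ x (EuclideanSpace.single i 1)) • u x = -∫ x, φ x • w x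

/-- `u ∈ H¹(ℝⁿ, V)`: `u` is square integrable and has square integrable weak partial
derivatives. -/
def MemH1 (u : E n → V) : Prop :=
  MemLp u 2 volume ∧ ∀ i : Fin n, ∃ w : E n → V, MemLp w 2 volume ∧ IsWeakPartial i u w

open Classical in
/-- The square integrable weak partial derivative `∂ᵢ u` of `u`, when there is one. It is unique
up to a null set, see `IsWeakPartial.ae_eq`. -/
def weakPartial (i : Fin n) (u : E n → V) : E n → V :=
  if h : ∃ w : E n → V, MemLp w 2 volume ∧ IsWeakPartial i u w then h.choose else 0

/-- The norm `‖u‖_{L^q}`, for a finite real exponent `q`. -/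
def normLq (q : ℝ) (u : E n → V) : ℝ :=
  (eLpNorm u (ENNReal.ofReal q) volume).toReal

/-- The norm `‖∇u‖_{L²} = (∑ᵢ ∫ |∂ᵢ u|²)^{1/2}`, for `u ∈ H¹`. -/
def normGrad (u : E n → V) : ℝ :=
  Real.sqrt (∑ i : Fin n, ∫ x, ‖weakPartial i u x‖ ^ 2)

/-- `u ∈ H¹_π(ℝⁿ)`: `u ∈ H¹(ℝⁿ, V)` and, for each `g ∈ G`, `u(g x) = π(g) u(x)`; this is an
identity between elements of `L²`, so it holds for almost every `x`. -/
def MemH1Equiv {G : Subgroup (Matrix.specialOrthogonalGroup (Fin n) ℝ)}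
    (π : G →* (V ≃ₗᵢ[ℂ] V)) (u : E n → V) : Prop :=
  MemH1 u ∧ ∀ g : G, ∀ᵐ x : E n, u (rot g x) = π g (u x)

/-- `u` is a nonzero element of `H¹_π(ℝⁿ)`. -/
def IsNonzeroH1Equiv {G : Subgroup (Matrix.specialOrthogonalGroup (Fin n) ℝ)}
    (π : G →* (V ≃ₗᵢ[ℂ] V)) (u : E n → V) : Prop :=
  MemH1Equiv π u ∧ ¬ u =ᵐ[volume] 0

/-- The exponent `α = 2 - (n-2)(p-1)/2`. -/
def alpha (n : ℕ) (p : ℝ) : ℝ := 2 - ((n : ℝ) - 2) * (p - 1) / 2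

/-- The exponent `β = n(p-1)/2`. -/
def beta (n : ℕ) (p : ℝ) : ℝ := (n : ℝ) * (p - 1) / 2

/-- The Weinstein functional `W(u) = ‖u‖_{L^{p+1}}^{p+1} / (‖u‖_{L²}^α ‖∇u‖_{L²}^β)`. -/
def weinstein (p : ℝ) (u : E n → V) : ℝ :=
  normLq (p + 1) u ^ (p + 1) / (normLq 2 u ^ alpha n p * normGrad u ^ beta n p)

/-- The set of values `W(u)`, for nonzero `u ∈ H¹_π(ℝⁿ)`. -/
def weinsteinValues {G : Subgroup (Matrix.specialOrthogonalGroup (Fin n) ℝ)}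
    (p : ℝ) (π : G →* (V ≃ₗᵢ[ℂ] V)) : Set ℝ :=
  {w : ℝ | ∃ u : E n → V, IsNonzeroH1Equiv π u ∧ weinstein p u = w}

/-- The supremum `𝒲(π)` of `W` over nonzero `u ∈ H¹_π(ℝⁿ)`. -/
def weinsteinSup {G : Subgroup (Matrix.specialOrthogonalGroup (Fin n) ℝ)}
    (p : ℝ) (π : G →* (V ≃ₗᵢ[ℂ] V)) : ℝ :=
  sSup (weinsteinValues p π)

/-- `u` solves `Δu - lam u + K |u|^{p-1} u = 0` on `ℝⁿ` in the sense of distributions. -/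
def SolvesNLS (p lam K : ℝ) (u : E n → V) : Prop :=
  ∀ φ : E n → ℝ, ContDiff ℝ ∞ φ → HasCompactSupport φ →
    (∫ x, Laplacian.laplacian φ x • u x) - lam • (∫ x, φ x • u x)
      + K • (∫ x, φ x • (‖u x‖ ^ (p - 1) • u x)) = 0


/-- Square integrable weak partial derivatives are unique up to null sets. -/
theorem IsWeakPartial.ae_eq [FiniteDimensional ℂ V] {i : Fin n} {u w w' : E n → V}
    (hw : MemLp w 2 volume) (hw' : MemLp w' 2 volume)
    (h : IsWeakPartial i u w) (h' : IsWeakPartial i u w') : w =ᵐ[volume] w' := by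
  have : CompleteSpace V := FiniteDimensional.complete ℂ V
  refine ae_eq_of_integral_contDiff_smul_eq (hw.locallyIntegrable (by norm_num))
    (hw'.locallyIntegrable (by norm_num)) fun φ hφ hφc => ?_
  exact neg_injective ((h φ hφ hφc).symm.trans (h' φ hφ hφc))

end SphericalVortex

end

/-! Dilations `x ↦ a • u (s • x)` preserve equivariance and the value of W, since α + β = p + 1 and
β = n(p+1)/2 - n. So W can be studied on functions with ‖u‖₂ = ‖∇u‖₂ = 1, where it equals ∫
|u|^(p+1). Subcriticality leaves room for a Gagliardo–Nirenberg bound in some L^r with r > p + 1;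
interpolated with L², it makes the supremum finite (`exists_sobolev`, `exists_eLpNorm_le`,
`bddAbove_weinsteinValues`).

A maximiser comes from the direct method (`exists_maximiser`). A normalised maximising sequence has
a subsequence converging weakly in H¹ to some u, and u is again equivariant because equivariance is
a closed linear condition. The differences d_k from u tend to zero in L^(p+1): mollifying changes
them by little in L², uniformly in k, hence by little in L^(p+1) by interpolation, so it is enough
to treat the mollified differences. These tend to zero pointwise and are uniformly bounded, which
settles every bounded region. Transitivity settles infinity: |d_k| is G-invariant, a ball of fixed
radius far from the origin has N disjoint images under G, so it carries at most 1/N of the L² mass,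
and mollification turns small local mass into uniform smallness (`exists_lintegral_ball_le`,
`tendsto_eLpNorm_of_tendsto_moll`). Thus ∫ |u|^(p+1) is the supremum, u is not zero, and as its L²
norms are at most 1 while α, β > 0, it is a maximiser.

For the equation, differentiating along u + t v with v equivariant gives the weak Euler–Lagrange
identity for such v. Symmetric criticality removes the restriction (`euler_lagrange`): the lower
order part of the identity is represented in the H¹ inner product by some f. Uniqueness of f and the
invariance of the functional make f equivariant, so u - f is an admissible test function; testing
with it gives u = f, which is the identity for all v in H¹. Taking v = φ • e yields the equation in
distributions. -/

open Filter Topology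
open scoped ENNReal NNReal

noncomputable section

namespace SphericalVortex

/-! ### Averages over a probability measure in Lebesgue norms -/

section Jensen

variable {X Y W : Type*} [MeasurableSpace X] [MeasurableSpace Y]
  [NormedAddCommGroup W] [NormedSpace ℝ W]

/-- Jensen's inequality for the powers of the norm of an average. -/
theorem enorm_integral_rpow_le (ν : Measure Y) [IsProbabilityMeasure ν] (f : Y → W)
    {r : ℝ≥0∞} (hr : 1 ≤ r) (hr' : r ≠ ⊤) :
    ‖∫ y, f y ∂ν‖ₑ ^ r.toReal ≤ ∫⁻ y, ‖f y‖ₑ ^ r.toReal ∂ν := by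
  have hr0 : r ≠ 0 := (zero_lt_one.trans_le hr).ne'
  have hpos : 0 < r.toReal := ENNReal.toReal_pos hr0 hr'
  by_cases hf : AEStronglyMeasurable f ν
  · calc ‖∫ y, f y ∂ν‖ₑ ^ r.toReal ≤ (eLpNorm f r ν) ^ r.toReal := by
          gcongr
          exact (enorm_integral_le_lintegral_enorm f).trans
            (eLpNorm_one_eq_lintegral_enorm.symm.le.trans
              (eLpNorm_le_eLpNorm_of_exponent_le hr hf))
      _ = _ := by
          rw [eLpNorm_eq_lintegral_rpow_enorm_toReal hr0 hr', ← ENNReal.rpow_mul,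
            one_div, inv_mul_cancel₀ hpos.ne', ENNReal.rpow_one]
  -- The Bochner integral of a non-measurable function is 0 by convention.
  · simp [integral_non_aestronglyMeasurable hf, hpos]

/-- If all the slices `F (·, y)` have `Lʳ` norm at most `D`, so does their average. -/
theorem eLpNorm_integral_le_of_forall (μ : Measure X) [SFinite μ] (ν : Measure Y)
    [IsProbabilityMeasure ν]
    (F : X → Y → W) (hF : StronglyMeasurable (Function.uncurry F)) {r : ℝ≥0∞} (hr : 1 ≤ r)
    (hr' : r ≠ ⊤) (D : ℝ≥0∞) (hD : ∀ᵐ y ∂ν, eLpNorm (fun x => F x y) r μ ≤ D) :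
    eLpNorm (fun x => ∫ y, F x y ∂ν) r μ ≤ D := by
  have hr0 : r ≠ 0 := (zero_lt_one.trans_le hr).ne'
  have hpos : 0 < r.toReal := ENNReal.toReal_pos hr0 hr'
  have hpow : ∀ f : X → W, eLpNorm f r μ ^ r.toReal = ∫⁻ x, ‖f x‖ₑ ^ r.toReal ∂μ := by
    intro f
    rw [eLpNorm_eq_lintegral_rpow_enorm_toReal hr0 hr', ← ENNReal.rpow_mul,
      one_div, inv_mul_cancel₀ hpos.ne', ENNReal.rpow_one]
  rw [← ENNReal.rpow_le_rpow_iff hpos, hpow]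
  -- Jensen inside the outer integral and then Tonelli take the place of Minkowski's integral
  -- inequality.
  calc ∫⁻ x, ‖∫ y, F x y ∂ν‖ₑ ^ r.toReal ∂μ
      ≤ ∫⁻ x, ∫⁻ y, ‖F x y‖ₑ ^ r.toReal ∂ν ∂μ :=
        lintegral_mono fun x => enorm_integral_rpow_le ν _ hr hr'
    _ = ∫⁻ y, ∫⁻ x, ‖F x y‖ₑ ^ r.toReal ∂μ ∂ν :=
        lintegral_lintegral_swap (hF.enorm.pow_const _).aemeasurable
    _ ≤ ∫⁻ _, D ^ r.toReal ∂ν := by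
        refine lintegral_mono_ae ?_
        filter_upwards [hD] with y hy
        rw [← hpow]
        gcongr
    _ = D ^ r.toReal := by simp

end Jensen

/-! ### Mollification as an average of translates -/

variable {n : ℕ} {V : Type*} [NormedAddCommGroup V] [InnerProductSpace ℂ V]

/-- The mollification of `u` by a normalised bump function. -/
def moll (φ : ContDiffBump (0 : E n)) (u : E n → V) : E n → V :=
  convolution (φ.normed volume) u (ContinuousLinearMap.lsmul ℝ ℝ) volume

theorem measurable_ofReal_normed (φ : ContDiffBump (0 : E n)) :
    Measurable fun y => ENNReal.ofReal (φ.normed volume y) :=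
  ENNReal.measurable_ofReal.comp φ.continuous_normed.measurable

/-- The probability measure whose density is a normalised bump function. -/
def bumpMeasure (φ : ContDiffBump (0 : E n)) : Measure (E n) :=
  volume.withDensity fun y => ENNReal.ofReal (φ.normed volume y)

theorem isProbabilityMeasure_bumpMeasure (φ : ContDiffBump (0 : E n)) :
    IsProbabilityMeasure (bumpMeasure φ) := by
  constructor
  rw [bumpMeasure, withDensity_apply _ MeasurableSet.univ, Measure.restrict_univ,
    ← ofReal_integral_eq_lintegral_ofReal φ.integrable_normed (ae_of_all _ φ.nonneg_normed),
    φ.integral_normed, ENNReal.ofReal_one]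

theorem ae_bumpMeasure_norm_lt (φ : ContDiffBump (0 : E n)) :
    ∀ᵐ y ∂(bumpMeasure φ), ‖y‖ < φ.rOut := by
  rw [bumpMeasure, ae_withDensity_iff
    (measurable_ofReal_normed φ)]
  refine ae_of_all _ fun y hy => ?_
  have : y ∈ Function.support (φ.normed volume) := by
    intro h
    exact hy (by simp [h])
  rwa [φ.support_normed_eq, mem_ball_zero_iff] at this

theorem moll_eq_integral_bumpMeasure (φ : ContDiffBump (0 : E n)) (u : E n → V) (x : E n) :
    moll φ u x = ∫ y, u (x - y) ∂(bumpMeasure φ) := by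
  rw [bumpMeasure, integral_withDensity_eq_integral_toReal_smul
    (measurable_ofReal_normed φ) (by simp)]
  simp [moll, convolution_def, ENNReal.toReal_ofReal (φ.nonneg_normed _)]

theorem moll_congr (φ : ContDiffBump (0 : E n)) {u v : E n → V} (h : u =ᵐ[volume] v) :
    moll φ u = moll φ v :=
  convolution_congr _ EventuallyEq.rfl h

theorem eLpNorm_comp_sub_right (u : E n → V) (hu : AEStronglyMeasurable u volume) (y : E n)
    (r : ℝ≥0∞) : eLpNorm (fun x => u (x - y)) r volume = eLpNorm u r volume :=
  eLpNorm_comp_measurePreserving hu (measurePreserving_sub_right volume y)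

/-- The mollification averages translates of u, all with the same norm. Passing to a strongly
measurable representative makes `u (x - y)` jointly measurable in (x, y). -/
theorem eLpNorm_moll_le (φ : ContDiffBump (0 : E n)) {u : E n → V}
    (hu : AEStronglyMeasurable u volume) {r : ℝ≥0∞} (hr : 1 ≤ r) (hr' : r ≠ ⊤) :
    eLpNorm (moll φ u) r volume ≤ eLpNorm u r volume := by
  have := isProbabilityMeasure_bumpMeasure φ
  rw [moll_congr φ hu.ae_eq_mk, eLpNorm_congr_ae hu.ae_eq_mk]
  have hm := hu.stronglyMeasurable_mk
  rw [funext (moll_eq_integral_bumpMeasure φ (hu.mk u))]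
  refine eLpNorm_integral_le_of_forall volume (bumpMeasure φ) (fun x y => hu.mk u (x - y))
    (hm.comp_measurable (measurable_fst.sub measurable_snd)) hr hr' _ (ae_of_all _ fun y => ?_)
  exact (eLpNorm_comp_sub_right _ hm.aestronglyMeasurable y r).le

/-- The bump has mass 1, so the error is the average of u(· - y) - u over |y| < `φ.rOut`; a modulus
of continuity of translations in L^r therefore bounds it. -/
theorem eLpNorm_moll_sub_le [CompleteSpace V] (φ : ContDiffBump (0 : E n)) {u : E n → V}
    (hu : AEStronglyMeasurable u volume) (hloc : LocallyIntegrable u volume)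
    {r : ℝ≥0∞} (hr : 1 ≤ r) (hr' : r ≠ ⊤) {D : ℝ≥0∞}
    (hD : ∀ y : E n, ‖y‖ ≤ φ.rOut → eLpNorm (fun x => u (x - y) - u x) r volume ≤ D) :
    eLpNorm (fun x => moll φ u x - u x) r volume ≤ D := by
  have := isProbabilityMeasure_bumpMeasure φ
  have hae := hu.ae_eq_mk
  have hm := hu.stronglyMeasurable_mk
  set v := hu.mk u
  have key : ∀ x, moll φ v x - v x = ∫ y, (v (x - y) - v x) ∂(bumpMeasure φ) := by
    intro x
    have hint : Integrable (fun y => v (x - y)) (bumpMeasure φ) := by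
      rw [bumpMeasure, integrable_withDensity_iff_integrable_smul'
        (measurable_ofReal_normed φ) (by simp)]
      have := (φ.hasCompactSupport_normed (μ := volume)).convolutionExists_left
        (ContinuousLinearMap.lsmul ℝ ℝ) φ.continuous_normed (hloc.congr hae) x
      simpa [ConvolutionExistsAt, ENNReal.toReal_ofReal (φ.nonneg_normed _)] using this
    rw [integral_sub hint (integrable_const _), moll_eq_integral_bumpMeasure]
    simp
  have h1 : eLpNorm (fun x => moll φ u x - u x) r volume
      = eLpNorm (fun x => ∫ y, (v (x - y) - v x) ∂(bumpMeasure φ)) r volume := by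
    refine eLpNorm_congr_ae ?_
    filter_upwards [hae] with x hx
    rw [← key, moll_congr φ hae, hx]
  rw [h1]
  refine eLpNorm_integral_le_of_forall volume (bumpMeasure φ) (fun x y => v (x - y) - v x)
    ((hm.comp_measurable (measurable_fst.sub measurable_snd)).sub
      (hm.comp_measurable measurable_fst)) hr hr' _ ?_
  filter_upwards [ae_bumpMeasure_norm_lt φ] with y hy
  refine le_trans (le_of_eq (eLpNorm_congr_ae ?_)) (hD y hy.le)
  filter_upwards [hae, (measurePreserving_sub_right volume y).quasiMeasurePreserving.ae hae]
    with x h1 h2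
  rw [h1, h2]

theorem contDiff_moll [CompleteSpace V] (φ : ContDiffBump (0 : E n)) {u : E n → V}
    (hu : LocallyIntegrable u volume) : ContDiff ℝ ∞ (moll φ u) :=
  (φ.hasCompactSupport_normed (μ := volume)).contDiff_convolution_left _ φ.contDiff_normed hu

theorem ae_tendsto_moll [CompleteSpace V] {φ : ℕ → ContDiffBump (0 : E n)}
    (hφ : Tendsto (fun k => (φ k).rOut) atTop (𝓝 0)) (h2 : ∀ k, (φ k).rOut ≤ 2 * (φ k).rIn)
    {u : E n → V} (hu : LocallyIntegrable u volume) :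
    ∀ᵐ x, Tendsto (fun k => moll (φ k) u x) atTop (𝓝 (u x)) :=
  ContDiffBump.ae_convolution_tendsto_right_of_locallyIntegrable hφ (Eventually.of_forall h2) hu

/-- The derivative falls on the kernel, and y ↦ φ(x - y) is itself a test function for the weak
derivative. The sign from the reflection cancels the sign from integration by parts. -/
theorem fderiv_moll_single [CompleteSpace V] (φ : ContDiffBump (0 : E n)) {u w : E n → V}
    (hu : LocallyIntegrable u volume) {i : Fin n} (h : IsWeakPartial i u w) (x : E n) :
    fderiv ℝ (moll φ u) x (EuclideanSpace.single i 1) = moll φ w x := by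
  have hc := φ.hasCompactSupport_normed (μ := volume)
  have hs : ContDiff ℝ ∞ (φ.normed volume) := φ.contDiff_normed
  have h1 := (hc.hasFDerivAt_convolution_left (ContinuousLinearMap.lsmul ℝ ℝ)
    (hs.of_le (by simp)) hu x).fderiv
  have hex := (hc.fderiv ℝ).convolutionExists_left
    ((ContinuousLinearMap.lsmul ℝ ℝ : ℝ →L[ℝ] V →L[ℝ] V).precompL (E n))
    (hs.continuous_fderiv (by simp)) hu x
  have hex' := (hc.fderiv ℝ).convolutionExists_right
    ((ContinuousLinearMap.lsmul ℝ ℝ : ℝ →L[ℝ] V →L[ℝ] V).precompL (E n)).flip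
    hu (hs.continuous_fderiv (by simp)) x
  have h2 : fderiv ℝ (moll φ u) x (EuclideanSpace.single i 1)
      = ∫ y, fderiv ℝ (φ.normed volume) (x - y) (EuclideanSpace.single i 1) • u y := by
    change fderiv ℝ (convolution (φ.normed volume) u (ContinuousLinearMap.lsmul ℝ ℝ) volume) x _ = _
    rw [h1, convolution_eq_swap, ContinuousLinearMap.integral_apply]
    · rfl
    · exact hex'
  rw [h2, moll, convolution_eq_swap]
  have hcomp : ContDiff ℝ ∞ (fun y => φ.normed volume (x - y)) :=
    hs.comp (contDiff_const.sub contDiff_id)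
  have hcs : HasCompactSupport (fun y => φ.normed volume (x - y)) :=
    hc.comp_homeomorph (Homeomorph.subLeft x)
  have h3 := h _ hcomp hcs
  have h4 : ∀ y, fderiv ℝ (fun y => φ.normed volume (x - y)) y
      = - fderiv ℝ (φ.normed volume) (x - y) := by
    intro y
    have := ((hs.differentiable (by simp)) (x - y)).hasFDerivAt.comp y
      ((hasFDerivAt_const x y).sub (hasFDerivAt_id y))
    rw [HasFDerivAt.fderiv (by exact this)]
    ext v
    simp
  simp only [h4, neg_apply, neg_smul, integral_neg, neg_inj] at h3
  rw [h3]
  rfl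

theorem bump_normed_le (φ : ContDiffBump (0 : E n)) :
    ∃ C : ℝ≥0, ∀ y, φ.normed volume y ≤ C := by
  obtain ⟨C, hC⟩ := (φ.hasCompactSupport_normed (μ := volume)).exists_bound_of_continuous
    φ.continuous_normed
  refine ⟨C.toNNReal, fun y => ?_⟩
  rw [Real.coe_toNNReal _ ((norm_nonneg _).trans (hC 0))]
  exact (le_abs_self _).trans (hC y)

/-- Jensen together with the boundedness of the bump. Only the mass of u in one ball enters, and C
depends on φ alone; this is how small local L² mass becomes pointwise smallness. -/
theorem enorm_moll_sq_le (φ : ContDiffBump (0 : E n)) : ∃ C : ℝ≥0, ∀ (u : E n → V) (x : E n),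
    ‖moll φ u x‖ₑ ^ 2 ≤ C * ∫⁻ y in Metric.ball x φ.rOut, ‖u y‖ₑ ^ 2 := by
  obtain ⟨C, hC⟩ := bump_normed_le φ
  refine ⟨C, fun u x => ?_⟩
  have := isProbabilityMeasure_bumpMeasure φ
  have h1 := enorm_integral_rpow_le (bumpMeasure φ) (fun y => u (x - y)) (r := 2)
    (by norm_num) (by norm_num)
  rw [← moll_eq_integral_bumpMeasure] at h1
  simp only [ENNReal.toReal_ofNat, ENNReal.rpow_ofNat] at h1
  refine h1.trans ?_
  rw [bumpMeasure, lintegral_withDensity_eq_lintegral_mul_non_measurable _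
    (measurable_ofReal_normed φ) (by simp)]
  calc ∫⁻ y, ((fun y => ENNReal.ofReal (φ.normed volume y)) * fun y => ‖u (x - y)‖ₑ ^ 2) y
      ≤ ∫⁻ y, C * (Metric.ball x φ.rOut).indicator (fun z => ‖u z‖ₑ ^ 2) (x - y) := by
        refine lintegral_mono fun y => ?_
        simp only [Pi.mul_apply]
        by_cases hy : φ.normed volume y = 0
        · simp [hy]
        · have : y ∈ Metric.ball (0 : E n) φ.rOut := by
            rw [← φ.support_normed_eq (μ := volume)]; exact hy
          rw [Set.indicator_of_mem (by simpa [dist_eq_norm] using this)]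
          gcongr
          rw [← ENNReal.ofReal_coe_nnreal]
          exact ENNReal.ofReal_le_ofReal (hC y)
    _ = C * ∫⁻ y in Metric.ball x φ.rOut, ‖u y‖ₑ ^ 2 := by
        rw [lintegral_const_mul' _ _ (by simp),
          lintegral_sub_left_eq_self
            (fun z => (Metric.ball x φ.rOut).indicator (fun z => ‖u z‖ₑ ^ 2) z) x,
          lintegral_indicator Metric.isOpen_ball.measurableSet]

end SphericalVortex

end

/-! ### The space H¹: translations and smooth approximation -/

open Filter Topology
open scoped ENNReal NNReal

noncomputable section

namespace SphericalVortex

attribute [local instance] InnerProductSpace.complexToReal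

variable {n : ℕ} {V : Type*} [NormedAddCommGroup V] [InnerProductSpace ℂ V]

/-- `u` belongs to `H¹` and its weak partial derivatives are the `w i`. -/
def IsH1 (u : E n → V) (w : Fin n → E n → V) : Prop :=
  MemLp u 2 volume ∧ ∀ i, MemLp (w i) 2 volume ∧ IsWeakPartial i u (w i)

/-- The sum of the `L²` norms of the components of a gradient. -/
def gradSum (w : Fin n → E n → V) : ℝ≥0∞ := ∑ i, eLpNorm (w i) 2 volume

theorem IsH1.locallyIntegrable {u : E n → V} {w : Fin n → E n → V} (h : IsH1 u w) :
    LocallyIntegrable u volume := h.1.locallyIntegrable (by norm_num)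

section Smooth

variable {F : Type*} [NormedAddCommGroup F] [NormedSpace ℝ F]

theorem norm_clm_le_sum (L : E n →L[ℝ] F) :
    ‖L‖ ≤ ∑ i, ‖L (EuclideanSpace.single i 1)‖ := by
  refine L.opNorm_le_bound (Finset.sum_nonneg fun _ _ => norm_nonneg _) fun v => ?_
  have hv : v = ∑ i, v i • (EuclideanSpace.single i (1 : ℝ) : E n) := by
    have := (EuclideanSpace.basisFun (Fin n) ℝ).sum_repr v
    simpa using this.symm
  calc ‖L v‖ = ‖∑ i, v i • L (EuclideanSpace.single i 1)‖ := by
        conv_lhs => rw [hv]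
        simp
    _ ≤ ∑ i, ‖v i • L (EuclideanSpace.single i 1)‖ := norm_sum_le _ _
    _ ≤ ∑ i, ‖L (EuclideanSpace.single i 1)‖ * ‖v‖ := by
        refine Finset.sum_le_sum fun i _ => ?_
        rw [norm_smul, mul_comm]
        gcongr
        exact PiLp.norm_apply_le v i
    _ = _ := (Finset.sum_mul _ _ _).symm

theorem eLpNorm_fderiv_le_sum {f : E n → F} (hf : ContDiff ℝ 1 f) :
    eLpNorm (fderiv ℝ f) 2 volume
      ≤ ∑ i, eLpNorm (fun x => fderiv ℝ f x (EuclideanSpace.single i 1)) 2 volume := by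
  have hc := hf.continuous_fderiv (by simp)
  calc eLpNorm (fderiv ℝ f) 2 volume
      ≤ eLpNorm (∑ i, fun x => ‖fderiv ℝ f x (EuclideanSpace.single i 1)‖) 2 volume := by
        refine eLpNorm_mono_real fun x => ?_
        rw [Finset.sum_apply]
        exact norm_clm_le_sum _
    _ ≤ ∑ i, eLpNorm (fun x => ‖fderiv ℝ f x (EuclideanSpace.single i 1)‖) 2 volume :=
        eLpNorm_sum_le (fun i _ =>
          ((hc.clm_apply continuous_const).norm).aestronglyMeasurable) (by norm_num)
    _ = _ := by simp only [eLpNorm_norm]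

/-- Translating a smooth function changes it in `L²` by at most the length of the translation
times the `L²` norm of the derivative. -/
theorem eLpNorm_comp_sub_sub_le_of_contDiff [CompleteSpace F] {f : E n → F}
    (hf : ContDiff ℝ 1 f) (y : E n) :
    eLpNorm (fun x => f (x - y) - f x) 2 volume
      ≤ ‖y‖ₑ * eLpNorm (fderiv ℝ f) 2 volume := by
  have hc := hf.continuous_fderiv (by simp)
  -- By the fundamental theorem of calculus the difference is the average over t in (0, 1] of the
  -- directional derivatives at x - t y, so the averaging inequality applies.
  set ν : Measure ℝ := volume.restrict (Set.Ioc 0 1)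
  have hν : IsProbabilityMeasure ν := ⟨by simp [ν]⟩
  have hcF : Continuous (Function.uncurry fun (x : E n) (t : ℝ) => fderiv ℝ f (x - t • y) (-y)) := by
    have : Continuous fun p : E n × ℝ => p.1 - p.2 • y := by fun_prop
    exact (hc.comp this).clm_apply continuous_const
  have key : ∀ x, f (x - y) - f x = ∫ t, fderiv ℝ f (x - t • y) (-y) ∂ν := by
    intro x
    have hd : ∀ t ∈ Set.uIcc (0 : ℝ) 1,
        HasDerivAt (fun t : ℝ => f (x - t • y)) (fderiv ℝ f (x - t • y) (-y)) t := by
      intro t _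
      have h1 : HasDerivAt (fun t : ℝ => x - t • y) (-y) t := by
        simpa using ((hasDerivAt_id t).smul_const y).const_sub x
      exact ((hf.differentiable (by simp)) _).hasFDerivAt.comp_hasDerivAt t h1
    have h2 := intervalIntegral.integral_eq_sub_of_hasDerivAt hd
      ((hcF.comp (Continuous.prodMk continuous_const continuous_id)).intervalIntegrable 0 1)
    rw [intervalIntegral.integral_of_le zero_le_one] at h2
    simp only [one_smul, zero_smul, sub_zero] at h2
    exact h2.symm
  rw [funext key]
  refine eLpNorm_integral_le_of_forall volume ν (fun x t => fderiv ℝ f (x - t • y) (-y))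
    hcF.stronglyMeasurable (by norm_num) (by norm_num) _ (ae_of_all _ fun t => ?_)
  calc eLpNorm (fun x => fderiv ℝ f (x - t • y) (-y)) 2 volume
      ≤ ‖y‖ₑ * eLpNorm (fun x => fderiv ℝ f (x - t • y)) 2 volume := by
        have := eLpNorm_le_nnreal_smul_eLpNorm_of_ae_le_mul (μ := volume) (c := ‖y‖₊)
          (f := fun x => fderiv ℝ f (x - t • y) (-y)) (g := fun x => fderiv ℝ f (x - t • y))
          (ae_of_all _ fun x => by
            have := (fderiv ℝ f (x - t • y)).le_opNNNorm (-y)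
            rwa [nnnorm_neg, mul_comm] at this) 2
        simpa [ENNReal.smul_def, enorm] using this
    _ = ‖y‖ₑ * eLpNorm (fderiv ℝ f) 2 volume := by
        congr 1
        exact eLpNorm_comp_measurePreserving hc.aestronglyMeasurable
          (measurePreserving_sub_right volume (t • y))

end Smooth

section Approx

/-- A bump function of radius `1 / (k + 1)`. -/
def smallBump (n k : ℕ) : ContDiffBump (0 : E n) where
  -- The ratio of the radii stays equal to 2, as the almost everywhere convergence of mollifications
  -- requires.
  rIn := (1 / 2) * (1 / ((k : ℝ) + 1))
  rOut := 1 / ((k : ℝ) + 1)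
  rIn_pos := by positivity
  rIn_lt_rOut := by
    have : 0 < 1 / ((k : ℝ) + 1) := by positivity
    linarith

theorem tendsto_smallBump_rOut (n : ℕ) :
    Tendsto (fun k => (smallBump n k).rOut) atTop (𝓝 0) :=
  tendsto_one_div_add_atTop_nhds_zero_nat

/-- A function in `H¹` is the almost everywhere limit of smooth compactly supported functions with
control of the norms. -/
theorem IsH1.exists_approx [CompleteSpace V] {u : E n → V} {w : Fin n → E n → V} (h : IsH1 u w) :
    ∃ f : ℕ → E n → V, (∀ k, ContDiff ℝ ∞ (f k)) ∧ (∀ k, HasCompactSupport (f k)) ∧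
      (∀ᵐ x, Tendsto (fun k => f k x) atTop (𝓝 (u x))) ∧
      (∀ k, eLpNorm (f k) 2 volume ≤ eLpNorm u 2 volume) ∧
      ∃ D : ℕ → ℝ≥0∞, Tendsto D atTop (𝓝 (gradSum w)) ∧
        ∀ k, eLpNorm (fderiv ℝ (f k)) 2 volume ≤ D k := by
  have hloc := h.locallyIntegrable
  let χ : ContDiffBump (0 : E n) := ⟨1, 2, by norm_num, by norm_num⟩
  have hχs : ContDiff ℝ ∞ χ := χ.contDiff
  have hχd := hχs.continuous_fderiv (by simp)
  obtain ⟨C, hC⟩ := (χ.hasCompactSupport.fderiv ℝ).exists_bound_of_continuous hχd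
  have hC0 : 0 ≤ C := (norm_nonneg _).trans (hC 0)
  let c : ℕ → ℝ := fun k => 1 / ((k : ℝ) + 1)
  have hc0 : ∀ k, 0 < c k := fun k => by positivity
  -- Cutoff at scale k + 1: it tends to 1 everywhere and its gradient is at most C/(k + 1).
  let ψ : ℕ → E n → ℝ := fun k x => χ (c k • x)
  let g : ℕ → E n → V := fun k => moll (smallBump n k) u
  have hψs : ∀ k, ContDiff ℝ ∞ (ψ k) := fun k => hχs.comp (contDiff_const_smul (c k))
  have hgs : ∀ k, ContDiff ℝ ∞ (g k) := fun k => contDiff_moll _ hloc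
  have hψ1 : ∀ k x, ‖ψ k x‖ ≤ 1 := fun k x => by
    rw [Real.norm_of_nonneg χ.nonneg]; exact χ.le_one
  have hψd : ∀ k x, ‖fderiv ℝ (ψ k) x‖ ≤ C * c k := by
    intro k x
    have h1 : HasFDerivAt (fun x : E n => c k • x) (c k • ContinuousLinearMap.id ℝ (E n)) x :=
      (hasFDerivAt_id x).const_smul (c k)
    have h2 := ((hχs.differentiable (by simp)) (c k • x)).hasFDerivAt.comp x h1
    rw [HasFDerivAt.fderiv (by exact h2)]
    refine (ContinuousLinearMap.opNorm_comp_le _ _).trans ?_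
    refine mul_le_mul (hC _) ?_ (norm_nonneg _) hC0
    rw [norm_smul, Real.norm_of_nonneg (hc0 k).le]
    exact mul_le_of_le_one_right (hc0 k).le ContinuousLinearMap.norm_id_le
  have hg2 : ∀ k, eLpNorm (g k) 2 volume ≤ eLpNorm u 2 volume := fun k =>
    eLpNorm_moll_le _ h.1.1 (by norm_num) (by norm_num)
  have hgd : ∀ k, eLpNorm (fderiv ℝ (g k)) 2 volume ≤ gradSum w := by
    intro k
    refine (eLpNorm_fderiv_le_sum ((hgs k).of_le (by simp))).trans ?_
    refine Finset.sum_le_sum fun i _ => ?_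
    simp only [g, fderiv_moll_single (smallBump n k) hloc (h.2 i).2]
    exact eLpNorm_moll_le _ (h.2 i).1.1 (by norm_num) (by norm_num)
  -- Mollify, then cut off. By the product rule the cutoff adds at most C c_k ‖u‖₂ to the gradient
  -- norm, and this tends to 0.
  refine ⟨fun k x => ψ k x • g k x, fun k => (hψs k).smul (hgs k), fun k => ?_, ?_, fun k => ?_,
    fun k => gradSum w + ENNReal.ofReal (C * c k) * eLpNorm u 2 volume, ?_, fun k => ?_⟩
  · refine HasCompactSupport.mono (f := ψ k) ?_ (fun x hx h0 => hx (by simp [h0]))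
    exact χ.hasCompactSupport.comp_homeomorph (Homeomorph.smulOfNeZero (c k) (hc0 k).ne')
  · filter_upwards [ae_tendsto_moll (tendsto_smallBump_rOut n)
      (fun k => by simp [smallBump]) hloc] with x hx
    have h1 : Tendsto (fun k => ψ k x) atTop (𝓝 1) := by
      have : Tendsto (fun k => c k • x) atTop (𝓝 ((0 : ℝ) • x)) :=
        tendsto_one_div_add_atTop_nhds_zero_nat.smul_const x
      have h2 := (χ.continuous.tendsto _).comp this
      rw [zero_smul, χ.one_of_mem_closedBall (by simp [χ])] at h2
      exact h2
    simpa using h1.smul hx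
  · refine le_trans (eLpNorm_mono fun x => ?_) (hg2 k)
    rw [norm_smul]
    exact mul_le_of_le_one_left (norm_nonneg _) (hψ1 k x)
  · have : Tendsto (fun k => ENNReal.ofReal (C * c k)) atTop (𝓝 0) := by
      have h1 : Tendsto (fun k => C * c k) atTop (𝓝 (C * 0)) :=
        tendsto_one_div_add_atTop_nhds_zero_nat.const_mul C
      simpa using ENNReal.tendsto_ofReal h1
    have h2 := ENNReal.Tendsto.mul_const this (b := eLpNorm u 2 volume) (Or.inr h.1.2.ne)
    simpa using tendsto_const_nhds.add h2
  · have hms : AEStronglyMeasurable (fun x => ψ k x • fderiv ℝ (g k) x) volume :=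
      ((hψs k).continuous.smul ((hgs k).continuous_fderiv (by simp))).aestronglyMeasurable
    have hmr : AEStronglyMeasurable (fun x => (fderiv ℝ (ψ k) x).smulRight (g k x)) volume :=
      Continuous.aestronglyMeasurable
        ((((ContinuousLinearMap.smulRightL ℝ (E n) V).continuous₂).comp
          (((hψs k).continuous_fderiv (by simp)).prodMk (hgs k).continuous)))
    have hψg : fderiv ℝ (fun x => ψ k x • g k x)
        = (fun x => ψ k x • fderiv ℝ (g k) x) + fun x => (fderiv ℝ (ψ k) x).smulRight (g k x) := by
      ext1 x
      exact fderiv_fun_smul ((hψs k).differentiable (by simp) x)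
        ((hgs k).differentiable (by simp) x)
    rw [hψg]
    refine (eLpNorm_add_le hms hmr (by norm_num)).trans (add_le_add ?_ ?_)
    · refine le_trans (eLpNorm_mono fun x => ?_) (hgd k)
      rw [norm_smul]
      exact mul_le_of_le_one_left (norm_nonneg _) (hψ1 k x)
    · refine le_trans ?_ (mul_le_mul_right (hg2 k) _)
      refine eLpNorm_le_mul_eLpNorm_of_ae_le_mul (ae_of_all _ fun x => ?_) 2
      rw [ContinuousLinearMap.norm_smulRight_apply]
      exact mul_le_mul_of_nonneg_right (hψd k x) (norm_nonneg _)

/-- Fatou's lemma. It carries norm inequalities from smooth functions to H¹ without any norm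
convergence of the approximants. -/
theorem eLpNorm_le_of_tendsto_bound {W : Type*} [NormedAddCommGroup W] {f : ℕ → E n → W}
    {u : E n → W} {r : ℝ≥0∞}
    (hf : ∀ k, AEStronglyMeasurable (f k) volume)
    (hlim : ∀ᵐ x, Tendsto (fun k => f k x) atTop (𝓝 (u x))) {b : ℕ → ℝ≥0∞} {B : ℝ≥0∞}
    (hb : Tendsto b atTop (𝓝 B)) (hfb : ∀ k, eLpNorm (f k) r volume ≤ b k) :
    eLpNorm u r volume ≤ B :=
  (Lp.eLpNorm_lim_le_liminf_eLpNorm hf u hlim).trans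
    ((liminf_le_liminf (Eventually.of_forall hfb)).trans hb.liminf_eq.le)

theorem IsH1.eLpNorm_comp_sub_sub_le [CompleteSpace V] {u : E n → V} {w : Fin n → E n → V}
    (h : IsH1 u w) (y : E n) :
    eLpNorm (fun x => u (x - y) - u x) 2 volume ≤ ‖y‖ₑ * gradSum w := by
  obtain ⟨f, hfs, -, hlim, -, D, hD, hfD⟩ := h.exists_approx
  refine eLpNorm_le_of_tendsto_bound (f := fun k x => f k (x - y) - f k x)
    (b := fun k => ‖y‖ₑ * D k) (fun k => ?_) ?_
    (ENNReal.Tendsto.const_mul hD (Or.inr enorm_ne_top)) fun k => ?_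
  · have := (hfs k).continuous
    exact Continuous.aestronglyMeasurable (by fun_prop)
  · filter_upwards [hlim, (measurePreserving_sub_right volume y).quasiMeasurePreserving.ae hlim]
      with x h1 h2
    exact h2.sub h1
  · refine (eLpNorm_comp_sub_sub_le_of_contDiff ((hfs k).of_le (by simp)) y).trans ?_
    gcongr
    exact hfD k

/-- The rate depends only on the gradient norm, so mollification is uniformly accurate on bounded
subsets of H¹. -/
theorem IsH1.eLpNorm_moll_sub_le [CompleteSpace V] {u : E n → V} {w : Fin n → E n → V}
    (h : IsH1 u w) (φ : ContDiffBump (0 : E n)) :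
    eLpNorm (fun x => moll φ u x - u x) 2 volume ≤ ENNReal.ofReal φ.rOut * gradSum w := by
  refine SphericalVortex.eLpNorm_moll_sub_le φ h.1.1 h.locallyIntegrable (by norm_num)
    (by norm_num) fun y hy => (h.eLpNorm_comp_sub_sub_le y).trans ?_
  gcongr
  rw [← ofReal_norm]
  exact ENNReal.ofReal_le_ofReal hy

end Approx

/-! ### Gagliardo–Nirenberg inequalities -/

section Sobolev

/-- Iterated Ladyzhenskaya inequality in the plane. -/
theorem exists_eLpNorm_pow_le_of_two (F : Type*) [NormedAddCommGroup F] [InnerProductSpace ℝ F]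
    (k : ℕ) : ∃ C : ℝ≥0, ∀ f : E 2 → F, ContDiff ℝ 1 f → HasCompactSupport f →
      eLpNorm f (2 * (k + 1)) volume ^ (k + 1)
        ≤ C * eLpNorm f 2 volume * eLpNorm (fderiv ℝ f) 2 volume ^ k := by
  induction k with
  | zero => exact ⟨1, fun f _ _ => by simp⟩
  | succ k ih =>
    obtain ⟨C, hC⟩ := ih
    obtain ⟨A, hA⟩ : ∃ A : ℝ≥0,
        A = eLpNormLESNormFDerivOneConst (volume : Measure (E 2)) (2 : ℝ) := ⟨_, rfl⟩
    refine ⟨A * (k + 2) * C, fun f hf hfc => ?_⟩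
    -- The induction step applies the embedding of W^{1,1} into L² in the plane to |f|^(k+2). Its
    -- gradient is at most (k+2) |f|^(k+1) |∇f|, and Cauchy–Schwarz splits the integral into the
    -- previous norm and ‖∇f‖₂.
    let s : ℝ≥0 := k + 2
    have hs : (1 : ℝ≥0) < s := by
      have : (0 : ℝ≥0) ≤ k := by positivity
      calc (1 : ℝ≥0) < 2 := by norm_num
        _ ≤ s := le_add_of_nonneg_left this
    let g : E 2 → ℝ := fun x => ‖f x‖ ^ (s : ℝ)
    have hs' : (1 : ℝ) < s := by exact_mod_cast hs
    have hg : ContDiff ℝ 1 g := hf.norm_rpow hs'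
    have hgc : HasCompactSupport g := hfc.norm.comp_left (g := fun t : ℝ => t ^ (s : ℝ))
      (Real.zero_rpow (by positivity))
    have hfin : Module.finrank ℝ (E 2) = 2 := by simp
    have hconj : NNReal.HolderConjugate (Module.finrank ℝ (E 2)) 2 := by
      rw [hfin]
      have : NNReal.HolderConjugate 2 2 := NNReal.HolderConjugate.two_two
      exact_mod_cast this
    have h1 := eLpNorm_le_eLpNorm_fderiv_one (volume : Measure (E 2)) hg hgc hconj
    have hsreal : (s : ℝ) = ((k + 2 : ℕ) : ℝ) := by simp [s]
    have h2 : eLpNorm g (2 : ℝ≥0) volume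
        = eLpNorm f (2 * (k + 1 + 1)) volume ^ (k + 1 + 1) := by
      have := eLpNorm_norm_rpow (μ := volume) (p := 2) f (q := (s : ℝ)) (by positivity)
      rw [show ((2 : ℝ≥0) : ℝ≥0∞) = 2 by rfl]
      simp only [g]
      rw [this, hsreal, ENNReal.rpow_natCast]
      congr 2
      rw [ENNReal.ofReal_natCast]
      push_cast
      ring
    have h3 : eLpNorm (fderiv ℝ g) 1 volume
        ≤ (k + 2) * (eLpNorm f (2 * (k + 1)) volume ^ (k + 1)
          * eLpNorm (fderiv ℝ f) 2 volume) := by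
      have h4 : eLpNorm (fun x => ‖f x‖ ^ ((k + 1 : ℕ) : ℝ)) 2 volume
          = eLpNorm f (2 * (k + 1)) volume ^ (k + 1) := by
        rw [eLpNorm_norm_rpow f (by positivity), ENNReal.rpow_natCast, ENNReal.ofReal_natCast]
        push_cast
        rfl
      rw [← h4]
      rw [eLpNorm_one_eq_lintegral_enorm]
      have hm1 : AEMeasurable (fun x => ‖(‖f x‖ ^ ((k + 1 : ℕ) : ℝ))‖ₑ) volume :=
        (Continuous.aestronglyMeasurable
          (hf.continuous.norm.rpow_const fun _ => Or.inr (by positivity))).enorm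
      have hm2 : AEMeasurable (fun x => ‖fderiv ℝ f x‖ₑ) volume :=
        (hf.continuous_fderiv (by simp)).aestronglyMeasurable.enorm
      calc ∫⁻ x, ‖fderiv ℝ g x‖ₑ
          ≤ ∫⁻ x, (k + 2) * (‖(‖f x‖ ^ ((k + 1 : ℕ) : ℝ))‖ₑ * ‖fderiv ℝ f x‖ₑ) := by
            refine lintegral_mono fun x => ?_
            have := enorm_fderiv_norm_rpow_le (hf.differentiable (by simp)) (x := x) hs
            refine this.trans (le_of_eq ?_)
            rw [mul_assoc]
            have e1 : ((s : ℝ) - 1) = ((k + 1 : ℕ) : ℝ) := by rw [hsreal]; push_cast; ring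
            rw [e1, Real.enorm_rpow_of_nonneg (norm_nonneg _) (by positivity), enorm_norm]
            simp [s]
        _ = (k + 2) * ∫⁻ x, (‖(‖f x‖ ^ ((k + 1 : ℕ) : ℝ))‖ₑ * ‖fderiv ℝ f x‖ₑ) :=
            lintegral_const_mul'' _ (hm1.mul hm2)
        _ ≤ _ := by
            gcongr
            have := ENNReal.lintegral_mul_le_Lp_mul_Lq volume Real.HolderConjugate.two_two hm1 hm2
            rw [eLpNorm_eq_lintegral_rpow_enorm_toReal (by norm_num) (by norm_num),
              eLpNorm_eq_lintegral_rpow_enorm_toReal (by norm_num) (by norm_num)]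
            simpa using this
    rw [h2] at h1
    simp only [NNReal.coe_ofNat] at h1
    rw [← hA] at h1
    push_cast at h1 ⊢
    calc eLpNorm f (2 * (k + 1 + 1)) volume ^ (k + 1 + 1)
        ≤ A * ((k + 2) * (eLpNorm f (2 * (k + 1)) volume ^ (k + 1)
          * eLpNorm (fderiv ℝ f) 2 volume)) := h1.trans (by gcongr)
      _ ≤ A * ((k + 2) * ((C * eLpNorm f 2 volume * eLpNorm (fderiv ℝ f) 2 volume ^ k)
          * eLpNorm (fderiv ℝ f) 2 volume)) := by
          gcongr
          exact hC f hf hfc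
      _ = _ := by ring

/-- A Gagliardo–Nirenberg inequality for smooth functions: some exponent `r` above a given
subcritical exponent is controlled. -/
theorem exists_sobolev_of_contDiff (hn : 2 ≤ n) (F : Type*) [NormedAddCommGroup F]
    [InnerProductSpace ℝ F]
    {q : ℝ} (hq : 2 < n → q < 2 * n / ((n : ℝ) - 2)) :
    ∃ (r C : ℝ≥0) (γ δ : ℝ), q < r ∧ 0 < γ ∧ 0 ≤ δ ∧
      ∀ f : E n → F, ContDiff ℝ 1 f → HasCompactSupport f →
        eLpNorm f r volume
          ≤ C * eLpNorm f 2 volume ^ δ * eLpNorm (fderiv ℝ f) 2 volume ^ γ := by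
  rcases hn.eq_or_lt with rfl | hn'
  -- In the plane every finite exponent is available: take the (k+2)-th root of the previous
  -- inequality, with r = 2(k+2) > q.
  · obtain ⟨k, hk⟩ := exists_nat_gt (|q|)
    obtain ⟨C, hC⟩ := exists_eLpNorm_pow_le_of_two F (k + 1)
    have hinv : (0 : ℝ) < ((k : ℝ) + 2)⁻¹ := by positivity
    refine ⟨2 * (k + 2), C ^ ((k : ℝ) + 2)⁻¹, (k + 1) * ((k : ℝ) + 2)⁻¹, ((k : ℝ) + 2)⁻¹, ?_,
      by positivity, hinv.le, fun f hf hfc => ?_⟩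
    · have := le_abs_self q
      push_cast
      have h0 : (0 : ℝ) ≤ k := by positivity
      linarith
    · have h1 := hC f hf hfc
      have h2 := ENNReal.rpow_le_rpow h1 hinv.le
      rw [← ENNReal.rpow_natCast, ← ENNReal.rpow_mul] at h2
      have e1 : (((k + 1 + 1 : ℕ) : ℝ) * ((k : ℝ) + 2)⁻¹) = 1 := by
        push_cast
        field_simp
        ring
      rw [e1, ENNReal.rpow_one, ENNReal.mul_rpow_of_nonneg _ _ hinv.le,
        ENNReal.mul_rpow_of_nonneg _ _ hinv.le, ← ENNReal.rpow_natCast _ (k + 1),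
        ← ENNReal.rpow_mul] at h2
      rw [ENNReal.coe_rpow_of_nonneg _ hinv.le]
      convert h2 using 2
      · push_cast
        ring
      · push_cast
        ring_nf
  -- Above dimension two the critical Sobolev exponent itself serves, with γ = 1 and δ = 0.
  · have hn0 : (2 : ℝ) < n := by exact_mod_cast hn'
    have hpos : (0 : ℝ) < (n : ℝ) - 2 := by linarith
    let r : ℝ≥0 := ⟨2 * n / ((n : ℝ) - 2), by positivity⟩
    refine ⟨r, eLpNormLESNormFDerivOfEqInnerConst (volume : Measure (E n)) (2 : ℝ≥0), 1, 0,
      hq hn', one_pos, le_rfl, fun f hf hfc => ?_⟩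
    have hfin : Module.finrank ℝ (E n) = n := by simp
    have := eLpNorm_le_eLpNorm_fderiv_of_eq_inner (volume : Measure (E n)) hf hfc (p := 2)
      (p' := r) (by norm_num) (by rw [hfin]; omega) (by
        rw [hfin]
        have : (r : ℝ) = 2 * n / ((n : ℝ) - 2) := rfl
        rw [this]
        push_cast
        field_simp)
    simpa using this

/-- The Gagliardo–Nirenberg inequality on `H¹`. -/
theorem exists_sobolev [CompleteSpace V] (hn : 2 ≤ n) {q : ℝ}
    (hq : 2 < n → q < 2 * n / ((n : ℝ) - 2)) :
    ∃ (r C : ℝ≥0) (γ δ : ℝ), q < r ∧ 0 < γ ∧ 0 ≤ δ ∧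
      ∀ (u : E n → V) (w : Fin n → E n → V), IsH1 u w →
        eLpNorm u r volume ≤ C * eLpNorm u 2 volume ^ δ * gradSum w ^ γ := by
  obtain ⟨r, C, γ, δ, hr, hγ, hδ, H⟩ := exists_sobolev_of_contDiff hn V hq
  refine ⟨r, C, γ, δ, hr, hγ, hδ, fun u w h => ?_⟩
  obtain ⟨f, hfs, hfc, hlim, hf2, D, hD, hfD⟩ := h.exists_approx
  have hfin : (C * eLpNorm u 2 volume ^ δ : ℝ≥0∞) ≠ ⊤ :=
    ENNReal.mul_ne_top ENNReal.coe_ne_top (ENNReal.rpow_ne_top_of_nonneg hδ h.1.2.ne)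
  refine eLpNorm_le_of_tendsto_bound (b := fun k => C * eLpNorm u 2 volume ^ δ * D k ^ γ)
    (fun k => (hfs k).continuous.aestronglyMeasurable) hlim
    (ENNReal.Tendsto.const_mul (hD.ennrpow_const γ) (Or.inr hfin)) fun k => ?_
  refine (H (f k) ((hfs k).of_le (by simp)) (hfc k)).trans ?_
  gcongr
  · exact hf2 k
  · exact hfD k

end Sobolev

end SphericalVortex

end

open Filter Topology
open scoped ENNReal NNReal

noncomputable section

namespace SphericalVortex

variable {n : ℕ} {V : Type*} [NormedAddCommGroup V] [InnerProductSpace ℂ V]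

/-! ### Rotations, and decay of local mass under a transitive group -/

section Rotation

theorem rot_mul (g h : Matrix.specialOrthogonalGroup (Fin n) ℝ) (x : E n) :
    rot (g * h) x = rot g (rot h x) := by
  simp [rot, Matrix.mulVec_mulVec]

theorem rot_one (x : E n) : rot (1 : Matrix.specialOrthogonalGroup (Fin n) ℝ) x = x := by
  simp [rot]

theorem rot_transpose_mul (g : Matrix.specialOrthogonalGroup (Fin n) ℝ) :
    (g : Matrix (Fin n) (Fin n) ℝ).transpose * (g : Matrix (Fin n) (Fin n) ℝ) = 1 := by
  have := (Matrix.mem_specialOrthogonalGroup_iff.1 g.2).1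
  exact (Matrix.mem_orthogonalGroup_iff' (Fin n) ℝ).1 this

theorem norm_rot (g : Matrix.specialOrthogonalGroup (Fin n) ℝ) (x : E n) : ‖rot g x‖ = ‖x‖ := by
  have h : ∀ y : E n, ‖y‖ ^ 2 = dotProduct (WithLp.ofLp y) (WithLp.ofLp y) := by
    intro y
    rw [EuclideanSpace.real_norm_sq_eq]
    simp [dotProduct, sq]
  have h2 : ‖rot g x‖ ^ 2 = ‖x‖ ^ 2 := by
    rw [h, h]
    simp only [rot]
    rw [Matrix.dotProduct_mulVec, Matrix.vecMul_mulVec, rot_transpose_mul, Matrix.vecMul_one]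
  exact (sq_eq_sq₀ (norm_nonneg _) (norm_nonneg _)).1 h2

/-- A rotation as a linear isometry. -/
def rotEquiv (g : Matrix.specialOrthogonalGroup (Fin n) ℝ) : E n ≃ₗᵢ[ℝ] E n where
  toFun := rot g
  invFun := rot g⁻¹
  left_inv x := by rw [← rot_mul, inv_mul_cancel, rot_one]
  right_inv x := by rw [← rot_mul, mul_inv_cancel, rot_one]
  map_add' x y := by simp [rot, Matrix.mulVec_add]
  map_smul' c x := by simp [rot, Matrix.mulVec_smul]
  norm_map' := norm_rot g

theorem coe_rotEquiv (g : Matrix.specialOrthogonalGroup (Fin n) ℝ) : ⇑(rotEquiv g) = rot g := rfl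

theorem measurePreserving_rot (g : Matrix.specialOrthogonalGroup (Fin n) ℝ) :
    MeasurePreserving (rot g) volume volume := (rotEquiv g).measurePreserving

/-- From dimension two on the sphere is connected with more than one point. This provides as many
separated directions as needed; in dimension one there are only two. -/
theorem infinite_sphere (hn : 2 ≤ n) : (Metric.sphere (0 : E n) 1).Infinite := by
  have hr : 1 < Module.rank ℝ (E n) := by
    rw [← Module.finrank_eq_rank]
    simp only [finrank_euclideanSpace, Fintype.card_fin]
    exact_mod_cast hn
  have : Nontrivial (E n) := by
    have : Nonempty (Fin n) := ⟨⟨0, by omega⟩⟩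
    infer_instance
  refine (isPreconnected_sphere hr 0 1).infinite_of_nontrivial ?_
  obtain ⟨x, hx⟩ := exists_norm_eq (E n) (zero_le_one (α := ℝ))
  refine ⟨x, by simpa using hx, -x, by simpa using hx, fun h => ?_⟩
  have h2 : (2 : ℝ) • x = 0 := by
    rw [two_smul]
    exact add_eq_zero_iff_eq_neg.2 h
  have : x = 0 := (smul_eq_zero.1 h2).resolve_left two_ne_zero
  rw [this, norm_zero] at hx
  exact zero_ne_one hx

/-- Far away from the origin, a ball of fixed radius has many disjoint images under `G`. -/
theorem exists_disjoint_balls (hn : 2 ≤ n)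
    {G : Subgroup (Matrix.specialOrthogonalGroup (Fin n) ℝ)} (hG : ActsTransitivelyOnSphere G)
    (N : ℕ) {ε : ℝ} (hε : 0 < ε) :
    ∃ R : ℝ, ∀ x : E n, R ≤ ‖x‖ → ∃ (s : Finset (E n))
      (g : E n → Matrix.specialOrthogonalGroup (Fin n) ℝ), s.card = N ∧ (∀ e, g e ∈ G) ∧
        (s : Set (E n)).PairwiseDisjoint fun e => Metric.ball (rot (g e) x) ε := by
  obtain ⟨s, hs, hcard⟩ := (infinite_sphere hn).exists_subset_card_eq N
  -- δ is the least distance between distinct points of s. With at most one point `Set.infsep` is 0,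
  -- and any positive number will do.
  obtain ⟨δ, hδ, hsep⟩ : ∃ δ : ℝ, 0 < δ ∧ ∀ e ∈ s, ∀ e' ∈ s, e ≠ e' → δ ≤ dist e e' := by
    by_cases h : (s : Set (E n)).Nontrivial
    · exact ⟨(s : Set (E n)).infsep, (s.finite_toSet.infsep_pos_iff_nontrivial).2 h,
        fun e he e' he' hne => Set.infsep_le_dist_of_mem he he' hne⟩
    · rw [Set.not_nontrivial_iff] at h
      exact ⟨1, one_pos, fun e he e' he' hne => (hne (h he he')).elim⟩
  -- The group moves x to the points ‖x‖ e with e in s. Their mutual distances are at least ‖x‖ δ ≥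
  -- 2ε, so the ε-balls around them are disjoint.
  refine ⟨2 * ε / δ, fun x hx => ?_⟩
  have hxpos : 0 < ‖x‖ := lt_of_lt_of_le (by positivity) hx
  have hy : ‖x‖⁻¹ • x ∈ Metric.sphere (0 : E n) 1 := by
    simp [norm_smul, inv_mul_cancel₀ hxpos.ne']
  have hch : ∀ e : E n, ∃ g ∈ G, e ∈ s → rot g x = ‖x‖ • e := by
    intro e
    by_cases he : e ∈ s
    · obtain ⟨g, hg, hge⟩ := hG _ hy e (hs he)
      refine ⟨g, hg, fun _ => ?_⟩
      rw [← hge, ← coe_rotEquiv, map_smul, smul_smul, mul_inv_cancel₀ hxpos.ne', one_smul]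
    · exact ⟨1, G.one_mem, fun h => (he h).elim⟩
  choose g hgG hg using hch
  refine ⟨s, g, hcard, hgG, fun e he e' he' hne => Metric.ball_disjoint_ball ?_⟩
  rw [hg e he, hg e' he', dist_eq_norm, ← smul_sub, norm_smul, norm_norm, ← dist_eq_norm]
  rw [div_le_iff₀ hδ] at hx
  have := mul_le_mul_of_nonneg_left (hsep e he e' he' hne) hxpos.le
  linarith

theorem lintegral_ball_rot (g : Matrix.specialOrthogonalGroup (Fin n) ℝ) {u : E n → V}
    (hu : ∀ᵐ x, ‖u (rot g x)‖ = ‖u x‖) (x : E n) (ε : ℝ) :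
    ∫⁻ y in Metric.ball (rot g x) ε, ‖u y‖ₑ ^ 2 = ∫⁻ y in Metric.ball x ε, ‖u y‖ₑ ^ 2 := by
  have hpre : rot g ⁻¹' Metric.ball (rot g x) ε = Metric.ball x ε := by
    rw [← coe_rotEquiv]
    exact (rotEquiv g).isometry.preimage_ball x ε
  have hemb : MeasurableEmbedding (rot g) :=
    (rotEquiv g).toHomeomorph.measurableEmbedding
  rw [← (measurePreserving_rot g).setLIntegral_comp_preimage_emb hemb, hpre]
  refine lintegral_congr_ae (ae_restrict_of_ae ?_)
  filter_upwards [hu] with y hy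
  rw [← ofReal_norm, ← ofReal_norm, hy]

/-- The `L²` mass in balls of fixed radius of functions with `G`-invariant norm is small far from
the origin. -/
theorem exists_lintegral_ball_le (hn : 2 ≤ n)
    {G : Subgroup (Matrix.specialOrthogonalGroup (Fin n) ℝ)} (hG : ActsTransitivelyOnSphere G)
    (N : ℕ) {ε : ℝ} (hε : 0 < ε) :
    ∃ R : ℝ, ∀ u : E n → V, (∀ g ∈ G, ∀ᵐ x, ‖u (rot g x)‖ = ‖u x‖) →
      ∀ x : E n, R ≤ ‖x‖ → N * ∫⁻ y in Metric.ball x ε, ‖u y‖ₑ ^ 2 ≤ ∫⁻ y, ‖u y‖ₑ ^ 2 := by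
  obtain ⟨R, hR⟩ := exists_disjoint_balls hn hG N hε
  refine ⟨R, fun u hu x hx => ?_⟩
  obtain ⟨s, g, hcard, hg, hdisj⟩ := hR x hx
  calc N * ∫⁻ y in Metric.ball x ε, ‖u y‖ₑ ^ 2
      = ∑ e ∈ s, ∫⁻ y in Metric.ball (rot (g e) x) ε, ‖u y‖ₑ ^ 2 := by
        rw [Finset.sum_congr rfl fun e _ => lintegral_ball_rot (g e) (hu _ (hg e)) x ε]
        simp [hcard]
    _ = ∫⁻ y in ⋃ e ∈ s, Metric.ball (rot (g e) x) ε, ‖u y‖ₑ ^ 2 :=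
        (lintegral_biUnion_finset hdisj (fun _ _ => Metric.isOpen_ball.measurableSet) _).symm
    _ ≤ ∫⁻ y, ‖u y‖ₑ ^ 2 := setLIntegral_le_lintegral _ _

end Rotation

/-! ### Interpolation between L² and L^r -/

section Norms

variable {X W : Type*} [MeasurableSpace X] {μ : Measure X} [NormedAddCommGroup W]

theorem eLpNorm_ofReal_rpow {q : ℝ} (hq : 0 < q) (f : X → W) :
    eLpNorm f (ENNReal.ofReal q) μ ^ q = ∫⁻ x, ‖f x‖ₑ ^ q ∂μ := by
  rw [eLpNorm_eq_lintegral_rpow_enorm_toReal (by simpa using hq) (by simp),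
    ENNReal.toReal_ofReal hq.le, ← ENNReal.rpow_mul, one_div, inv_mul_cancel₀ hq.ne',
    ENNReal.rpow_one]

theorem eLpNorm_two_sq (f : X → W) : eLpNorm f 2 μ ^ 2 = ∫⁻ x, ‖f x‖ₑ ^ 2 ∂μ := by
  have := eLpNorm_ofReal_rpow (μ := μ) two_pos f
  simpa using this

/-- Interpolation of Lebesgue norms. -/
theorem exists_eLpNorm_le_interpolate {q r : ℝ} (hq : 2 < q) (hr : q < r) :
    ∃ a b : ℝ, 0 < a ∧ 0 ≤ b ∧ ∀ f : X → W, AEStronglyMeasurable f μ →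
      eLpNorm f (ENNReal.ofReal q) μ
        ≤ eLpNorm f 2 μ ^ a * eLpNorm f (ENNReal.ofReal r) μ ^ b := by
  -- The weight with q = 2 s + r (1 - s), for Hölder. As q < r it is positive, so the L² norm enters
  -- with a positive power and smallness in L² passes to L^q.
  set s : ℝ := (r - q) / (r - 2) with hs
  have hr2 : 0 < r - 2 := by linarith
  have hs0 : 0 < s := div_pos (by linarith) hr2
  have hs1 : 0 ≤ 1 - s := by
    rw [hs, sub_nonneg, div_le_one hr2]; linarith
  have hq0 : 0 < q := by linarith
  have hr0 : 0 < r := by linarith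
  have hqs : q = 2 * s + r * (1 - s) := by
    rw [hs]; field_simp; ring
  refine ⟨2 * s / q, r * (1 - s) / q, by positivity, by positivity, fun f hf => ?_⟩
  have h1 := ENNReal.lintegral_mul_norm_pow_le (μ := μ) (f := fun x => ‖f x‖ₑ ^ (2 : ℝ))
    (g := fun x => ‖f x‖ₑ ^ r) (hf.enorm.pow_const _) (hf.enorm.pow_const _) hs0.le hs1 (by ring)
  have h2 : ∫⁻ x, ‖f x‖ₑ ^ q ∂μ = ∫⁻ x, (‖f x‖ₑ ^ (2 : ℝ)) ^ s * (‖f x‖ₑ ^ r) ^ (1 - s) ∂μ := by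
    refine lintegral_congr fun x => ?_
    rw [← ENNReal.rpow_mul, ← ENNReal.rpow_mul, ← ENNReal.rpow_add_of_nonneg _ _
      (by positivity) (by positivity), ← hqs]
  rw [← h2, ← eLpNorm_ofReal_rpow hq0, ← eLpNorm_ofReal_rpow two_pos,
    ← eLpNorm_ofReal_rpow hr0, ENNReal.ofReal_ofNat, ← ENNReal.rpow_mul, ← ENNReal.rpow_mul] at h1
  have h3 := ENNReal.rpow_le_rpow h1 (inv_nonneg.2 hq0.le)
  rw [← ENNReal.rpow_mul, mul_inv_cancel₀ hq0.ne', ENNReal.rpow_one,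
    ENNReal.mul_rpow_of_nonneg _ _ (inv_nonneg.2 hq0.le), ← ENNReal.rpow_mul,
    ← ENNReal.rpow_mul] at h3
  simpa [div_eq_mul_inv] using h3

end Norms

/-! ### Compactness in L^q for invariant norms -/

section Compactness

/-- Mollifications of a bounded sequence with `G`-invariant norms that tend to zero pointwise tend
to zero in `L^q` for `q > 2`. -/
theorem tendsto_eLpNorm_moll [CompleteSpace V] (hn : 2 ≤ n)
    {G : Subgroup (Matrix.specialOrthogonalGroup (Fin n) ℝ)} (hG : ActsTransitivelyOnSphere G)
    {q : ℝ} (hq : 2 < q) {u : ℕ → E n → V} (hu : ∀ k, MemLp (u k) 2 volume)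
    (hinv : ∀ k, ∀ g ∈ G, ∀ᵐ x, ‖u k (rot g x)‖ = ‖u k x‖) {M : ℝ≥0}
    (hM : ∀ k, eLpNorm (u k) 2 volume ≤ M) (φ : ContDiffBump (0 : E n))
    (hφ : ∀ x, Tendsto (fun k => moll φ (u k) x) atTop (𝓝 0)) :
    Tendsto (fun k => eLpNorm (moll φ (u k)) (ENNReal.ofReal q) volume) atTop (𝓝 0) := by
  have hq0 : 0 < q := by linarith
  obtain ⟨C, hC⟩ := enorm_moll_sq_le (V := V) φ
  have hcont : ∀ k, Continuous (moll φ (u k)) := fun k =>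
    (contDiff_moll φ ((hu k).locallyIntegrable (by norm_num))).continuous
  have hmass : ∀ k, ∫⁻ y, ‖u k y‖ₑ ^ 2 ≤ (M : ℝ≥0∞) ^ 2 := fun k => by
    rw [← eLpNorm_two_sq]; gcongr; exact hM k
  have hbd : ∀ k x, ‖moll φ (u k) x‖ₑ ≤ ((C * M ^ 2 : ℝ≥0) : ℝ≥0∞) ^ (1 / 2 : ℝ) := by
    intro k x
    have h := (hC (u k) x).trans (mul_le_mul_right ((setLIntegral_le_lintegral _ _).trans (hmass k)) _)
    have h2 := ENNReal.rpow_le_rpow h (by norm_num : (0 : ℝ) ≤ 1 / 2)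
    rw [← ENNReal.rpow_natCast, ← ENNReal.rpow_mul] at h2
    simpa using h2
  have key : Tendsto (fun k => ∫⁻ x, ‖moll φ (u k) x‖ₑ ^ q) atTop (𝓝 0) := by
    rw [ENNReal.tendsto_nhds_zero]
    intro ε hε
    -- Where the mollification is at most η, the integral of its q-th power is at most η^(q-2) M²;
    -- this uses q > 2.
    obtain ⟨η, hη, hηε⟩ : ∃ η : ℝ≥0, 0 < η ∧
        (η : ℝ≥0∞) ^ (q - 2) * (M : ℝ≥0∞) ^ 2 ≤ ε / 2 := by
      have h1 : Tendsto (fun η : ℝ≥0 => (η : ℝ≥0∞) ^ (q - 2) * (M : ℝ≥0∞) ^ 2) (𝓝 0) (𝓝 0) := by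
        have h2 : Tendsto (fun η : ℝ≥0 => (η : ℝ≥0∞) ^ (q - 2)) (𝓝 0) (𝓝 (((0 : ℝ≥0) : ℝ≥0∞) ^ (q - 2))) :=
          (ENNReal.tendsto_coe.2 tendsto_id).ennrpow_const _
        rw [ENNReal.coe_zero, ENNReal.zero_rpow_of_pos (by linarith)] at h2
        have := ENNReal.Tendsto.mul_const h2 (b := (M : ℝ≥0∞) ^ 2) (Or.inr (by simp))
        simpa using this
      have h3 := (ENNReal.tendsto_nhds_zero.1 h1 (ε / 2) (ENNReal.half_pos hε.ne'))
      have h4 : ∀ᶠ η : ℝ≥0 in 𝓝[>] 0, (η : ℝ≥0∞) ^ (q - 2) * (M : ℝ≥0∞) ^ 2 ≤ ε / 2 :=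
        h3.filter_mono nhdsWithin_le_nhds
      obtain ⟨η, h5, h6⟩ := (h4.and self_mem_nhdsWithin).exists
      exact ⟨η, h6, h5⟩
    -- With N disjoint images a distant ball has mass at most M²/N, and the choice of N makes C M²/N
    -- at most η².
    obtain ⟨N, hN⟩ := exists_nat_gt ((C * M ^ 2 : ℝ≥0) / η ^ 2)
    obtain ⟨R, hR⟩ := exists_lintegral_ball_le (V := V) hn hG N φ.rOut_pos
    have htail : ∀ k x, R ≤ ‖x‖ → ‖moll φ (u k) x‖ₑ ≤ η := by
      intro k x hx
      have h1 := (hR (u k) (hinv k) x hx).trans (hmass k)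
      have hNpos : (0 : ℝ≥0) < N := lt_of_le_of_lt (by positivity) hN
      rw [div_lt_iff₀ (by positivity)] at hN
      have h2 : ∫⁻ y in Metric.ball x φ.rOut, ‖u k y‖ₑ ^ 2 ≤ ((M ^ 2 / N : ℝ≥0) : ℝ≥0∞) := by
        rw [ENNReal.coe_div hNpos.ne']
        rw [ENNReal.le_div_iff_mul_le (by left; simpa using hNpos.ne') (by left; simp), mul_comm]
        simpa using h1
      have h3 : ‖moll φ (u k) x‖ₑ ^ 2 ≤ (η : ℝ≥0∞) ^ 2 := by
        refine (hC (u k) x).trans ((mul_le_mul_right h2 _).trans ?_)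
        norm_cast
        rw [mul_div_assoc', div_le_iff₀ hNpos, mul_comm (η ^ 2)]
        exact hN.le
      exact (ENNReal.pow_le_pow_left_iff two_ne_zero).1 h3
    have hloc : Tendsto (fun k => ∫⁻ x in Metric.ball 0 R, ‖moll φ (u k) x‖ₑ ^ q) atTop (𝓝 0) := by
      have h0 : ∫⁻ x in Metric.ball (0 : E n) R, (0 : ℝ≥0∞) = 0 := by simp
      rw [← h0]
      refine tendsto_lintegral_of_dominated_convergence
        (fun _ => (((C * M ^ 2 : ℝ≥0) : ℝ≥0∞) ^ (1 / 2 : ℝ)) ^ q)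
        (fun k => ((hcont k).enorm.measurable.pow_const _))
        (fun k => ae_of_all _ fun x => ENNReal.rpow_le_rpow (hbd k x) hq0.le) ?_ (ae_of_all _ fun x => ?_)
      · rw [lintegral_const]
        refine ENNReal.mul_ne_top ?_ ?_
        · exact ENNReal.rpow_ne_top_of_nonneg hq0.le
            (ENNReal.rpow_ne_top_of_nonneg (by norm_num) ENNReal.coe_ne_top)
        · rw [Measure.restrict_apply_univ]
          exact measure_ball_lt_top.ne
      · have := ((hφ x).enorm).ennrpow_const q
        rwa [enorm_zero, ENNReal.zero_rpow_of_pos hq0] at this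
    filter_upwards [ENNReal.tendsto_nhds_zero.1 hloc (ε / 2) (ENNReal.half_pos hε.ne')] with k hk
    rw [← lintegral_add_compl _ (Metric.isOpen_ball (x := (0 : E n)) (ε := R)).measurableSet,
      ← ENNReal.add_halves ε]
    refine add_le_add hk (le_trans ?_ hηε)
    calc ∫⁻ x in (Metric.ball (0 : E n) R)ᶜ, ‖moll φ (u k) x‖ₑ ^ q
        ≤ ∫⁻ x in (Metric.ball (0 : E n) R)ᶜ, (η : ℝ≥0∞) ^ (q - 2) * ‖moll φ (u k) x‖ₑ ^ 2 := by
          refine setLIntegral_mono' Metric.isOpen_ball.measurableSet.compl fun x hx => ?_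
          have hx' : R ≤ ‖x‖ := by simpa using hx
          calc ‖moll φ (u k) x‖ₑ ^ q
              = ‖moll φ (u k) x‖ₑ ^ (q - 2) * ‖moll φ (u k) x‖ₑ ^ 2 := by
                rw [← ENNReal.rpow_natCast, ← ENNReal.rpow_add_of_nonneg _ _ (by linarith)
                  (by norm_num)]
                simp
            _ ≤ _ := mul_le_mul_left
                (ENNReal.rpow_le_rpow (htail k x hx') (by linarith : 0 ≤ q - 2)) _
      _ ≤ ∫⁻ x, (η : ℝ≥0∞) ^ (q - 2) * ‖moll φ (u k) x‖ₑ ^ 2 := setLIntegral_le_lintegral _ _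
      _ = (η : ℝ≥0∞) ^ (q - 2) * ∫⁻ x, ‖moll φ (u k) x‖ₑ ^ 2 :=
          lintegral_const_mul _ ((hcont k).enorm.measurable.pow_const _)
      _ ≤ (η : ℝ≥0∞) ^ (q - 2) * (M : ℝ≥0∞) ^ 2 := by
          gcongr
          rw [← eLpNorm_two_sq]
          gcongr
          exact (eLpNorm_moll_le φ (hu k).1 (by norm_num) (by norm_num)).trans (hM k)
  have := key.ennrpow_const q⁻¹
  rw [ENNReal.zero_rpow_of_pos (inv_pos.2 hq0)] at this
  refine this.congr fun k => ?_
  rw [← eLpNorm_ofReal_rpow hq0, ← ENNReal.rpow_mul, mul_inv_cancel₀ hq0.ne', ENNReal.rpow_one]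

/-- Compactness of the embedding of the functions in `H¹` with `G`-invariant norm into `L^q`. -/
theorem tendsto_eLpNorm_of_tendsto_moll [CompleteSpace V] (hn : 2 ≤ n)
    {G : Subgroup (Matrix.specialOrthogonalGroup (Fin n) ℝ)} (hG : ActsTransitivelyOnSphere G)
    {q : ℝ} (hq : 2 < q) (hq' : 2 < n → q < 2 * n / ((n : ℝ) - 2))
    {u : ℕ → E n → V} {w : ℕ → Fin n → E n → V} (hu : ∀ k, IsH1 (u k) (w k))
    (hinv : ∀ k, ∀ g ∈ G, ∀ᵐ x, ‖u k (rot g x)‖ = ‖u k x‖) {M : ℝ≥0}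
    (hM : ∀ k, eLpNorm (u k) 2 volume ≤ M) (hM' : ∀ k, gradSum (w k) ≤ M)
    (hφ : ∀ (φ : ContDiffBump (0 : E n)) (x : E n),
      Tendsto (fun k => moll φ (u k) x) atTop (𝓝 0)) :
    Tendsto (fun k => eLpNorm (u k) (ENNReal.ofReal q) volume) atTop (𝓝 0) := by
  obtain ⟨r, C, γ, δ, hr, hγ, hδ, hsob⟩ := exists_sobolev (V := V) hn hq'
  obtain ⟨a, b, ha, hb, hint⟩ := exists_eLpNorm_le_interpolate (X := E n) (W := V)
    (μ := volume) hq hr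
  rw [ENNReal.ofReal_coe_nnreal] at hint
  have hr1 : (1 : ℝ≥0∞) ≤ r := by
    have : (1 : ℝ≥0) ≤ r := by
      have : (1 : ℝ) ≤ r := by linarith
      exact_mod_cast this
    exact_mod_cast this
  set K : ℝ≥0∞ := C * (M : ℝ≥0∞) ^ δ * (M : ℝ≥0∞) ^ γ with hK
  have hKtop : K ≠ ⊤ := ENNReal.mul_ne_top (ENNReal.mul_ne_top ENNReal.coe_ne_top
    (ENNReal.rpow_ne_top_of_nonneg hδ ENNReal.coe_ne_top))
    (ENNReal.rpow_ne_top_of_nonneg hγ.le ENNReal.coe_ne_top)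
  have hur : ∀ k, eLpNorm (u k) r volume ≤ K := by
    intro k
    refine (hsob _ _ (hu k)).trans ?_
    rw [hK]
    gcongr
    · exact hM k
    · exact hM' k
  -- Interpolation between an L² error of order the bump radius and a bounded L^r norm; the bound
  -- does not depend on k.
  have hdiff : ∀ k j, eLpNorm (fun x => moll (smallBump n j) (u k) x - u k x) (ENNReal.ofReal q)
      volume ≤ (ENNReal.ofReal (smallBump n j).rOut * M) ^ a * (K + K) ^ b := by
    intro k j
    have hcont : Continuous (moll (smallBump n j) (u k)) :=
      (contDiff_moll _ (hu k).locallyIntegrable).continuous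
    refine (hint _ (hcont.aestronglyMeasurable.sub (hu k).1.1)).trans ?_
    gcongr
    · refine ((hu k).eLpNorm_moll_sub_le _).trans ?_
      gcongr
      exact hM' k
    · refine (eLpNorm_sub_le hcont.aestronglyMeasurable (hu k).1.1 hr1).trans ?_
      exact add_le_add ((eLpNorm_moll_le _ (hu k).1.1 hr1 ENNReal.coe_ne_top).trans (hur k)) (hur k)
  have hsmall : Tendsto (fun j => (ENNReal.ofReal (smallBump n j).rOut * M) ^ a * (K + K) ^ b)
      atTop (𝓝 0) := by
    have h1 := ENNReal.tendsto_ofReal (tendsto_smallBump_rOut n)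
    have h2 := (ENNReal.Tendsto.mul_const h1 (b := (M : ℝ≥0∞))
      (Or.inr ENNReal.coe_ne_top)).ennrpow_const a
    rw [ENNReal.ofReal_zero, zero_mul, ENNReal.zero_rpow_of_pos ha] at h2
    have h3 := ENNReal.Tendsto.mul_const h2 (b := (K + K) ^ b)
      (Or.inr (ENNReal.rpow_ne_top_of_nonneg hb (by simp [hKtop])))
    rwa [zero_mul] at h3
  rw [ENNReal.tendsto_nhds_zero]
  intro ε hε
  have hε2 := ENNReal.half_pos hε.ne'
  -- The mollification scale is fixed first, uniformly in k; only then does k tend to infinity.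
  obtain ⟨j, hj⟩ := (ENNReal.tendsto_nhds_zero.1 hsmall _ hε2).exists
  have hm := tendsto_eLpNorm_moll hn hG hq (fun k => (hu k).1) hinv hM (smallBump n j)
    (hφ (smallBump n j))
  filter_upwards [ENNReal.tendsto_nhds_zero.1 hm _ hε2] with k hk
  have hcont : Continuous (moll (smallBump n j) (u k)) :=
    (contDiff_moll _ (hu k).locallyIntegrable).continuous
  have hdec : u k = moll (smallBump n j) (u k) - fun x => moll (smallBump n j) (u k) x - u k x := by
    ext x; simp
  rw [hdec, ← ENNReal.add_halves ε]
  refine (eLpNorm_sub_le hcont.aestronglyMeasurable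
    (hcont.aestronglyMeasurable.sub (hu k).1.1) ?_).trans (add_le_add hk ((hdiff k j).trans hj))
  rw [ENNReal.one_le_ofReal]
  linarith

end Compactness

end SphericalVortex

end

open Filter Topology
open scoped ENNReal NNReal RealInnerProductSpace

noncomputable section

namespace SphericalVortex

/-! ### Weak sequential compactness in Hilbert spaces -/

section WeakSequences

/-- A bounded sequence in a separable Hilbert space has a weakly convergent subsequence. -/
theorem exists_weakly_convergent_subseq {X : Type*} [NormedAddCommGroup X] [InnerProductSpace ℝ X]
    [CompleteSpace X] [TopologicalSpace.SeparableSpace X] {x : ℕ → X} {M : ℝ}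
    (hx : ∀ k, ‖x k‖ ≤ M) :
    ∃ (y : X) (σ : ℕ → ℕ), StrictMono σ ∧
      ∀ z : X, Tendsto (fun k => ⟪x (σ k), z⟫) atTop (𝓝 ⟪y, z⟫) := by
  have hcomp := WeakDual.isSeqCompact_closedBall ℝ X 0 M
  let f : ℕ → WeakDual ℝ X := fun k =>
    StrongDual.toWeakDual (InnerProductSpace.toDual ℝ X (x k))
  have hf : ∀ k, f k ∈ WeakDual.toStrongDual ⁻¹' Metric.closedBall (0 : StrongDual ℝ X) M := by
    intro k
    have : ‖InnerProductSpace.toDual ℝ X (x k)‖ ≤ M := by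
      rw [LinearIsometryEquiv.norm_map]; exact hx k
    simpa [f] using this
  obtain ⟨a, -, σ, hσ, hlim⟩ := hcomp hf
  refine ⟨(InnerProductSpace.toDual ℝ X).symm (WeakDual.toStrongDual a), σ, hσ, fun z => ?_⟩
  have := ((WeakDual.eval_continuous z).tendsto a).comp hlim
  rw [InnerProductSpace.toDual_symm_apply]
  exact this

/-- A closed subspace of a Hilbert space is closed under weak limits of sequences. -/
theorem mem_of_weakly_convergent {X : Type*} [NormedAddCommGroup X] [InnerProductSpace ℝ X]
    [CompleteSpace X] {S : Submodule ℝ X} (hS : IsClosed (S : Set X)) {x : ℕ → X} {y : X}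
    (hx : ∀ k, x k ∈ S) (h : ∀ z : X, Tendsto (fun k => ⟪x k, z⟫) atTop (𝓝 ⟪y, z⟫)) : y ∈ S := by
  have : CompleteSpace S := hS.completeSpace_coe
  -- A closed subspace is its double orthogonal complement, hence cut out by equations ⟪·, z⟫ = 0,
  -- which survive weak limits.
  rw [← Submodule.orthogonal_orthogonal S]
  intro z hz
  rw [real_inner_comm]
  refine tendsto_nhds_unique (h z) ?_
  have : ∀ k, ⟪x k, z⟫ = 0 := fun k => hz _ (hx k)
  simp [this]

end WeakSequences

/-! ### H¹ as a closed subspace of tuples of L² functions -/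

variable {n : ℕ} {F : Type*} [NormedAddCommGroup F] [InnerProductSpace ℝ F]

theorem integrable_inner_of_memLp {u v : E n → F} (hu : MemLp u 2 volume) (hv : MemLp v 2 volume) :
    Integrable (fun x => ⟪u x, v x⟫) volume := by
  refine (L2.integrable_inner (𝕜 := ℝ) (hu.toLp u) (hv.toLp v)).congr ?_
  filter_upwards [hu.coeFn_toLp, hv.coeFn_toLp] with x h1 h2
  rw [h1, h2]

theorem inner_toLp {u v : E n → F} (hu : MemLp u 2 volume) (hv : MemLp v 2 volume) :
    ⟪hu.toLp u, hv.toLp v⟫ = ∫ x, ⟪u x, v x⟫ := by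
  rw [L2.inner_def]
  refine integral_congr_ae ?_
  filter_upwards [hu.coeFn_toLp, hv.coeFn_toLp] with x h1 h2
  rw [h1, h2]

/-- The weak partial derivative for functions with values in a real inner product space. -/
def HasWeakPartial (i : Fin n) (u w : E n → F) : Prop :=
  ∀ φ : E n → ℝ, ContDiff ℝ ∞ φ → HasCompactSupport φ →
    ∫ x, (fderiv ℝ φ x (EuclideanSpace.single i 1)) • u x = -∫ x, φ x • w x

theorem memLp_smul_const {φ : E n → ℝ} (hφ : Continuous φ) (hc : HasCompactSupport φ) (e : F) :
    MemLp (fun x => φ x • e) 2 volume :=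
  (hφ.smul continuous_const).memLp_of_hasCompactSupport
    (hc.mono fun x hx h0 => hx (by simp [h0]))

theorem integrable_test_smul {φ : E n → ℝ} (hφ : Continuous φ) (hc : HasCompactSupport φ)
    {u : E n → F} (hu : LocallyIntegrable u volume) : Integrable (fun x => φ x • u x) volume :=
  hu.integrable_smul_left_of_hasCompactSupport hφ hc

theorem continuous_fderiv_single {φ : E n → ℝ} (hφ : ContDiff ℝ ∞ φ) (i : Fin n) :
    Continuous fun x => fderiv ℝ φ x (EuclideanSpace.single i 1) :=
  (hφ.continuous_fderiv (by simp)).clm_apply continuous_const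

theorem hasCompactSupport_fderiv_single {φ : E n → ℝ} (hc : HasCompactSupport φ) (i : Fin n) :
    HasCompactSupport fun x => fderiv ℝ φ x (EuclideanSpace.single i 1) :=
  (hc.fderiv ℝ).mono fun x hx h0 => hx (by simp [h0])

theorem inner_integral_test_smul [CompleteSpace F] {φ : E n → ℝ} (hφ : Continuous φ)
    (hc : HasCompactSupport φ) {u : E n → F} (hu : LocallyIntegrable u volume) (e : F) :
    ⟪∫ x, φ x • u x, e⟫ = ∫ x, ⟪u x, φ x • e⟫ := by
  rw [real_inner_comm, ← integral_inner (integrable_test_smul hφ hc hu) e]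
  refine integral_congr_ae (ae_of_all _ fun x => ?_)
  simp only [inner_smul_right]
  rw [real_inner_comm]

/-- Pairing the vector identity with each e in F turns it into equalities of L² inner products with
the fixed functions ∂ᵢφ • e and φ • e. In this form the condition is visibly closed. -/
theorem hasWeakPartial_iff [CompleteSpace F] {i : Fin n} {u w : E n → F}
    (hu : LocallyIntegrable u volume) (hw : LocallyIntegrable w volume) :
    HasWeakPartial i u w ↔ ∀ φ : E n → ℝ, ContDiff ℝ ∞ φ → HasCompactSupport φ → ∀ e : F,
      (∫ x, ⟪u x, (fderiv ℝ φ x (EuclideanSpace.single i 1)) • e⟫) = -∫ x, ⟪w x, φ x • e⟫ := by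
  refine forall₃_congr fun φ hφ hc => ?_
  rw [← sub_eq_zero, sub_neg_eq_add, ext_iff_inner_right ℝ]
  refine forall_congr' fun e => ?_
  rw [inner_zero_left, inner_add_left,
    inner_integral_test_smul (continuous_fderiv_single hφ i)
      (hasCompactSupport_fderiv_single hc i) hu, inner_integral_test_smul hφ.continuous hc hw,
    eq_neg_iff_add_eq_zero]

/-- Square integrable vector fields on `ℝⁿ`. -/
abbrev L2 (n : ℕ) (F : Type*) [NormedAddCommGroup F] := Lp F 2 (volume : Measure (E n))

/-- The Hilbert space of tuples consisting of a function and a candidate for its gradient. -/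
abbrev L2Tuple (n : ℕ) (F : Type*) [NormedAddCommGroup F] :=
  PiLp 2 (fun _ : Option (Fin n) => L2 n F)

theorem secondCountableTopology_L2 [FiniteDimensional ℝ F] : SecondCountableTopology (L2 n F) := by
  have : ProperSpace F := FiniteDimensional.proper ℝ F
  have : Fact ((2 : ℝ≥0∞) ≠ ⊤) := ⟨by norm_num⟩
  infer_instance

theorem separableSpace_L2Tuple [FiniteDimensional ℝ F] :
    TopologicalSpace.SeparableSpace (L2Tuple n F) := by
  have : SecondCountableTopology (L2 n F) := secondCountableTopology_L2
  have e := (PiLp.continuousLinearEquiv 2 ℝ (fun _ : Option (Fin n) => L2 n F)).toHomeomorph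
  have := e.isEmbedding.secondCountableTopology
  infer_instance

/-- The tuple of classes of a function and of its gradient. -/
def mkTuple {u : E n → F} {w : Fin n → E n → F} (hu : MemLp u 2 volume)
    (hw : ∀ i, MemLp (w i) 2 volume) : L2Tuple n F :=
  WithLp.toLp 2 fun o => o.elim (hu.toLp u) fun i => (hw i).toLp (w i)

theorem inner_mkTuple {u v : E n → F} {w z : Fin n → E n → F} (hu : MemLp u 2 volume)
    (hw : ∀ i, MemLp (w i) 2 volume) (hv : MemLp v 2 volume) (hz : ∀ i, MemLp (z i) 2 volume) :
    ⟪mkTuple hu hw, mkTuple hv hz⟫ = (∫ x, ⟪u x, v x⟫) + ∑ i, ∫ x, ⟪w i x, z i x⟫ := by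
  rw [PiLp.inner_apply, Fintype.sum_option]
  simp only [mkTuple, Option.elim_none, Option.elim_some, inner_toLp]

theorem mkTuple_coe (x : L2Tuple n F) :
    mkTuple (Lp.memLp (x none)) (fun i => Lp.memLp (x (some i))) = x := by
  ext o : 1
  cases o <;> simp [mkTuple]

/-- The Sobolev space `H¹` as a subspace of the tuples. -/
def sobolevSpace (n : ℕ) (F : Type*) [NormedAddCommGroup F] [InnerProductSpace ℝ F] :
    Submodule ℝ (L2Tuple n F) where
  carrier := {x | ∀ i, HasWeakPartial i (x none) (x (some i))}
  zero_mem' := by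
    intro i φ hφ hc
    have h0 : ∀ᵐ x, ((0 : L2 n F) : E n → F) x = 0 := Lp.coeFn_zero F 2 volume
    have h1 : ∫ x, (fderiv ℝ φ x (EuclideanSpace.single i 1)) • ((0 : L2 n F) : E n → F) x = 0 := by
      rw [← integral_zero (E n) F]
      exact integral_congr_ae (h0.mono fun x hx => by simp)
    have h2 : ∫ x, φ x • ((0 : L2 n F) : E n → F) x = 0 := by
      rw [← integral_zero (E n) F]
      exact integral_congr_ae (h0.mono fun x hx => by simp)
    simp only [PiLp.zero_apply, h1, h2, neg_zero]
  add_mem' := by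
    intro a b ha hb i φ hφ hc
    have hl : ∀ f : L2 n F, LocallyIntegrable f volume := fun f =>
      (Lp.memLp f).locallyIntegrable (by norm_num)
    have h1 := continuous_fderiv_single hφ i
    have h2 := hasCompactSupport_fderiv_single hc i
    have e1 : ∫ x, (fderiv ℝ φ x (EuclideanSpace.single i 1)) • ((a + b) none : E n → F) x
        = (∫ x, (fderiv ℝ φ x (EuclideanSpace.single i 1)) • (a none : E n → F) x)
          + ∫ x, (fderiv ℝ φ x (EuclideanSpace.single i 1)) • (b none : E n → F) x := by
      rw [← integral_add (integrable_test_smul h1 h2 (hl _)) (integrable_test_smul h1 h2 (hl _))]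
      refine integral_congr_ae ?_
      filter_upwards [Lp.coeFn_add (a none) (b none)] with x hx
      rw [PiLp.add_apply, hx, Pi.add_apply, smul_add]
    have e2 : ∫ x, φ x • ((a + b) (some i) : E n → F) x
        = (∫ x, φ x • (a (some i) : E n → F) x) + ∫ x, φ x • (b (some i) : E n → F) x := by
      rw [← integral_add (integrable_test_smul hφ.continuous hc (hl _))
        (integrable_test_smul hφ.continuous hc (hl _))]
      refine integral_congr_ae ?_
      filter_upwards [Lp.coeFn_add (a (some i)) (b (some i))] with x hx
      rw [PiLp.add_apply, hx, Pi.add_apply, smul_add]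
    rw [e1, e2, ha i φ hφ hc, hb i φ hφ hc, neg_add]
  smul_mem' := by
    intro c a ha i φ hφ hc
    have e1 : ∫ x, (fderiv ℝ φ x (EuclideanSpace.single i 1)) • ((c • a) none : E n → F) x
        = c • ∫ x, (fderiv ℝ φ x (EuclideanSpace.single i 1)) • (a none : E n → F) x := by
      rw [← integral_smul]
      refine integral_congr_ae ?_
      filter_upwards [Lp.coeFn_smul c (a none)] with x hx
      rw [PiLp.smul_apply, hx, Pi.smul_apply, smul_comm]
    have e2 : ∫ x, φ x • ((c • a) (some i) : E n → F) x
        = c • ∫ x, φ x • (a (some i) : E n → F) x := by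
      rw [← integral_smul]
      refine integral_congr_ae ?_
      filter_upwards [Lp.coeFn_smul c (a (some i))] with x hx
      rw [PiLp.smul_apply, hx, Pi.smul_apply, smul_comm]
    rw [e1, e2, ha i φ hφ hc, smul_neg]

theorem mem_sobolevSpace {x : L2Tuple n F} :
    x ∈ sobolevSpace n F ↔ ∀ i, HasWeakPartial i (x none) (x (some i)) := Iff.rfl

theorem HasWeakPartial.congr {i : Fin n} {u u' w w' : E n → F} (h : HasWeakPartial i u w)
    (hu : u =ᵐ[volume] u') (hw : w =ᵐ[volume] w') : HasWeakPartial i u' w' := by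
  intro φ hφ hc
  have e1 : ∫ x, (fderiv ℝ φ x (EuclideanSpace.single i 1)) • u' x
      = ∫ x, (fderiv ℝ φ x (EuclideanSpace.single i 1)) • u x :=
    integral_congr_ae (hu.mono fun x hx => by simp [hx])
  have e2 : ∫ x, φ x • w' x = ∫ x, φ x • w x :=
    integral_congr_ae (hw.mono fun x hx => by simp [hx])
  rw [e1, e2]
  exact h φ hφ hc

theorem mkTuple_mem_sobolevSpace {u : E n → F} {w : Fin n → E n → F} (hu : MemLp u 2 volume)
    (hw : ∀ i, MemLp (w i) 2 volume) (h : ∀ i, HasWeakPartial i u (w i)) :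
    mkTuple hu hw ∈ sobolevSpace n F :=
  fun i => (h i).congr hu.coeFn_toLp.symm (hw i).coeFn_toLp.symm

theorem isClosed_sobolevSpace [CompleteSpace F] : IsClosed (sobolevSpace n F : Set (L2Tuple n F)) := by
  have hset : (sobolevSpace n F : Set (L2Tuple n F)) = ⋂ (i : Fin n) (φ : E n → ℝ)
      (_ : ContDiff ℝ ∞ φ) (_ : HasCompactSupport φ) (e : F),
      {x : L2Tuple n F | (∫ y, ⟪(x none : E n → F) y,
        (fderiv ℝ φ y (EuclideanSpace.single i 1)) • e⟫)
        = -∫ y, ⟪(x (some i) : E n → F) y, φ y • e⟫} := by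
    ext x
    simp only [Set.mem_iInter, Set.mem_ofPred_eq, SetLike.mem_coe, mem_sobolevSpace]
    exact forall_congr' fun i => hasWeakPartial_iff
      ((Lp.memLp _).locallyIntegrable (by norm_num)) ((Lp.memLp _).locallyIntegrable (by norm_num))
  rw [hset]
  refine isClosed_iInter fun i => isClosed_iInter fun φ => isClosed_iInter fun hφ =>
    isClosed_iInter fun hc => isClosed_iInter fun e => ?_
  have key : ∀ (o : Option (Fin n)) (v : E n → F), MemLp v 2 volume →
      Continuous fun x : L2Tuple n F => ∫ y, ⟪(x o : E n → F) y, v y⟫ := by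
    intro o v hv
    have : (fun x : L2Tuple n F => ∫ y, ⟪(x o : E n → F) y, v y⟫)
        = fun x => ⟪x o, hv.toLp v⟫ := by
      ext x
      conv_rhs => rw [← Lp.toLp_coeFn (x o) (Lp.memLp _)]
      rw [inner_toLp]
    rw [this]
    exact (PiLp.continuous_apply 2 _ o).inner continuous_const
  exact isClosed_eq
    (key none _ (memLp_smul_const (continuous_fderiv_single hφ i)
      (hasCompactSupport_fderiv_single hc i) e))
    (key (some i) _ (memLp_smul_const hφ.continuous hc e)).neg

/-- The square integrable functions `f` with `f ∘ T = A ∘ f`. -/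
def intertwiningSpace {T : E n → E n} (hT : MeasurePreserving T volume volume) (A : F →L[ℝ] F) :
    Submodule ℝ (L2 n F) :=
  LinearMap.eqLocus (Lp.compMeasurePreservingₗᵢ ℝ T hT).toLinearMap
    (ContinuousLinearMap.compLpL 2 volume A : L2 n F →L[ℝ] L2 n F).toLinearMap

theorem mem_intertwiningSpace {T : E n → E n} (hT : MeasurePreserving T volume volume)
    (A : F →L[ℝ] F) (f : L2 n F) :
    f ∈ intertwiningSpace hT A ↔ ∀ᵐ x, (f : E n → F) (T x) = A ((f : E n → F) x) := by
  have h1 := Lp.coeFn_compMeasurePreserving f hT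
  have h2 := A.coeFn_compLpL (p := 2) (μ := volume) f
  rw [intertwiningSpace, LinearMap.mem_eqLocus]
  constructor
  · intro h
    have h' : Lp.compMeasurePreserving T hT f = ContinuousLinearMap.compLpL 2 volume A f := h
    rw [h'] at h1
    filter_upwards [h1, h2] with x h1 h2
    rw [← h2, h1, Function.comp_apply]
  · intro h
    have h' : Lp.compMeasurePreserving T hT f = ContinuousLinearMap.compLpL 2 volume A f := by
      refine Lp.ext ?_
      filter_upwards [h1, h2, h] with x h1 h2 h
      rw [h1, h2, Function.comp_apply, h]
    exact h'

theorem isClosed_intertwiningSpace {T : E n → E n} (hT : MeasurePreserving T volume volume)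
    (A : F →L[ℝ] F) : IsClosed (intertwiningSpace hT A : Set (L2 n F)) :=
  isClosed_eq (Lp.compMeasurePreservingₗᵢ ℝ T hT).continuous
    (ContinuousLinearMap.compLpL 2 volume A : L2 n F →L[ℝ] L2 n F).continuous

/-- Weak compactness for sequences of equivariant functions bounded in `H¹`. -/
theorem exists_weak_limit [FiniteDimensional ℝ F] {ι : Type*} {T : ι → E n → E n}
    (hT : ∀ g, MeasurePreserving (T g) volume volume) (A : ι → F →L[ℝ] F)
    {u : ℕ → E n → F} {w : ℕ → Fin n → E n → F} (hu : ∀ k, MemLp (u k) 2 volume)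
    (hw : ∀ k i, MemLp (w k i) 2 volume) (h : ∀ k i, HasWeakPartial i (u k) (w k i))
    (hinv : ∀ k g, ∀ᵐ x, u k (T g x) = A g (u k x)) {M : ℝ}
    (hM : ∀ k, (∫ x, ‖u k x‖ ^ 2) + ∑ i, ∫ x, ‖w k i x‖ ^ 2 ≤ M) :
    ∃ (u₀ : E n → F) (w₀ : Fin n → E n → F) (σ : ℕ → ℕ), StrictMono σ ∧ MemLp u₀ 2 volume ∧
      (∀ i, MemLp (w₀ i) 2 volume) ∧ (∀ i, HasWeakPartial i u₀ (w₀ i)) ∧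
      (∀ g, ∀ᵐ x, u₀ (T g x) = A g (u₀ x)) ∧
      (∀ ψ : E n → F, MemLp ψ 2 volume →
        Tendsto (fun k => ∫ x, ⟪u (σ k) x, ψ x⟫) atTop (𝓝 (∫ x, ⟪u₀ x, ψ x⟫))) ∧
      ∀ i, ∀ ψ : E n → F, MemLp ψ 2 volume →
        Tendsto (fun k => ∫ x, ⟪w (σ k) i x, ψ x⟫) atTop (𝓝 (∫ x, ⟪w₀ i x, ψ x⟫)) := by
  have : CompleteSpace F := FiniteDimensional.complete ℝ F
  have : TopologicalSpace.SeparableSpace (L2Tuple n F) := separableSpace_L2Tuple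
  let X : ℕ → L2Tuple n F := fun k => mkTuple (hu k) (hw k)
  have hX : ∀ k, ‖X k‖ ≤ Real.sqrt M := by
    intro k
    refine Real.le_sqrt_of_sq_le ?_
    rw [← real_inner_self_eq_norm_sq, inner_mkTuple]
    simpa only [real_inner_self_eq_norm_sq] using hM k
  obtain ⟨Y, σ, hσ, hY⟩ := exists_weakly_convergent_subseq hX
  -- Being a weak gradient and each single equivariance are closed linear conditions. Their
  -- intersection is closed however large the index type is, so the weak limit inherits all of them
  -- at once.
  let S : Submodule ℝ (L2Tuple n F) := sobolevSpace n F ⊓ ⨅ g,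
    (intertwiningSpace (hT g) (A g)).comap
      (PiLp.proj 2 (𝕜 := ℝ) (fun _ : Option (Fin n) => L2 n F) none).toLinearMap
  have hS : IsClosed (S : Set (L2Tuple n F)) := by
    simp only [S, Submodule.coe_inf, Submodule.coe_iInf, Submodule.comap_coe]
    exact isClosed_sobolevSpace.inter (isClosed_iInter fun g =>
      (isClosed_intertwiningSpace (hT g) (A g)).preimage (PiLp.continuous_apply 2 _ none))
  have hXS : ∀ k, X (σ k) ∈ S := by
    intro k
    refine ⟨mkTuple_mem_sobolevSpace _ _ (h (σ k)), ?_⟩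
    rw [SetLike.mem_coe, Submodule.mem_iInf]
    intro g
    rw [Submodule.mem_comap]
    change (hu (σ k)).toLp _ ∈ _
    rw [mem_intertwiningSpace]
    have h1 := (hu (σ k)).coeFn_toLp
    filter_upwards [h1, (hT g).quasiMeasurePreserving.ae h1, hinv (σ k) g] with x h1 h2 h3
    rw [h1, h2, h3]
  have hYS : Y ∈ S := mem_of_weakly_convergent hS hXS hY
  have hYe := hYS.2
  rw [SetLike.mem_coe, Submodule.mem_iInf] at hYe
  have hz : MemLp (fun _ : E n => (0 : F)) 2 volume := MemLp.zero'
  refine ⟨Y none, fun i => Y (some i), σ, hσ, Lp.memLp _, fun i => Lp.memLp _, hYS.1,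
    fun g => (mem_intertwiningSpace (hT g) (A g) _).1 (hYe g), fun ψ hψ => ?_, fun i ψ hψ => ?_⟩
  · have := hY (mkTuple hψ (w := fun _ _ => 0) fun _ => hz)
    rw [← mkTuple_coe Y] at this
    simpa [X, inner_mkTuple] using this
  · classical
    have := hY (mkTuple (u := fun _ => 0) (w := fun j => if j = i then ψ else fun _ => 0) hz
      fun j => by
        by_cases hj : j = i
        · simpa [hj] using hψ
        · simp only [hj, if_false]; exact hz)
    rw [← mkTuple_coe Y] at this
    simp only [X, inner_mkTuple] at this
    have key : ∀ v : Fin n → E n → F, ∑ j, ∫ x, ⟪v j x, (if j = i then ψ else fun _ => 0) x⟫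
        = ∫ x, ⟪v i x, ψ x⟫ := by
      intro v
      rw [Finset.sum_eq_single i]
      · simp
      · intro j _ hj
        simp [hj]
      · simp
    simp only [key, inner_zero_right, integral_zero, zero_add] at this
    exact this

/-- The Riesz representation theorem in `H¹` for functionals given by a density. -/
theorem exists_riesz [CompleteSpace F] (h : E n → F) (C : ℝ)
    (hint : ∀ (v : E n → F) (w : Fin n → E n → F), MemLp v 2 volume → (∀ i, MemLp (w i) 2 volume) →
      (∀ i, HasWeakPartial i v (w i)) → Integrable (fun x => ⟪h x, v x⟫) volume ∧
        ((∫ x, ‖v x‖ ^ 2) + ∑ i, ∫ x, ‖w i x‖ ^ 2 ≤ 1 → |∫ x, ⟪h x, v x⟫| ≤ C)) :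
    ∃ (f : E n → F) (z : Fin n → E n → F), MemLp f 2 volume ∧ (∀ i, MemLp (z i) 2 volume) ∧
      (∀ i, HasWeakPartial i f (z i)) ∧
      ∀ (v : E n → F) (w : Fin n → E n → F), MemLp v 2 volume → (∀ i, MemLp (w i) 2 volume) →
        (∀ i, HasWeakPartial i v (w i)) →
          ∫ x, ⟪h x, v x⟫ = (∫ x, ⟪f x, v x⟫) + ∑ i, ∫ x, ⟪z i x, w i x⟫ := by
  have : CompleteSpace (sobolevSpace n F) := isClosed_sobolevSpace.completeSpace_coe
  have hi : ∀ X : sobolevSpace n F,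
      Integrable (fun x => ⟪h x, ((X : L2Tuple n F) none : E n → F) x⟫) volume := fun X =>
    (hint _ (fun i => (X : L2Tuple n F) (some i)) (Lp.memLp _) (fun i => Lp.memLp _) X.2).1
  let L : sobolevSpace n F →ₗ[ℝ] ℝ :=
    { toFun := fun X => ∫ x, ⟪h x, ((X : L2Tuple n F) none : E n → F) x⟫
      map_add' := by
        intro X Y
        rw [← integral_add (hi X) (hi Y)]
        refine integral_congr_ae ?_
        filter_upwards [Lp.coeFn_add ((X : L2Tuple n F) none) ((Y : L2Tuple n F) none)] with x hx
        rw [Submodule.coe_add, PiLp.add_apply, hx, Pi.add_apply, inner_add_right]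
      map_smul' := by
        intro c X
        rw [RingHom.id_apply, smul_eq_mul, ← integral_const_mul]
        refine integral_congr_ae ?_
        filter_upwards [Lp.coeFn_smul c ((X : L2Tuple n F) none)] with x hx
        rw [Submodule.coe_smul, PiLp.smul_apply, hx, Pi.smul_apply, inner_smul_right] }
  have hnorm : ∀ X : L2Tuple n F, ‖X‖ ^ 2 = (∫ x, ‖(X none : E n → F) x‖ ^ 2)
      + ∑ i, ∫ x, ‖(X (some i) : E n → F) x‖ ^ 2 := by
    intro X
    rw [← real_inner_self_eq_norm_sq]
    conv_lhs => rw [← mkTuple_coe X]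
    rw [inner_mkTuple]
    simp only [real_inner_self_eq_norm_sq]
  let ℓ : StrongDual ℝ (sobolevSpace n F) := L.mkContinuous (C / 1) fun X => by
    refine LinearMap.bound_of_sphere_bound one_pos C L (fun Y hY => ?_) X
    refine (hint _ (fun i => (Y : L2Tuple n F) (some i)) (Lp.memLp _) (fun i => Lp.memLp _) Y.2).2 ?_
    rw [← hnorm]
    have : ‖Y‖ = 1 := by simpa using hY
    rw [← Submodule.coe_norm, this, one_pow]
  set f := (InnerProductSpace.toDual ℝ (sobolevSpace n F)).symm ℓ with hf
  refine ⟨(f : L2Tuple n F) none, fun i => (f : L2Tuple n F) (some i), Lp.memLp _,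
    fun i => Lp.memLp _, f.2, fun v w hv hw hvw => ?_⟩
  have key : ⟪f, (⟨mkTuple hv hw, mkTuple_mem_sobolevSpace hv hw hvw⟩ : sobolevSpace n F)⟫
      = ℓ ⟨mkTuple hv hw, mkTuple_mem_sobolevSpace hv hw hvw⟩ := by
    rw [hf, InnerProductSpace.toDual_symm_apply]
  rw [Submodule.coe_inner] at key
  have h2 := inner_mkTuple (Lp.memLp ((f : L2Tuple n F) none))
    (fun i => Lp.memLp ((f : L2Tuple n F) (some i))) hv hw
  rw [mkTuple_coe] at h2
  rw [← h2, key]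
  change _ = ∫ x, ⟪h x, (hv.toLp v : E n → F) x⟫
  refine integral_congr_ae ?_
  filter_upwards [hv.coeFn_toLp] with x hx
  rw [hx]

end SphericalVortex

end

open Filter Topology
open scoped ENNReal NNReal RealInnerProductSpace

noncomputable section

namespace SphericalVortex

attribute [local instance] InnerProductSpace.complexToReal

variable {n : ℕ} {V : Type*} [NormedAddCommGroup V] [InnerProductSpace ℂ V]

/-! ### Norms of H¹ functions as integrals -/

section NormFormulas

theorem normLq_rpow {q : ℝ} (hq : 0 < q) {u : E n → V} (hu : AEStronglyMeasurable u volume) :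
    normLq q u ^ q = ∫ x, ‖u x‖ ^ q := by
  rw [normLq, ENNReal.toReal_rpow, eLpNorm_ofReal_rpow hq,
    integral_eq_lintegral_of_nonneg_ae (ae_of_all _ fun x => by positivity)
      (hu.norm.aemeasurable.pow_const q).aestronglyMeasurable]
  congr 1
  refine lintegral_congr fun x => ?_
  rw [← ofReal_norm, ENNReal.ofReal_rpow_of_nonneg (norm_nonneg _) hq.le]

theorem normLq_nonneg (q : ℝ) (u : E n → V) : 0 ≤ normLq q u := ENNReal.toReal_nonneg

theorem normLq_two_sq {u : E n → V} (hu : AEStronglyMeasurable u volume) :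
    normLq 2 u ^ 2 = ∫ x, ‖u x‖ ^ 2 := by
  have := normLq_rpow two_pos hu
  simpa using this

theorem integral_norm_sq_nonneg (u : E n → V) : 0 ≤ ∫ x, ‖u x‖ ^ 2 :=
  integral_nonneg fun _ => by positivity

theorem eLpNorm_two_eq {u : E n → V} (hu : MemLp u 2 volume) :
    eLpNorm u 2 volume = ENNReal.ofReal (√(∫ x, ‖u x‖ ^ 2)) := by
  have h : normLq 2 u = √(∫ x, ‖u x‖ ^ 2) := by
    rw [← normLq_two_sq hu.1, Real.sqrt_sq (normLq_nonneg 2 u)]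
  rw [← h, normLq, ENNReal.ofReal_ofNat, ENNReal.ofReal_toReal hu.2.ne]

/-- The squared `L²` norm of a gradient. -/
def gradSq (w : Fin n → E n → V) : ℝ := ∑ i, ∫ x, ‖w i x‖ ^ 2

theorem gradSq_nonneg (w : Fin n → E n → V) : 0 ≤ gradSq w :=
  Finset.sum_nonneg fun i _ => integral_norm_sq_nonneg (w i)

theorem MemH1.isH1 {u : E n → V} (h : MemH1 u) : IsH1 u fun i => weakPartial i u := by
  refine ⟨h.1, fun i => ?_⟩
  have hw : weakPartial i u = (h.2 i).choose := dif_pos (h.2 i)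
  simp only [hw]
  exact (h.2 i).choose_spec

theorem IsH1.memH1 {u : E n → V} {w : Fin n → E n → V} (h : IsH1 u w) : MemH1 u :=
  ⟨h.1, fun i => ⟨w i, h.2 i⟩⟩

theorem IsH1.weakPartial_ae_eq [FiniteDimensional ℂ V] {u : E n → V} {w : Fin n → E n → V}
    (h : IsH1 u w) (i : Fin n) : weakPartial i u =ᵐ[volume] w i :=
  IsWeakPartial.ae_eq (h.memH1.isH1.2 i).1 (h.2 i).1 (h.memH1.isH1.2 i).2 (h.2 i).2

/-- Uniqueness of weak derivatives removes the choice made in `weakPartial`, so the gradient norm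
can be computed from any square integrable weak gradient. -/
theorem IsH1.normGrad_eq [FiniteDimensional ℂ V] {u : E n → V} {w : Fin n → E n → V}
    (h : IsH1 u w) : normGrad u = √(gradSq w) := by
  rw [normGrad, gradSq]
  congr 1
  refine Finset.sum_congr rfl fun i _ => integral_congr_ae ?_
  filter_upwards [h.weakPartial_ae_eq i] with x hx
  rw [hx]

theorem IsH1.normLq_two_eq {u : E n → V} {w : Fin n → E n → V} (h : IsH1 u w) :
    normLq 2 u = √(∫ x, ‖u x‖ ^ 2) := by
  rw [← normLq_two_sq h.1.1, Real.sqrt_sq (normLq_nonneg 2 u)]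

theorem IsH1.gradSum_le {u : E n → V} {w : Fin n → E n → V} (h : IsH1 u w) :
    gradSum w ≤ n * ENNReal.ofReal (√(gradSq w)) := by
  have : ∀ i ∈ Finset.univ, eLpNorm (w i) 2 volume ≤ ENNReal.ofReal (√(gradSq w)) := by
    intro i _
    rw [eLpNorm_two_eq (h.2 i).1]
    refine ENNReal.ofReal_le_ofReal (Real.sqrt_le_sqrt ?_)
    exact Finset.single_le_sum (f := fun i => ∫ x, ‖w i x‖ ^ 2)
      (fun i _ => integral_norm_sq_nonneg (w i)) (Finset.mem_univ i)
  refine (Finset.sum_le_card_nsmul _ _ _ this).trans ?_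
  simp

theorem IsH1.weinstein_eq [FiniteDimensional ℂ V] {p : ℝ} (hp : 1 < p) {u : E n → V}
    {w : Fin n → E n → V} (h : IsH1 u w) :
    weinstein p u = (∫ x, ‖u x‖ ^ (p + 1))
      / (√(∫ x, ‖u x‖ ^ 2) ^ alpha n p * √(gradSq w) ^ beta n p) := by
  rw [weinstein, normLq_rpow (by linarith) h.1.1, h.normLq_two_eq, h.normGrad_eq]

theorem integral_norm_sq_pos {u : E n → V} (hu : MemLp u 2 volume) (h0 : ¬ u =ᵐ[volume] 0) :
    0 < ∫ x, ‖u x‖ ^ 2 := by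
  refine lt_of_le_of_ne (integral_norm_sq_nonneg u) fun h => h0 ?_
  rw [← eLpNorm_eq_zero_iff hu.1 (by norm_num : (2 : ℝ≥0∞) ≠ 0), eLpNorm_two_eq hu, ← h]
  simp

/-- The gradient enters the Gagliardo–Nirenberg inequality with a positive power γ, so a vanishing
gradient forces u = 0. The exponent q = 0 only ensures r > 0. -/
theorem IsH1.gradSq_pos [CompleteSpace V] (hn : 2 ≤ n) {u : E n → V} {w : Fin n → E n → V}
    (h : IsH1 u w) (h0 : ¬ u =ᵐ[volume] 0) : 0 < gradSq w := by
  refine lt_of_le_of_ne (gradSq_nonneg w) fun hg => h0 ?_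
  have hs : gradSum w = 0 := by
    have := h.gradSum_le
    rw [← hg] at this
    simpa using this
  obtain ⟨r, C, γ, δ, hr, hγ, hδ, H⟩ := exists_sobolev (V := V) hn (q := 0) fun h2 => by
    have : (2 : ℝ) < n := by exact_mod_cast h2
    have : (0 : ℝ) < n - 2 := by linarith
    positivity
  have hr0 : (r : ℝ≥0∞) ≠ 0 := by
    have : 0 < r := by exact_mod_cast hr
    exact_mod_cast this.ne'
  have := H u w h
  rw [hs, ENNReal.zero_rpow_of_pos hγ, mul_zero] at this
  exact (eLpNorm_eq_zero_iff h.1.1 hr0).1 (le_antisymm this (zero_le))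

/-- The functions in `H¹` belong to `L^q` for subcritical `q`, with a uniform bound. -/
theorem exists_eLpNorm_le [CompleteSpace V] (hn : 2 ≤ n) {q : ℝ} (hq2 : 2 < q)
    (hq : 2 < n → q < 2 * n / ((n : ℝ) - 2)) (M : ℝ) :
    ∃ K : ℝ≥0, ∀ (u : E n → V) (w : Fin n → E n → V), IsH1 u w → ∫ x, ‖u x‖ ^ 2 ≤ M →
      gradSq w ≤ M → eLpNorm u (ENNReal.ofReal q) volume ≤ K := by
  obtain ⟨r, C, γ, δ, hr, hγ, hδ, H⟩ := exists_sobolev (V := V) hn hq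
  obtain ⟨a, b, ha, hb, hint⟩ := exists_eLpNorm_le_interpolate (X := E n) (W := V)
    (μ := volume) hq2 hr
  rw [ENNReal.ofReal_coe_nnreal] at hint
  set m : ℝ≥0∞ := ENNReal.ofReal (√M)
  have hm : m ≠ ⊤ := ENNReal.ofReal_ne_top
  set K : ℝ≥0∞ := m ^ a * (C * m ^ δ * (n * m) ^ γ) ^ b with hK
  have hKt : K ≠ ⊤ := by
    refine ENNReal.mul_ne_top (ENNReal.rpow_ne_top_of_nonneg ha.le hm)
      (ENNReal.rpow_ne_top_of_nonneg hb (ENNReal.mul_ne_top (ENNReal.mul_ne_top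
        ENNReal.coe_ne_top (ENNReal.rpow_ne_top_of_nonneg hδ hm))
        (ENNReal.rpow_ne_top_of_nonneg hγ.le (ENNReal.mul_ne_top (by simp) hm))))
  refine ⟨K.toNNReal, fun u w h h1 h2 => ?_⟩
  rw [ENNReal.coe_toNNReal hKt, hK]
  have hu : eLpNorm u 2 volume ≤ m := by
    rw [eLpNorm_two_eq h.1]
    exact ENNReal.ofReal_le_ofReal (Real.sqrt_le_sqrt h1)
  have hw : gradSum w ≤ n * m := by
    exact h.gradSum_le.trans (mul_le_mul_right
      (ENNReal.ofReal_le_ofReal (Real.sqrt_le_sqrt h2)) _)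
  refine (hint u h.1.1).trans ?_
  refine mul_le_mul' (ENNReal.rpow_le_rpow hu ha.le) (ENNReal.rpow_le_rpow ?_ hb)
  refine (H u w h).trans ?_
  gcongr

theorem IsH1.memLp [CompleteSpace V] (hn : 2 ≤ n) {q : ℝ} (hq2 : 2 < q)
    (hq : 2 < n → q < 2 * n / ((n : ℝ) - 2)) {u : E n → V} {w : Fin n → E n → V}
    (h : IsH1 u w) : MemLp u (ENNReal.ofReal q) volume := by
  obtain ⟨K, hK⟩ := exists_eLpNorm_le (V := V) hn hq2 hq (max (∫ x, ‖u x‖ ^ 2) (gradSq w))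
  exact ⟨h.1.1, (hK u w h (le_max_left _ _) (le_max_right _ _)).trans_lt ENNReal.coe_lt_top⟩

end NormFormulas

/-! ### Linear combinations and dilations -/

section Operations

theorem IsH1.add_smul {u v : E n → V} {w z : Fin n → E n → V} (h : IsH1 u w) (h' : IsH1 v z)
    (t : ℝ) : IsH1 (fun x => u x + t • v x) fun i x => w i x + t • z i x := by
  refine ⟨h.1.add (h'.1.const_smul t), fun i => ⟨(h.2 i).1.add ((h'.2 i).1.const_smul t), ?_⟩⟩
  intro φ hφ hc
  have hl : ∀ {f : E n → V}, MemLp f 2 volume → LocallyIntegrable f volume := fun hf =>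
    hf.locallyIntegrable (by norm_num)
  have h1 := continuous_fderiv_single hφ i
  have h2 := hasCompactSupport_fderiv_single hc i
  have h3 : Integrable (fun x => t • (fderiv ℝ φ x (EuclideanSpace.single i 1)) • v x) volume :=
    (integrable_test_smul h1 h2 (hl h'.1)).smul t
  have h4 : Integrable (fun x => t • φ x • z i x) volume :=
    (integrable_test_smul hφ.continuous hc (hl (h'.2 i).1)).smul t
  simp only [smul_add, smul_comm _ t]
  rw [integral_add (integrable_test_smul h1 h2 (hl h.1)) h3,
    integral_add (integrable_test_smul hφ.continuous hc (hl (h.2 i).1)) h4,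
    integral_smul, integral_smul, (h.2 i).2 φ hφ hc, (h'.2 i).2 φ hφ hc, neg_add, smul_neg]

theorem measurePreserving_smul_ae {s : ℝ} (hs : s ≠ 0) {P : E n → Prop} (h : ∀ᵐ x, P x) :
    ∀ᵐ x : E n, P (s • x) :=
  (Measure.quasiMeasurePreserving_smul volume hs).ae h

/-- Dilations act on `H¹`. -/
theorem IsH1.dilate {u : E n → V} {w : Fin n → E n → V} (h : IsH1 u w) (a : ℝ) {s : ℝ}
    (hs : 0 < s) :
    IsH1 (fun x => a • u (s • x)) fun i x => (a * s) • w i (s • x) := by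
  have hmem : ∀ {f : E n → V} (b : ℝ), MemLp f 2 volume →
      MemLp (fun x => b • f (s • x)) 2 volume := by
    intro f b hf
    have h1 : MemLp (fun x => f (s • x)) 2 volume := by
      have hmap := Measure.map_addHaar_smul (volume : Measure (E n)) hs.ne'
      have h2 : MemLp f 2 (Measure.map (fun x : E n => s • x) volume) := by
        rw [show (fun x : E n => s • x) = (s • ·) from rfl, hmap]
        exact hf.smul_measure ENNReal.ofReal_ne_top
      exact h2.comp_of_map (measurable_const_smul s).aemeasurable
    exact h1.const_smul b
  refine ⟨hmem a h.1, fun i => ⟨hmem (a * s) (h.2 i).1, ?_⟩⟩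
  intro φ hφ hc
  -- The substitution y = s x moves the dilation onto the test function, and both sides acquire the
  -- same Jacobian factor.
  set ψ : E n → ℝ := fun y => φ (s⁻¹ • y)
  have hψ : ContDiff ℝ ∞ ψ := hφ.comp (contDiff_const_smul s⁻¹)
  have hψc : HasCompactSupport ψ :=
    hc.comp_homeomorph (Homeomorph.smulOfNeZero s⁻¹ (inv_ne_zero hs.ne'))
  have hd : ∀ y v, fderiv ℝ ψ y v = s⁻¹ * fderiv ℝ φ (s⁻¹ • y) v := by
    intro y v
    have h1 : HasFDerivAt (fun x : E n => s⁻¹ • x) (s⁻¹ • ContinuousLinearMap.id ℝ (E n)) y :=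
      (hasFDerivAt_id y).const_smul s⁻¹
    have h2 := ((hφ.differentiable (by simp)) (s⁻¹ • y)).hasFDerivAt.comp y h1
    rw [HasFDerivAt.fderiv (by exact h2)]
    simp
  have e1 : ∫ x, (fderiv ℝ φ x (EuclideanSpace.single i 1)) • a • u (s • x)
      = |(s ^ Module.finrank ℝ (E n))⁻¹| •
        (a * s) • ∫ y, (fderiv ℝ ψ y (EuclideanSpace.single i 1)) • u y := by
    rw [← integral_smul, ← Measure.integral_comp_smul]
    refine integral_congr_ae (ae_of_all _ fun x => ?_)
    simp only [hd]
    rw [smul_smul s⁻¹ s, inv_mul_cancel₀ hs.ne', one_smul, smul_smul, smul_smul]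
    congr 1
    field_simp
  have e2 : ∫ x, φ x • (a * s) • w i (s • x)
      = |(s ^ Module.finrank ℝ (E n))⁻¹| • (a * s) • ∫ y, ψ y • w i y := by
    rw [← integral_smul, ← Measure.integral_comp_smul]
    refine integral_congr_ae (ae_of_all _ fun x => ?_)
    simp only [ψ]
    rw [smul_smul s⁻¹ s, inv_mul_cancel₀ hs.ne', one_smul, smul_comm]
  rw [e1, e2, (h.2 i).2 ψ hψ hψc, smul_neg, smul_neg]

theorem integral_norm_dilate_rpow (f : E n → V) {a s : ℝ} (ha : 0 ≤ a) (hs : 0 < s) (q : ℝ) :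
    ∫ x, ‖a • f (s • x)‖ ^ q = a ^ q * (s ^ n)⁻¹ * ∫ x, ‖f x‖ ^ q := by
  have h1 : ∀ x, ‖a • f (s • x)‖ ^ q = a ^ q * ‖f (s • x)‖ ^ q := fun x => by
    rw [norm_smul, Real.norm_of_nonneg ha, Real.mul_rpow ha (norm_nonneg _)]
  simp only [h1]
  rw [integral_const_mul, Measure.integral_comp_smul volume (fun x => ‖f x‖ ^ q) s,
    finrank_euclideanSpace, Fintype.card_fin, abs_of_nonneg (by positivity), smul_eq_mul, mul_assoc]

theorem integral_norm_dilate_sq (f : E n → V) {a s : ℝ} (ha : 0 ≤ a) (hs : 0 < s) :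
    ∫ x, ‖a • f (s • x)‖ ^ 2 = a ^ 2 * (s ^ n)⁻¹ * ∫ x, ‖f x‖ ^ 2 := by
  have := integral_norm_dilate_rpow f ha hs 2
  simpa using this

end Operations

/-! ### Finiteness of the supremum and existence of a maximiser -/

section Maximiser

variable {G : Subgroup (Matrix.specialOrthogonalGroup (Fin n) ℝ)}

/-- Every nonzero element of `H¹_π` can be dilated to have unit norms, without changing the
Weinstein functional. -/
theorem IsNonzeroH1Equiv.exists_normalized [FiniteDimensional ℂ V] (hn : 2 ≤ n) {p : ℝ} (hp : 1 < p)
    {π : G →* (V ≃ₗᵢ[ℂ] V)} {u : E n → V} (hu : IsNonzeroH1Equiv π u) :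
    ∃ (v : E n → V) (w : Fin n → E n → V), IsH1 v w ∧
      (∀ g : G, ∀ᵐ x : E n, v (rot g x) = π g (v x)) ∧ ∫ x, ‖v x‖ ^ 2 = 1 ∧ gradSq w = 1 ∧
      ∫ x, ‖v x‖ ^ (p + 1) = weinstein p u := by
  have : CompleteSpace V := FiniteDimensional.complete ℂ V
  have h := hu.1.1.isH1
  set w := fun i => weakPartial i u
  have hA2 := integral_norm_sq_pos h.1 hu.2
  have hB2 := h.gradSq_pos hn hu.2
  set A := √(∫ x, ‖u x‖ ^ 2) with hA
  set B := √(gradSq w) with hB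
  have hA0 : 0 < A := Real.sqrt_pos.2 hA2
  have hB0 : 0 < B := Real.sqrt_pos.2 hB2
  have hAsq : ∫ x, ‖u x‖ ^ 2 = A ^ 2 := (Real.sq_sqrt hA2.le).symm
  have hBsq : gradSq w = B ^ 2 := (Real.sq_sqrt hB2.le).symm
  -- The requirements a² s^(-n) A² = 1 and a² s^(2-n) B² = 1 determine s = A/B and a = s^(n/2)/A.
  set s := A / B with hs
  have hs0 : 0 < s := div_pos hA0 hB0
  set a := √(s ^ n) / A with ha
  have ha0 : 0 < a := by positivity
  have hasq : a ^ 2 = s ^ n / A ^ 2 := by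
    rw [ha, div_pow, Real.sq_sqrt (by positivity)]
  have hsn : s ^ n ≠ 0 := by positivity
  refine ⟨_, _, h.dilate a hs0, fun g => ?_, ?_, ?_, ?_⟩
  · filter_upwards [measurePreserving_smul_ae hs0.ne' (hu.1.2 g)] with x hx
    have h1 : s • rot (g : Matrix.specialOrthogonalGroup (Fin n) ℝ) x = rot g (s • x) := by
      rw [← coe_rotEquiv, map_smul]
    rw [h1, hx, map_real_smul _ (π g).continuous]
  · rw [integral_norm_dilate_sq u ha0.le hs0, hAsq, hasq]
    field_simp
  · rw [gradSq]
    have : ∀ i, ∫ x, ‖(a * s) • w i (s • x)‖ ^ 2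
        = (a * s) ^ 2 * (s ^ n)⁻¹ * ∫ x, ‖w i x‖ ^ 2 := fun i =>
      integral_norm_dilate_sq (w i) (by positivity) hs0
    simp only [this]
    rw [← Finset.mul_sum]
    change _ * gradSq w = 1
    rw [hBsq, mul_pow, hasq, hs]
    field_simp
  · rw [integral_norm_dilate_rpow u ha0.le hs0, h.weinstein_eq hp, ← hA, ← hB]
    have e1 : a ^ (p + 1) = s ^ ((n : ℝ) * (p + 1) / 2) * A ^ (-(p + 1)) := by
      have : a = s ^ ((n : ℝ) / 2) * A ^ (-1 : ℝ) := by
        rw [ha, Real.sqrt_eq_rpow, ← Real.rpow_natCast, ← Real.rpow_mul hs0.le, Real.rpow_neg_one,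
          div_eq_mul_inv]
        congr 2
        ring
      rw [this, Real.mul_rpow (by positivity) (by positivity), ← Real.rpow_mul hs0.le,
        ← Real.rpow_mul hA0.le]
      congr 2 <;> ring
    -- The power of s is n(p+1)/2 - n = β. With s = A/B the power of A becomes β - (p+1) = -α.
    have e2 : a ^ (p + 1) * (s ^ n)⁻¹ = (A ^ alpha n p * B ^ beta n p)⁻¹ := by
      rw [e1, ← Real.rpow_natCast s n, ← Real.rpow_neg hs0.le, mul_right_comm,
        ← Real.rpow_add hs0]
      have : (n : ℝ) * (p + 1) / 2 + -(n : ℝ) = beta n p := by rw [beta]; ring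
      rw [this, hs, Real.div_rpow hA0.le hB0.le, mul_inv, div_mul_eq_mul_div, ← Real.rpow_add hA0,
        div_eq_mul_inv, ← Real.rpow_neg hA0.le]
      congr 2
      rw [beta, alpha]
      ring
    rw [e2, div_eq_inv_mul]

theorem bddAbove_weinsteinValues [FiniteDimensional ℂ V] (hn : 2 ≤ n) {p : ℝ} (hp : 1 < p)
    (hq : 2 < n → p + 1 < 2 * n / ((n : ℝ) - 2)) (π : G →* (V ≃ₗᵢ[ℂ] V)) :
    BddAbove (weinsteinValues p π) := by
  have : CompleteSpace V := FiniteDimensional.complete ℂ V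
  obtain ⟨K, hK⟩ := exists_eLpNorm_le (V := V) hn (by linarith : 2 < p + 1) hq 1
  refine ⟨(K : ℝ) ^ (p + 1), ?_⟩
  rintro _ ⟨u, hu, rfl⟩
  obtain ⟨v, w, hv, -, h1, h2, h3⟩ := hu.exists_normalized hn hp
  rw [← h3, ← normLq_rpow (by linarith) hv.1.1]
  refine Real.rpow_le_rpow (normLq_nonneg _ _) ?_ (by linarith)
  exact ENNReal.toReal_le_of_le_ofReal K.2 (by
    rw [ENNReal.ofReal_coe_nnreal]
    exact hK v w hv h1.le h2.le)

/-- At a fixed point x the coordinates of the mollification are L² pairings with φ(x - ·) • b j, so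
weak convergence of d_k becomes pointwise convergence. -/
theorem tendsto_moll_of_weak [FiniteDimensional ℂ V] {d : ℕ → E n → V}
    (hd : ∀ k, MemLp (d k) 2 volume)
    (hweak : ∀ ψ : E n → V, MemLp ψ 2 volume →
      Tendsto (fun k => ∫ x, ⟪d k x, ψ x⟫) atTop (𝓝 0)) (φ : ContDiffBump (0 : E n)) (x : E n) :
    Tendsto (fun k => moll φ (d k) x) atTop (𝓝 0) := by
  have : CompleteSpace V := FiniteDimensional.complete ℂ V
  let b := stdOrthonormalBasis ℝ V
  have hcont : Continuous fun y => φ.normed volume (x - y) :=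
    φ.continuous_normed.comp (continuous_const.sub continuous_id)
  have hcs : HasCompactSupport fun y => φ.normed volume (x - y) :=
    φ.hasCompactSupport_normed.comp_homeomorph (Homeomorph.subLeft x)
  have h1 : ∀ k, moll φ (d k) x
      = ∑ j, (∫ y, ⟪d k y, φ.normed volume (x - y) • b j⟫) • b j := by
    intro k
    rw [← b.sum_repr (moll φ (d k) x)]
    refine Finset.sum_congr rfl fun j _ => ?_
    rw [b.repr_apply_apply, real_inner_comm, moll, convolution_eq_swap]
    congr 1
    exact inner_integral_test_smul hcont hcs ((hd k).locallyIntegrable (by norm_num)) (b j)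
  simp only [h1]
  have h2 : Tendsto (fun k => ∑ j, (∫ y, ⟪d k y, φ.normed volume (x - y) • b j⟫) • b j) atTop
      (𝓝 (∑ j, (0 : ℝ) • b j)) :=
    tendsto_finsetSum _ fun j _ =>
      (hweak _ (memLp_smul_const hcont hcs (b j))).smul_const (b j)
  simpa using h2

theorem inner_le_half_add (a b : V) : ⟪a, b⟫ ≤ (‖a‖ ^ 2 + ‖b‖ ^ 2) / 2 := by
  have := norm_sub_sq_real a b
  have := sq_nonneg ‖a - b‖
  linarith

/-- Norms do not increase under weak limits. -/
theorem sum_integral_norm_sq_le_one {ι : Type*} [Fintype ι] {f : ℕ → ι → E n → V} {g : ι → E n → V}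
    (hf : ∀ k i, MemLp (f k i) 2 volume) (hg : ∀ i, MemLp (g i) 2 volume)
    (h1 : ∀ k, ∑ i, ∫ x, ‖f k i x‖ ^ 2 = 1)
    (hlim : ∀ i, Tendsto (fun k => ∫ x, ⟪f k i x, g i x⟫) atTop (𝓝 (∫ x, ⟪g i x, g i x⟫))) :
    ∑ i, ∫ x, ‖g i x‖ ^ 2 ≤ 1 := by
  have hsq : ∀ {v : E n → V}, MemLp v 2 volume → Integrable (fun x => ‖v x‖ ^ 2) volume :=
    fun hv => hv.integrable_norm_pow two_ne_zero
  have h2 : Tendsto (fun k => ∑ i, ∫ x, ⟪f k i x, g i x⟫) atTop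
      (𝓝 (∑ i, ∫ x, ‖g i x‖ ^ 2)) := by
    simp only [← real_inner_self_eq_norm_sq]
    exact tendsto_finsetSum _ fun i _ => hlim i
  -- From ⟪f, g⟫ ≤ (|f|² + |g|²)/2 the limit X = ∑ ‖g i‖₂² satisfies X ≤ (1 + X)/2, that is X ≤ 1.
  have h3 : ∑ i, ∫ x, ‖g i x‖ ^ 2 ≤ (1 + ∑ i, ∫ x, ‖g i x‖ ^ 2) / 2 := by
    refine le_of_tendsto' h2 fun k => ?_
    rw [← h1 k, ← Finset.sum_add_distrib, Finset.sum_div]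
    refine Finset.sum_le_sum fun i _ => ?_
    rw [← integral_add (hsq (hf k i)) (hsq (hg i)), ← integral_div]
    exact integral_mono (integrable_inner_of_memLp (hf k i) (hg i))
      (((hsq (hf k i)).add (hsq (hg i))).div_const 2) fun x => inner_le_half_add _ _
  linarith

/-- Subcriticality of p is exactly what gives α > 0; with it, losing L² mass in the limit can only
increase W. -/
theorem alpha_pos (hn : 2 ≤ n) {p : ℝ} (hp' : 2 < n → p < ((n : ℝ) + 2) / ((n : ℝ) - 2)) :
    0 < alpha n p := by
  rw [alpha]
  rcases hn.eq_or_lt with rfl | h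
  · simp
  · have h2 : (2 : ℝ) < n := by exact_mod_cast h
    have := hp' h
    rw [lt_div_iff₀ (by linarith)] at this
    nlinarith

theorem beta_pos (hn : 2 ≤ n) {p : ℝ} (hp : 1 < p) : 0 < beta n p := by
  have h2 : (2 : ℝ) ≤ n := by exact_mod_cast hn
  rw [beta]
  have : 0 < p - 1 := by linarith
  positivity

theorem subcritical {p : ℝ} (hp' : 2 < n → p < ((n : ℝ) + 2) / ((n : ℝ) - 2)) :
    2 < n → p + 1 < 2 * n / ((n : ℝ) - 2) := by
  intro h
  have h2 : (2 : ℝ) < n := by exact_mod_cast h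
  have h3 : (0 : ℝ) < n - 2 := by linarith
  have := hp' h
  rw [lt_div_iff₀ h3] at this ⊢
  linarith

theorem IsNonzeroH1Equiv.weinstein_pos [FiniteDimensional ℂ V] (hn : 2 ≤ n) {p : ℝ} (hp : 1 < p)
    (hq : 2 < n → p + 1 < 2 * n / ((n : ℝ) - 2))
    {π : G →* (V ≃ₗᵢ[ℂ] V)} {u : E n → V} (hu : IsNonzeroH1Equiv π u) : 0 < weinstein p u := by
  have : CompleteSpace V := FiniteDimensional.complete ℂ V
  have h := hu.1.1.isH1
  have hA := integral_norm_sq_pos h.1 hu.2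
  have hB := h.gradSq_pos hn hu.2
  have hN : 0 < normLq (p + 1) u := by
    have hm := h.memLp hn (by linarith : 2 < p + 1) hq
    refine ENNReal.toReal_pos (fun h0 => hu.2 ?_) hm.2.ne
    refine (eLpNorm_eq_zero_iff h.1.1 ?_).1 h0
    simp only [ne_eq, ENNReal.ofReal_eq_zero, not_le]
    linarith
  rw [h.weinstein_eq hp, ← normLq_rpow (by linarith) h.1.1]
  have := Real.sqrt_pos.2 hA
  have := Real.sqrt_pos.2 hB
  positivity

/-- Existence of a maximiser of the Weinstein functional. -/
theorem exists_maximiser [FiniteDimensional ℂ V] (hn : 2 ≤ n) {p : ℝ} (hp : 1 < p)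
    (hp' : 2 < n → p < ((n : ℝ) + 2) / ((n : ℝ) - 2)) (hG : ActsTransitivelyOnSphere G)
    (π : G →* (V ≃ₗᵢ[ℂ] V)) (hne : ∃ u : E n → V, IsNonzeroH1Equiv π u) :
    ∃ u : E n → V, IsNonzeroH1Equiv π u ∧ weinstein p u = weinsteinSup p π := by
  have : CompleteSpace V := FiniteDimensional.complete ℂ V
  have hq := subcritical hp'
  have hp1 : 2 < p + 1 := by linarith
  have hp0 : 0 < p + 1 := by linarith
  have hbdd := bddAbove_weinsteinValues hn hp hq π
  obtain ⟨u₁, hu₁⟩ := hne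
  have hS : 0 < weinsteinSup p π :=
    (hu₁.weinstein_pos hn hp hq).trans_le (le_csSup hbdd ⟨u₁, hu₁, rfl⟩)
  obtain ⟨s, -, hs, hsv⟩ := exists_seq_tendsto_sSup (S := weinsteinValues p π)
    ⟨_, u₁, hu₁, rfl⟩ hbdd
  have hex : ∀ k, ∃ (v : E n → V) (w : Fin n → E n → V), IsH1 v w ∧
      (∀ g : G, ∀ᵐ x : E n, v (rot g x) = π g (v x)) ∧ ∫ x, ‖v x‖ ^ 2 = 1 ∧ gradSq w = 1 ∧
      ∫ x, ‖v x‖ ^ (p + 1) = s k := by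
    intro k
    obtain ⟨u, hu, hus⟩ := hsv k
    rw [← hus]
    exact hu.exists_normalized hn hp
  choose v w hv hinv hv1 hw1 hvs using hex
  let A : G → V →L[ℝ] V := fun g =>
    ((π g).toContinuousLinearEquiv : V →L[ℂ] V).restrictScalars ℝ
  have hT : ∀ g : G, MeasurePreserving
      (rot (g : Matrix.specialOrthogonalGroup (Fin n) ℝ)) volume volume := fun g =>
    measurePreserving_rot (g : Matrix.specialOrthogonalGroup (Fin n) ℝ)
  obtain ⟨u, z, σ, hσ, hu2, hz2, huz, huinv, hlim, hlimz⟩ := exists_weak_limit (ι := G)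
    (T := fun g : G => rot (g : Matrix.specialOrthogonalGroup (Fin n) ℝ))
    hT A (fun k => (hv k).1) (fun k i => ((hv k).2 i).1)
    (fun k i => ((hv k).2 i).2) (fun k g => hinv k g) (M := 2)
    (fun k => by
      have : ∑ i, ∫ x, ‖w k i x‖ ^ 2 = 1 := hw1 k
      rw [hv1 k, this]; norm_num)
  have huH : IsH1 u z := ⟨hu2, fun i => ⟨hz2 i, huz i⟩⟩
  have hu1 : ∫ x, ‖u x‖ ^ 2 ≤ 1 := by
    have := sum_integral_norm_sq_le_one (ι := Unit) (f := fun k _ => v (σ k)) (g := fun _ => u)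
      (fun k _ => (hv _).1) (fun _ => hu2) (fun k => by simpa using hv1 (σ k))
      (fun _ => hlim u hu2)
    simpa using this
  have hz1 : gradSq z ≤ 1 :=
    sum_integral_norm_sq_le_one (f := fun k => w (σ k)) (fun k i => ((hv _).2 i).1) hz2
      (fun k => hw1 (σ k)) (fun i => hlimz i (z i) (hz2 i))
  -- The sequence and its limit are equivariant under the same isometries π g, so |d_k| is
  -- G-invariant, as the compactness theorem needs.
  let d : ℕ → E n → V := fun k x => v (σ k) x + (-1 : ℝ) • u x
  have hd : ∀ k, IsH1 (d k) fun i x => w (σ k) i x + (-1 : ℝ) • z i x := fun k =>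
    (hv (σ k)).add_smul huH (-1)
  have hone : ∀ {f : E n → V}, MemLp f 2 volume → ∫ x, ‖f x‖ ^ 2 ≤ 1 →
      eLpNorm f 2 volume ≤ 1 := by
    intro f hf h
    rw [eLpNorm_two_eq hf, ENNReal.ofReal_le_one]
    exact Real.sqrt_le_one.2 h
  have hgs : ∀ {f : E n → V} {y : Fin n → E n → V}, IsH1 f y → gradSq y ≤ 1 → gradSum y ≤ n := by
    intro f y hf h
    refine hf.gradSum_le.trans (le_trans ?_ (mul_one (n : ℝ≥0∞)).le)
    gcongr
    rw [ENNReal.ofReal_le_one]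
    exact Real.sqrt_le_one.2 h
  have hneg : ∀ (f : E n → V), eLpNorm ((-1 : ℝ) • f) 2 volume
      = eLpNorm f 2 volume := fun f => by
    have := eLpNorm_const_smul (-1 : ℝ) f 2 (volume : Measure (E n))
    rw [enorm_neg, enorm_one, one_mul] at this
    exact this
  have htend : Tendsto (fun k => eLpNorm (d k) (ENNReal.ofReal (p + 1)) volume) atTop (𝓝 0) := by
    -- A common bound: the L² norm of d_k is at most 2, and its n gradient components contribute at
    -- most 2 n.
    refine tendsto_eLpNorm_of_tendsto_moll hn hG hp1 hq hd (M := 2 * n + 2) ?_ ?_ ?_ ?_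
    · intro k g hg
      filter_upwards [hinv (σ k) ⟨g, hg⟩, huinv ⟨g, hg⟩] with x h1 h2
      have h2' : u (rot g x) = π ⟨g, hg⟩ (u x) := h2
      have h1' : v (σ k) (rot g x) = π ⟨g, hg⟩ (v (σ k) x) := h1
      simp only [d]
      rw [h1', h2', ← map_real_smul (π ⟨g, hg⟩) (π ⟨g, hg⟩).continuous, ← map_add,
        LinearIsometryEquiv.norm_map]
    · intro k
      refine (eLpNorm_add_le (hv (σ k)).1.1 (hu2.1.const_smul (-1 : ℝ)) (by norm_num)).trans ?_
      rw [hneg]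
      refine (add_le_add (hone (hv (σ k)).1 (hv1 (σ k)).le) (hone hu2 hu1)).trans ?_
      rw [one_add_one_eq_two]
      push_cast
      exact le_add_self
    · intro k
      have : gradSum (fun i x => w (σ k) i x + (-1 : ℝ) • z i x) ≤ gradSum (w (σ k)) + gradSum z := by
        rw [gradSum, gradSum, gradSum, ← Finset.sum_add_distrib]
        refine Finset.sum_le_sum fun i _ => ?_
        refine (eLpNorm_add_le ((hv (σ k)).2 i).1.1 ((hz2 i).1.const_smul (-1 : ℝ))
          (by norm_num)).trans ?_
        rw [hneg]
      refine this.trans ((add_le_add (hgs (hv (σ k)) (hw1 (σ k)).le) (hgs huH hz1)).trans ?_)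
      rw [← two_mul]
      push_cast
      exact le_self_add
    · refine tendsto_moll_of_weak (fun k => (hd k).1) fun ψ hψ => ?_
      have := (hlim ψ hψ).sub_const (∫ x, ⟪u x, ψ x⟫)
      rw [sub_self] at this
      refine this.congr fun k => ?_
      rw [← integral_sub (integrable_inner_of_memLp (hv (σ k)).1 hψ)
        (integrable_inner_of_memLp hu2 hψ)]
      refine integral_congr_ae (ae_of_all _ fun x => ?_)
      simp only [d]
      rw [inner_add_left, neg_one_smul, inner_neg_left, sub_eq_add_neg]
  have hLq : Tendsto (fun k => normLq (p + 1) (v (σ k))) atTop (𝓝 (normLq (p + 1) u)) := by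
    rw [tendsto_iff_dist_tendsto_zero]
    have h0 := (ENNReal.tendsto_toReal ENNReal.zero_ne_top).comp htend
    rw [ENNReal.toReal_zero] at h0
    refine squeeze_zero (fun _ => dist_nonneg) (fun k => ?_) h0
    have hmu := huH.memLp hn hp1 hq
    have hmv := (hv (σ k)).memLp hn hp1 hq
    have hmd := (hd k).memLp hn hp1 hq
    have h1q : (1 : ℝ≥0∞) ≤ ENNReal.ofReal (p + 1) := by
      rw [ENNReal.one_le_ofReal]; linarith
    rw [Real.dist_eq, abs_sub_le_iff, Function.comp_apply]
    constructor
    · rw [sub_le_iff_le_add, normLq, normLq, ← ENNReal.toReal_add hmd.2.ne hmu.2.ne]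
      refine ENNReal.toReal_mono (ENNReal.add_ne_top.2 ⟨hmd.2.ne, hmu.2.ne⟩) ?_
      have : v (σ k) = d k + u := by ext x; simp [d]
      conv_lhs => rw [this]
      exact eLpNorm_add_le hmd.1 hmu.1 h1q
    · rw [sub_le_iff_le_add, normLq, normLq, ← ENNReal.toReal_add hmd.2.ne hmv.2.ne]
      refine ENNReal.toReal_mono (ENNReal.add_ne_top.2 ⟨hmd.2.ne, hmv.2.ne⟩) ?_
      have : u = v (σ k) - d k := by ext x; simp [d]
      conv_lhs => rw [this]
      exact (eLpNorm_sub_le hmv.1 hmd.1 h1q).trans (add_comm _ _).le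
  have hNu : ∫ x, ‖u x‖ ^ (p + 1) = weinsteinSup p π := by
    rw [← normLq_rpow hp0 huH.1.1]
    refine tendsto_nhds_unique (hLq.rpow_const (Or.inr hp0.le)) ?_
    refine (hs.comp hσ.tendsto_atTop).congr fun k => ?_
    rw [Function.comp_apply, normLq_rpow hp0 (hv (σ k)).1.1, hvs]
  have hu0 : ¬ u =ᵐ[volume] 0 := by
    intro h0
    rw [← hNu] at hS
    have : ∫ x, ‖u x‖ ^ (p + 1) = 0 := by
      rw [← integral_zero (E n) ℝ]
      refine integral_congr_ae (h0.mono fun x hx => ?_)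
      simp [hx, hp0.ne']
    exact hS.ne' this
  have huN : IsNonzeroH1Equiv π u := ⟨⟨huH.memH1, huinv⟩, hu0⟩
  refine ⟨u, huN, le_antisymm (le_csSup hbdd ⟨u, huN, rfl⟩) ?_⟩
  -- The limit is only known to have ‖u‖₂, ‖∇u‖₂ ≤ 1. As α, β > 0 the denominator is at most 1, so
  -- W(u) is at least the supremum.
  rw [huH.weinstein_eq hp, hNu]
  have hA0 := Real.sqrt_pos.2 (integral_norm_sq_pos hu2 hu0)
  have hB0 := Real.sqrt_pos.2 (huH.gradSq_pos hn hu0)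
  rw [le_div_iff₀ (by positivity)]
  refine mul_le_of_le_one_right hS.le ?_
  exact mul_le_one₀ (Real.rpow_le_one hA0.le (Real.sqrt_le_one.2 hu1) (alpha_pos hn hp').le)
    (by positivity) (Real.rpow_le_one hB0.le (Real.sqrt_le_one.2 hz1) (beta_pos hn hp).le)

end Maximiser

/-! ### First variation along equivariant directions -/

section FirstVariation

/-- Each of the p + 1 powers is bounded by |a| + |b|. This crude bound replaces Hölder both in
dominating the derivative and in bounding the nonlinear functional. -/
theorem abs_rpow_mul_inner_le {p : ℝ} (hp : 1 < p) (a b : V) :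
    |‖a‖ ^ (p - 1) * ⟪a, b⟫| ≤ (‖a‖ + ‖b‖) ^ (p + 1) := by
  have ha := norm_nonneg a
  have hb := norm_nonneg b
  rw [abs_mul, abs_of_nonneg (by positivity : (0 : ℝ) ≤ ‖a‖ ^ (p - 1))]
  calc ‖a‖ ^ (p - 1) * |⟪a, b⟫|
      ≤ (‖a‖ + ‖b‖) ^ (p - 1) * ((‖a‖ + ‖b‖) * (‖a‖ + ‖b‖)) := by
        refine mul_le_mul (Real.rpow_le_rpow ha (by linarith) (by linarith))
          ((abs_real_inner_le_norm a b).trans ?_) (abs_nonneg _) (by positivity)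
        exact mul_le_mul (by linarith) (by linarith) hb (by linarith)
    _ = (‖a‖ + ‖b‖) ^ (p + 1) := by
        have h0 : 0 ≤ ‖a‖ + ‖b‖ := by positivity
        rw [← sq, ← Real.rpow_natCast _ 2, ← Real.rpow_add_of_nonneg h0 (by linarith) (by norm_num)]
        congr 1
        push_cast
        ring

theorem integrable_norm_add_norm_rpow {q : ℝ} (hq : 0 < q) {u v : E n → V}
    (hu : MemLp u (ENNReal.ofReal q) volume) (hv : MemLp v (ENNReal.ofReal q) volume) :
    Integrable (fun x => (‖u x‖ + ‖v x‖) ^ q) volume := by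
  have := (hu.norm.add hv.norm).integrable_norm_rpow
    (by simpa using hq) ENNReal.ofReal_ne_top
  rw [ENNReal.toReal_ofReal hq.le] at this
  refine this.congr (ae_of_all _ fun x => ?_)
  simp only [Pi.add_apply]
  rw [Real.norm_of_nonneg (by positivity)]

/-- Differentiation under the integral sign. For |t| < 1 the derivative is dominated by (p+1) (2(|u|
+ |v|))^(p+1), which is integrable. -/
theorem hasDerivAt_integral_norm_rpow {p : ℝ} (hp : 1 < p) {u v : E n → V}
    (hu : MemLp u (ENNReal.ofReal (p + 1)) volume) (hv : MemLp v (ENNReal.ofReal (p + 1)) volume) :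
    HasDerivAt (fun t : ℝ => ∫ x, ‖u x + t • v x‖ ^ (p + 1))
      ((p + 1) * ∫ x, ‖u x‖ ^ (p - 1) * ⟪u x, v x⟫) 0 := by
  have hp0 : 0 < p + 1 := by linarith
  have hmeas : ∀ t : ℝ, AEStronglyMeasurable (fun x => u x + t • v x) volume := fun t =>
    hu.1.add (hv.1.const_smul t)
  have hpow : ∀ (t r : ℝ), AEStronglyMeasurable (fun x => ‖u x + t • v x‖ ^ r) volume :=
    fun t r => ((hmeas t).norm.aemeasurable.pow_const r).aestronglyMeasurable
  have key := hasDerivAt_integral_of_dominated_loc_of_deriv_le (μ := volume)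
    (F := fun (t : ℝ) x => ‖u x + t • v x‖ ^ (p + 1))
    (F' := fun (t : ℝ) x => (p + 1) * (‖u x + t • v x‖ ^ (p - 1) * ⟪u x + t • v x, v x⟫))
    (x₀ := 0) (s := Metric.ball 0 1) (bound := fun x => (p + 1) * (2 * (‖u x‖ + ‖v x‖)) ^ (p + 1))
    (Metric.ball_mem_nhds 0 one_pos) (Eventually.of_forall fun t => hpow t _) ?_ ?_ ?_ ?_ ?_
  · have h2 := key.2
    simp only [zero_smul, add_zero] at h2
    rwa [integral_const_mul] at h2
  · have := hu.integrable_norm_rpow (by simpa using hp0) ENNReal.ofReal_ne_top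
    rw [ENNReal.toReal_ofReal hp0.le] at this
    simpa using this
  · exact (((hpow 0 _).mul ((hmeas 0).inner hv.1)).const_mul _)
  · refine ae_of_all _ fun x t ht => ?_
    have ht : |t| < 1 := by simpa using ht
    rw [norm_mul, Real.norm_of_nonneg hp0.le, Real.norm_eq_abs]
    refine mul_le_mul_of_nonneg_left ((abs_rpow_mul_inner_le hp _ _).trans ?_) hp0.le
    refine Real.rpow_le_rpow (by positivity) ?_ hp0.le
    have h1 : ‖u x + t • v x‖ ≤ ‖u x‖ + |t| * ‖v x‖ :=
      (norm_add_le _ _).trans (by rw [norm_smul, Real.norm_eq_abs])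
    have h2 := norm_nonneg (u x)
    have h3 := mul_le_mul_of_nonneg_right ht.le (norm_nonneg (v x))
    linarith
  · have := (integrable_norm_add_norm_rpow hp0 hu hv).const_mul ((p + 1) * 2 ^ (p + 1))
    refine this.congr (ae_of_all _ fun x => ?_)
    simp only
    rw [Real.mul_rpow two_pos.le (by positivity), mul_assoc]
  · refine ae_of_all _ fun x t _ => ?_
    have h1 : HasDerivAt (fun t : ℝ => u x + t • v x) (v x) t := by
      simpa using ((hasDerivAt_id t).smul_const (v x)).const_add (u x)
    have h2 := (hasFDerivAt_norm_rpow (u x + t • v x) (by linarith : 1 < p + 1)).comp_hasDerivAt t h1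
    refine h2.congr_deriv ?_
    simp only [smul_apply, innerSL_apply_apply, smul_eq_mul]
    rw [mul_assoc]
    congr 3
    ring

theorem integral_norm_add_smul_sq {u v : E n → V} (hu : MemLp u 2 volume) (hv : MemLp v 2 volume)
    (t : ℝ) : ∫ x, ‖u x + t • v x‖ ^ 2
      = (∫ x, ‖u x‖ ^ 2) + t * (2 * ∫ x, ⟪u x, v x⟫) + t ^ 2 * ∫ x, ‖v x‖ ^ 2 := by
  have h1 := hu.integrable_norm_pow (by norm_num)
  have h2 := hv.integrable_norm_pow (by norm_num)
  have h3 := integrable_inner_of_memLp hu hv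
  have h4 : ∀ x, ‖u x + t • v x‖ ^ 2
      = ‖u x‖ ^ 2 + t * (2 * ⟪u x, v x⟫) + t ^ 2 * ‖v x‖ ^ 2 := by
    intro x
    rw [norm_add_sq_real, inner_smul_right, norm_smul, mul_pow, Real.norm_eq_abs, sq_abs]
    ring
  have h5 : Integrable (fun x => t * (2 * ⟪u x, v x⟫)) volume := (h3.const_mul 2).const_mul t
  have h6 : Integrable (fun x => ‖u x‖ ^ 2 + t * (2 * ⟪u x, v x⟫)) volume := h1.add h5
  simp only [h4]
  rw [integral_add h6 (h2.const_mul _), integral_add h1 h5, integral_const_mul, integral_const_mul,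
    integral_const_mul]

theorem gradSq_add_smul {w z : Fin n → E n → V} (hw : ∀ i, MemLp (w i) 2 volume)
    (hz : ∀ i, MemLp (z i) 2 volume) (t : ℝ) : gradSq (fun i x => w i x + t • z i x)
      = gradSq w + t * (2 * ∑ i, ∫ x, ⟪w i x, z i x⟫) + t ^ 2 * gradSq z := by
  simp only [gradSq, integral_norm_add_smul_sq (hw _) (hz _), Finset.sum_add_distrib,
    Finset.mul_sum]

theorem hasDerivAt_quadratic (a b c : ℝ) :
    HasDerivAt (fun t : ℝ => a + t * (2 * b) + t ^ 2 * c) (2 * b) 0 := by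
  have := (((hasDerivAt_id (0 : ℝ)).mul_const (2 * b)).const_add a).add
    (((hasDerivAt_id (0 : ℝ)).pow 2).mul_const c)
  refine (this.congr_deriv (by simp)).congr_of_eventuallyEq (Eventually.of_forall fun t => ?_)
  simp

variable {G : Subgroup (Matrix.specialOrthogonalGroup (Fin n) ℝ)}

theorem MemH1Equiv.add_smul {π : G →* (V ≃ₗᵢ[ℂ] V)} {u v : E n → V} (hu : MemH1Equiv π u)
    (hv : MemH1Equiv π v) (t : ℝ) : MemH1Equiv π (fun x => u x + t • v x) := by
  refine ⟨(hu.1.isH1.add_smul hv.1.isH1 t).memH1, fun g => ?_⟩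
  filter_upwards [hu.2 g, hv.2 g] with x h1 h2
  rw [h1, h2, map_add, ← Complex.coe_smul, ← Complex.coe_smul, map_smul]

/-- The Euler–Lagrange equation of a maximiser, tested against equivariant functions. -/
theorem euler_lagrange_equivariant [FiniteDimensional ℂ V] (hn : 2 ≤ n) {p : ℝ} (hp : 1 < p)
    (hp' : 2 < n → p < ((n : ℝ) + 2) / ((n : ℝ) - 2))
    (π : G →* (V ≃ₗᵢ[ℂ] V)) {u : E n → V} (hu : IsNonzeroH1Equiv π u)
    (hmax : weinstein p u = weinsteinSup p π) {w : Fin n → E n → V} (h : IsH1 u w)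
    {v : E n → V} {z : Fin n → E n → V} (hv : MemH1Equiv π v) (h' : IsH1 v z) :
    (∑ i, ∫ x, ⟪w i x, z i x⟫)
        + alpha n p / beta n p * (gradSq w / ∫ x, ‖u x‖ ^ 2) * ∫ x, ⟪u x, v x⟫
      = (p + 1) / beta n p * (gradSq w / ∫ x, ‖u x‖ ^ (p + 1))
        * ∫ x, ‖u x‖ ^ (p - 1) * ⟪u x, v x⟫ := by
  have : CompleteSpace V := FiniteDimensional.complete ℂ V
  have hq := subcritical hp'
  have hβ := beta_pos hn hp
  have hA := integral_norm_sq_pos h.1 hu.2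
  have hB := h.gradSq_pos hn hu.2
  have hS := hu.weinstein_pos hn hp hq
  have hSup := hmax
  rw [h.weinstein_eq hp] at hmax
  set A := ∫ x, ‖u x‖ ^ 2 with hAdef
  set B := gradSq w with hBdef
  set N := ∫ x, ‖u x‖ ^ (p + 1) with hNdef
  set a := ∫ x, ⟪u x, v x⟫
  set b := ∑ i, ∫ x, ⟪w i x, z i x⟫
  set c := ∫ x, ‖u x‖ ^ (p - 1) * ⟪u x, v x⟫
  set S := weinsteinSup p π
  have hsA := Real.sqrt_pos.2 hA
  have hsB := Real.sqrt_pos.2 hB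
  have hNS : N = S * (√A ^ alpha n p * √B ^ beta n p) :=
    (div_eq_iff (by positivity)).1 hmax
  have hS' : 0 < S := by rwa [hSup] at hS
  have hN : 0 < N := by rw [hNS]; positivity
  let At : ℝ → ℝ := fun t => ∫ x, ‖u x + t • v x‖ ^ 2
  let Bt : ℝ → ℝ := fun t => gradSq (fun i x => w i x + t • z i x)
  let Nt : ℝ → ℝ := fun t => ∫ x, ‖u x + t • v x‖ ^ (p + 1)
  have hA0 : At 0 = A := by simp [At, A]
  have hB0 : Bt 0 = B := by simp [Bt, B]
  have hN0 : Nt 0 = N := by simp [Nt, N]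
  have dA : HasDerivAt At (2 * a) 0 := by
    have : At = fun t => A + t * (2 * a) + t ^ 2 * ∫ x, ‖v x‖ ^ 2 :=
      funext fun t => integral_norm_add_smul_sq h.1 h'.1 t
    rw [this]
    exact hasDerivAt_quadratic _ _ _
  have dB : HasDerivAt Bt (2 * b) 0 := by
    have : Bt = fun t => B + t * (2 * b) + t ^ 2 * gradSq z :=
      funext fun t => gradSq_add_smul (fun i => (h.2 i).1) (fun i => (h'.2 i).1) t
    rw [this]
    exact hasDerivAt_quadratic _ _ _
  have hp2 : 2 < p + 1 := by linarith
  have dN : HasDerivAt Nt ((p + 1) * c) 0 :=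
    hasDerivAt_integral_norm_rpow hp (h.memLp hn hp2 hq) (h'.memLp hn hp2 hq)
  have dA' := (dA.sqrt (by rw [hA0]; exact hA.ne')).rpow_const (p := alpha n p)
    (Or.inl (by rw [hA0]; exact hsA.ne'))
  have dB' := (dB.sqrt (by rw [hB0]; exact hB.ne')).rpow_const (p := beta n p)
    (Or.inl (by rw [hB0]; exact hsB.ne'))
  have dF := ((dA'.mul dB').const_mul S).sub dN
  -- Clearing the denominator of W gives S A^(α/2) B^(β/2) - N ≥ 0 along the whole line, with
  -- equality at t = 0. Unlike the quotient, this also makes sense when u + t v vanishes.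
  have hmin : IsLocalMin (fun t => S * (√(At t) ^ alpha n p * √(Bt t) ^ beta n p) - Nt t) 0 := by
    refine Eventually.of_forall fun t => ?_
    simp only [hA0, hB0, hN0]
    rw [← hNS, sub_self, sub_nonneg]
    by_cases h0 : (fun x => u x + t • v x) =ᵐ[volume] 0
    · have : Nt t = 0 := by
        simp only [Nt]
        rw [integral_congr_ae (g := fun _ => (0 : ℝ)), integral_zero]
        filter_upwards [h0] with x hx
        rw [hx, Pi.zero_apply, norm_zero, Real.zero_rpow (by linarith)]
      rw [this]
      positivity
    · have ht := h.add_smul h' t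
      have hne : IsNonzeroH1Equiv π (fun x => u x + t • v x) := ⟨hu.1.add_smul hv t, h0⟩
      have hle := le_csSup (bddAbove_weinsteinValues hn hp hq π) ⟨_, hne, rfl⟩
      rw [ht.weinstein_eq hp] at hle
      have h1 := Real.sqrt_pos.2 (integral_norm_sq_pos ht.1 h0)
      have h2 := Real.sqrt_pos.2 (ht.gradSq_pos hn h0)
      exact (div_le_iff₀ (by positivity)).1 hle
  have hzero := hmin.hasDerivAt_eq_zero dF
  rw [hA0, hB0, Real.rpow_sub_one hsA.ne', Real.rpow_sub_one hsB.ne'] at hzero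
  have hsA2 : √A * √A = A := Real.mul_self_sqrt hA.le
  have hsB2 : √B * √B = B := Real.mul_self_sqrt hB.le
  -- The vanishing derivative, with S A^(α/2) B^(β/2) replaced by N; multiplying by B/(β N) then
  -- gives the stated form.
  have key : alpha n p * a * N / A + beta n p * b * N / B = (p + 1) * c := by
    have e1 : alpha n p * a * N / A = S * (2 * a / (2 * √A) * alpha n p *
        (√A ^ alpha n p / √A) * √B ^ beta n p) := by
      rw [hNS]
      field_simp
      rw [Real.sq_sqrt hA.le]
    have e2 : beta n p * b * N / B = S * (√A ^ alpha n p * (2 * b / (2 * √B) * beta n p *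
        (√B ^ beta n p / √B))) := by
      rw [hNS]
      field_simp
      rw [Real.sq_sqrt hB.le]
    rw [e1, e2]
    linarith
  rw [show (p + 1) / beta n p * (B / N) * c = (p + 1) * c * (B / (beta n p * N)) by
    field_simp, ← key]
  field_simp
  ring

end FirstVariation

/-! ### Rotations acting on H¹ -/

section RotationOfSobolevFunctions

theorem fderiv_comp_rot (g : Matrix.specialOrthogonalGroup (Fin n) ℝ) {ψ : E n → ℝ}
    (hψ : ContDiff ℝ ∞ ψ) (i : Fin n) (x : E n) :
    fderiv ℝ (fun y => ψ (rot g y)) x (EuclideanSpace.single i 1)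
      = ∑ j, g.1 j i * fderiv ℝ ψ (rot g x) (EuclideanSpace.single j 1) := by
  have h1 : HasFDerivAt (rot g) ((rotEquiv g).toContinuousLinearEquiv : E n →L[ℝ] E n) x :=
    (rotEquiv g).toContinuousLinearEquiv.hasFDerivAt
  have h2 := ((hψ.differentiable (by simp)) (rot g x)).hasFDerivAt.comp x h1
  have h3 : rot g (EuclideanSpace.single i 1) = ∑ j, g.1 j i • EuclideanSpace.single j (1 : ℝ) := by
    ext k
    simp [rot, Finset.sum_apply, Pi.single_apply]
  rw [HasFDerivAt.fderiv (by exact h2)]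
  change fderiv ℝ ψ (rot g x) (rot g (EuclideanSpace.single i 1)) = _
  rw [h3, map_sum]
  simp only [map_smul, smul_eq_mul]

/-- A complex linear isometry as a real continuous linear map. -/
def realCLM (L : V ≃ₗᵢ[ℂ] V) : V →L[ℝ] V :=
  (L.toContinuousLinearEquiv : V →L[ℂ] V).restrictScalars ℝ

theorem realCLM_apply (L : V ≃ₗᵢ[ℂ] V) (a : V) : realCLM L a = L a := rfl

theorem integral_comp_rot (g : Matrix.specialOrthogonalGroup (Fin n) ℝ) {X : Type*}
    [NormedAddCommGroup X] [NormedSpace ℝ X] (f : E n → X) :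
    ∫ x, f (rot g x) = ∫ x, f x :=
  (measurePreserving_rot g).integral_comp (rotEquiv g).toHomeomorph.measurableEmbedding f

theorem memLp_comp_rot (g : Matrix.specialOrthogonalGroup (Fin n) ℝ) (L : V ≃ₗᵢ[ℂ] V)
    {u : E n → V} (hu : MemLp u 2 volume) : MemLp (fun x => L (u (rot g x))) 2 volume :=
  (realCLM L).comp_memLp' (hu.comp_measurePreserving (measurePreserving_rot g))

/-- Rotations of the domain and isometries of the target act on `H¹`. -/
theorem IsH1.rotate [CompleteSpace V] {u : E n → V} {w : Fin n → E n → V} (h : IsH1 u w)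
    (g : Matrix.specialOrthogonalGroup (Fin n) ℝ) (L : V ≃ₗᵢ[ℂ] V) :
    IsH1 (fun x => L (u (rot g x))) fun i x => ∑ j, g.1 j i • L (w j (rot g x)) := by
  refine ⟨memLp_comp_rot g L h.1, fun i => ⟨memLp_finsetSum _ fun j _ =>
    (memLp_comp_rot g L (h.2 j).1).const_smul (g.1 j i), ?_⟩⟩
  intro φ hφ hc
  -- The test function is carried along by g, and the chain rule expresses ∂ᵢφ through the partial
  -- derivatives of ψ with coefficients from column i of g.
  set ψ : E n → ℝ := fun y => φ ((rotEquiv g).symm y) with hψdef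
  have hψ : ContDiff ℝ ∞ ψ := hφ.comp (rotEquiv g).symm.contDiff
  have hψc : HasCompactSupport ψ := hc.comp_homeomorph (rotEquiv g).symm.toHomeomorph
  have hφψ : φ = fun x => ψ (rot g x) := by
    funext x
    simp only [hψdef]
    rw [← coe_rotEquiv, LinearIsometryEquiv.symm_apply_apply]
  have hl : ∀ {f : E n → V}, MemLp f 2 volume → LocallyIntegrable f volume := fun hf =>
    hf.locallyIntegrable (by norm_num)
  have hi1 : ∀ j, Integrable (fun y => fderiv ℝ ψ y (EuclideanSpace.single j 1) • u y) volume :=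
    fun j => integrable_test_smul (continuous_fderiv_single hψ j)
      (hasCompactSupport_fderiv_single hψc j) (hl h.1)
  have hi2 : ∀ j, Integrable (fun y => ψ y • w j y) volume := fun j =>
    integrable_test_smul hψ.continuous hψc (hl (h.2 j).1)
  have e1 : ∫ x, (fderiv ℝ φ x (EuclideanSpace.single i 1)) • L (u (rot g x))
      = ∑ j, g.1 j i • realCLM L (∫ y, fderiv ℝ ψ y (EuclideanSpace.single j 1) • u y) := by
    rw [hφψ]
    simp only [fderiv_comp_rot g hψ]
    rw [integral_comp_rot g fun y =>
      (∑ j, g.1 j i * fderiv ℝ ψ y (EuclideanSpace.single j 1)) • L (u y)]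
    simp only [← (realCLM L).integral_comp_comm (hi1 _)]
    simp only [← integral_smul]
    have hi3 : ∀ j, Integrable (fun y => g.1 j i • realCLM L
        (fderiv ℝ ψ y (EuclideanSpace.single j 1) • u y)) volume := fun j =>
      ((realCLM L).integrable_comp (hi1 j)).smul (g.1 j i)
    rw [← integral_finsetSum _ fun j _ => hi3 j]
    refine integral_congr_ae (ae_of_all _ fun y => ?_)
    simp only [Finset.sum_smul, map_smul, realCLM_apply, mul_smul]
  have e2 : ∫ x, φ x • ∑ j, g.1 j i • L (w j (rot g x))
      = ∑ j, g.1 j i • realCLM L (∫ y, ψ y • w j y) := by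
    rw [hφψ]
    rw [integral_comp_rot g fun y => ψ y • ∑ j, g.1 j i • L (w j y)]
    simp only [← (realCLM L).integral_comp_comm (hi2 _)]
    simp only [← integral_smul]
    have hi3 : ∀ j, Integrable (fun y => g.1 j i • realCLM L (ψ y • w j y)) volume := fun j =>
      ((realCLM L).integrable_comp (hi2 j)).smul (g.1 j i)
    rw [← integral_finsetSum _ fun j _ => hi3 j]
    refine integral_congr_ae (ae_of_all _ fun y => ?_)
    simp only [Finset.smul_sum, map_smul, realCLM_apply]
    exact Finset.sum_congr rfl fun j _ => smul_comm _ _ _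
  rw [e1, e2, ← Finset.sum_neg_distrib]
  refine Finset.sum_congr rfl fun j _ => ?_
  rw [(h.2 j).2 ψ hψ hψc, map_neg, smul_neg]

/-- Expanding the squares leaves the coefficients ∑ᵢ g_ji g_ki, the entries of g gᵀ = 1. Hence the
gradient norm is invariant under rotations. -/
theorem sum_norm_sq_rotate (g : Matrix.specialOrthogonalGroup (Fin n) ℝ) (a : Fin n → V) :
    ∑ i, ‖∑ j, g.1 j i • a j‖ ^ 2 = ∑ j, ‖a j‖ ^ 2 := by
  have hg : g.1 * g.1.transpose = 1 :=
    (Matrix.mem_orthogonalGroup_iff (Fin n) ℝ).1 (Matrix.mem_specialOrthogonalGroup_iff.1 g.2).1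
  have h1 : ∀ i, ‖∑ j, g.1 j i • a j‖ ^ 2 = ∑ j, ∑ k, g.1 j i * g.1 k i * ⟪a j, a k⟫ := by
    intro i
    rw [← real_inner_self_eq_norm_sq, sum_inner]
    refine Finset.sum_congr rfl fun j _ => ?_
    rw [inner_sum]
    refine Finset.sum_congr rfl fun k _ => ?_
    rw [real_inner_smul_left, real_inner_smul_right, mul_assoc]
  have h2 : ∀ j k, ∑ i, g.1 j i * g.1 k i = (1 : Matrix (Fin n) (Fin n) ℝ) j k := by
    intro j k
    rw [← hg, Matrix.mul_apply]
    rfl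
  simp only [h1]
  rw [Finset.sum_comm]
  refine Finset.sum_congr rfl fun j _ => ?_
  rw [Finset.sum_comm]
  simp only [← Finset.sum_mul, h2, Matrix.one_apply, ite_mul, one_mul, zero_mul,
    Finset.sum_ite_eq, Finset.mem_univ, if_true, real_inner_self_eq_norm_sq]

theorem gradSq_rotate {w : Fin n → E n → V} (hw : ∀ i, MemLp (w i) 2 volume)
    (g : Matrix.specialOrthogonalGroup (Fin n) ℝ) (L : V ≃ₗᵢ[ℂ] V) :
    gradSq (fun i x => ∑ j, g.1 j i • L (w j (rot g x))) = gradSq w := by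
  have h1 : ∀ i, Integrable (fun x => ‖w i x‖ ^ 2) volume := fun i =>
    (hw i).integrable_norm_pow (by norm_num)
  have h2 : ∀ i, Integrable (fun x => ‖∑ j, g.1 j i • L (w j (rot g x))‖ ^ 2) volume := fun i =>
    (memLp_finsetSum _ fun j _ => (memLp_comp_rot g L (hw j)).const_smul
      (g.1 j i)).integrable_norm_pow (by norm_num)
  simp only [gradSq]
  rw [← integral_finsetSum _ fun i _ => h2 i, ← integral_finsetSum _ fun i _ => h1 i,
    ← integral_comp_rot g fun x => ∑ i, ‖w i x‖ ^ 2]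
  refine integral_congr_ae (ae_of_all _ fun x => ?_)
  simp only [sum_norm_sq_rotate, LinearIsometryEquiv.norm_map]

theorem inner_map_isometry (L : V ≃ₗᵢ[ℂ] V) (a b : V) : ⟪L a, L b⟫ = ⟪a, b⟫ :=
  congrArg Complex.re (L.inner_map_map a b)

end RotationOfSobolevFunctions

/-! ### The inner product of H¹ -/

section SobolevInnerProduct

/-- The inner product of `H¹`. -/
def h1Inner (u : E n → V) (w : Fin n → E n → V) (v : E n → V) (z : Fin n → E n → V) : ℝ :=
  (∫ x, ⟪u x, v x⟫) + ∑ i, ∫ x, ⟪w i x, z i x⟫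

theorem h1Inner_comm (u v : E n → V) (w z : Fin n → E n → V) :
    h1Inner u w v z = h1Inner v z u w := by
  simp only [h1Inner, real_inner_comm]

theorem h1Inner_self (u : E n → V) (w : Fin n → E n → V) :
    h1Inner u w u w = (∫ x, ‖u x‖ ^ 2) + gradSq w := by
  simp only [h1Inner, gradSq, real_inner_self_eq_norm_sq]

theorem integral_inner_add_smul {u v f : E n → V} (hu : MemLp u 2 volume) (hv : MemLp v 2 volume)
    (hf : MemLp f 2 volume) (t : ℝ) :
    ∫ x, ⟪u x, v x + t • f x⟫ = (∫ x, ⟪u x, v x⟫) + t * ∫ x, ⟪u x, f x⟫ := by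
  rw [← integral_const_mul, ← integral_add (integrable_inner_of_memLp hu hv)
    ((integrable_inner_of_memLp hu hf).const_mul t)]
  simp only [inner_add_right, real_inner_smul_right]

theorem IsH1.h1Inner_add_smul {u v f : E n → V} {w z y : Fin n → E n → V} (hu : IsH1 u w)
    (hv : IsH1 v z) (hf : IsH1 f y) (t : ℝ) :
    h1Inner u w (fun x => v x + t • f x) (fun i x => z i x + t • y i x)
      = h1Inner u w v z + t * h1Inner u w f y := by
  simp only [h1Inner, integral_inner_add_smul hu.1 hv.1 hf.1,
    integral_inner_add_smul (hu.2 _).1 (hv.2 _).1 (hf.2 _).1, Finset.sum_add_distrib,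
    ← Finset.mul_sum]
  ring

/-- The hypothesis says ‖u - f‖² ≤ 0 in H¹. It serves twice for symmetric criticality: to show that
the representative is equivariant, and that it equals u. -/
theorem IsH1.ae_eq_of_h1Inner {u f : E n → V} {w z : Fin n → E n → V} (hu : IsH1 u w)
    (hf : IsH1 f z) (h : h1Inner u w u w + h1Inner f z f z ≤ 2 * h1Inner u w f z) :
    u =ᵐ[volume] f ∧ ∀ i, w i =ᵐ[volume] z i := by
  have hd := hu.add_smul hf (-1)
  have h1 : h1Inner (fun x => u x + (-1 : ℝ) • f x) (fun i x => w i x + (-1 : ℝ) • z i x)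
      (fun x => u x + (-1 : ℝ) • f x) (fun i x => w i x + (-1 : ℝ) • z i x) ≤ 0 := by
    rw [hd.h1Inner_add_smul hu hf, h1Inner_comm _ u, h1Inner_comm _ f, hu.h1Inner_add_smul hu hf,
      hf.h1Inner_add_smul hu hf, h1Inner_comm f]
    linarith
  rw [h1Inner_self] at h1
  have h2 := integral_norm_sq_nonneg fun x => u x + (-1 : ℝ) • f x
  have h3 := gradSq_nonneg fun i x => w i x + (-1 : ℝ) • z i x
  have key : ∀ {a b : E n → V}, MemLp (fun x => a x + (-1 : ℝ) • b x) 2 volume →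
      ∫ x, ‖a x + (-1 : ℝ) • b x‖ ^ 2 = 0 → a =ᵐ[volume] b := by
    intro a b hm h0
    by_contra hne
    refine (integral_norm_sq_pos hm fun h00 => hne ?_).ne' h0
    filter_upwards [h00] with x hx
    rw [neg_one_smul, ← sub_eq_add_neg] at hx
    exact sub_eq_zero.1 hx
  refine ⟨key hd.1 (by linarith), fun i => key (hd.2 i).1 ?_⟩
  have h4 : gradSq (fun i x => w i x + (-1 : ℝ) • z i x) = 0 := by linarith
  exact (Finset.sum_eq_zero_iff_of_nonneg fun i _ => integral_norm_sq_nonneg _).1 h4 i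
    (Finset.mem_univ i)

end SobolevInnerProduct

/-! ### Symmetric criticality -/

section SymmetricCriticality

theorem add_rpow_le_two_rpow_mul {q a b : ℝ} (hq : 0 ≤ q) (ha : 0 ≤ a) (hb : 0 ≤ b) :
    (a + b) ^ q ≤ 2 ^ q * (a ^ q + b ^ q) := by
  rcases le_total a b with h | h
  · calc (a + b) ^ q ≤ (2 * b) ^ q := Real.rpow_le_rpow (by positivity) (by linarith) hq
      _ = 2 ^ q * b ^ q := Real.mul_rpow two_pos.le hb
      _ ≤ _ := mul_le_mul_of_nonneg_left (by linarith [Real.rpow_nonneg ha q]) (by positivity)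
  · calc (a + b) ^ q ≤ (2 * a) ^ q := Real.rpow_le_rpow (by positivity) (by linarith) hq
      _ = 2 ^ q * a ^ q := Real.mul_rpow two_pos.le ha
      _ ≤ _ := mul_le_mul_of_nonneg_left (by linarith [Real.rpow_nonneg hb q]) (by positivity)

theorem integrable_rpow_mul_inner {p : ℝ} (hp : 1 < p) {u v : E n → V}
    (hu : MemLp u (ENNReal.ofReal (p + 1)) volume) (hv : MemLp v (ENNReal.ofReal (p + 1)) volume) :
    Integrable (fun x => ‖u x‖ ^ (p - 1) * ⟪u x, v x⟫) volume :=
  (integrable_norm_add_norm_rpow (by linarith) hu hv).mono'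
    ((hu.1.norm.aemeasurable.pow_const _).aestronglyMeasurable.mul (hu.1.inner hv.1))
    (ae_of_all _ fun x => abs_rpow_mul_inner_le hp (u x) (v x))

theorem abs_integral_inner_le {u v : E n → V} (hu : MemLp u 2 volume) (hv : MemLp v 2 volume) :
    |∫ x, ⟪u x, v x⟫| ≤ (∫ x, ‖u x‖ ^ 2) + ∫ x, ‖v x‖ ^ 2 := by
  have h1 : Integrable (fun x => ‖u x‖ ^ 2) volume := hu.integrable_norm_pow (by norm_num)
  have h2 : Integrable (fun x => ‖v x‖ ^ 2) volume := hv.integrable_norm_pow (by norm_num)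
  rw [← integral_add h1 h2]
  refine (abs_integral_le_integral_abs).trans
    (integral_mono (integrable_inner_of_memLp hu hv).abs (h1.add h2) fun x => ?_)
  refine (abs_real_inner_le_norm _ _).trans ?_
  nlinarith [sq_nonneg (‖u x‖ - ‖v x‖), sq_nonneg ‖u x‖, sq_nonneg ‖v x‖]

/-- Continuity of the nonlinear functional on H¹: the L^(p+1) norm is uniformly bounded on the H¹
unit ball, and u is fixed. This is what the Riesz theorem needs. -/
theorem exists_abs_integral_rpow_mul_inner_le [CompleteSpace V] (hn : 2 ≤ n) {p : ℝ} (hp : 1 < p)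
    (hq : 2 < n → p + 1 < 2 * n / ((n : ℝ) - 2)) {u : E n → V}
    (hu : MemLp u (ENNReal.ofReal (p + 1)) volume) :
    ∃ C : ℝ, ∀ (v : E n → V) (z : Fin n → E n → V), IsH1 v z → (∫ x, ‖v x‖ ^ 2) ≤ 1 →
      gradSq z ≤ 1 → |∫ x, ‖u x‖ ^ (p - 1) * ⟪u x, v x⟫| ≤ C := by
  have hp0 : 0 < p + 1 := by linarith
  have hp2 : 2 < p + 1 := by linarith
  have hpow : ∀ {f : E n → V}, MemLp f (ENNReal.ofReal (p + 1)) volume →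
      Integrable (fun x => ‖f x‖ ^ (p + 1)) volume := by
    intro f hf
    have := hf.integrable_norm_rpow (by simpa using hp0) ENNReal.ofReal_ne_top
    rwa [ENNReal.toReal_ofReal hp0.le] at this
  obtain ⟨K, hK⟩ := exists_eLpNorm_le (V := V) hn hp2 hq 1
  refine ⟨2 ^ (p + 1) * ((∫ x, ‖u x‖ ^ (p + 1)) + (K : ℝ) ^ (p + 1)), fun v z h hv1 hv2 => ?_⟩
  have hv := h.memLp hn hp2 hq
  have hvK : ∫ x, ‖v x‖ ^ (p + 1) ≤ (K : ℝ) ^ (p + 1) := by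
    rw [← normLq_rpow hp0 hv.1]
    exact Real.rpow_le_rpow (normLq_nonneg _ _)
      (ENNReal.toReal_mono ENNReal.coe_ne_top (hK v z h hv1 hv2)) hp0.le
  have hint := integrable_rpow_mul_inner hp hu hv
  calc |∫ x, ‖u x‖ ^ (p - 1) * ⟪u x, v x⟫|
      ≤ ∫ x, |‖u x‖ ^ (p - 1) * ⟪u x, v x⟫| := abs_integral_le_integral_abs
    _ ≤ ∫ x, 2 ^ (p + 1) * (‖u x‖ ^ (p + 1) + ‖v x‖ ^ (p + 1)) := by
        refine integral_mono hint.abs (((hpow hu).add (hpow hv)).const_mul _) fun x => ?_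
        exact (abs_rpow_mul_inner_le hp _ _).trans
          (add_rpow_le_two_rpow_mul hp0.le (norm_nonneg _) (norm_nonneg _))
    _ = 2 ^ (p + 1) * ((∫ x, ‖u x‖ ^ (p + 1)) + ∫ x, ‖v x‖ ^ (p + 1)) := by
        rw [integral_const_mul, integral_add (hpow hu) (hpow hv)]
    _ ≤ _ := by gcongr

variable {G : Subgroup (Matrix.specialOrthogonalGroup (Fin n) ℝ)}

/-- Representation in `H¹` of the functional `v ↦ ∫ ⟪a u + K |u|^{p-1} u, v⟫`. -/
theorem IsH1.exists_representative [CompleteSpace V] (hn : 2 ≤ n) {p : ℝ} (hp : 1 < p)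
    (hq : 2 < n → p + 1 < 2 * n / ((n : ℝ) - 2)) {u : E n → V} {w : Fin n → E n → V}
    (h : IsH1 u w) (a K : ℝ) :
    ∃ (f : E n → V) (y : Fin n → E n → V), IsH1 f y ∧
      ∀ (v : E n → V) (z : Fin n → E n → V), IsH1 v z →
        a * (∫ x, ⟪u x, v x⟫) + K * (∫ x, ‖u x‖ ^ (p - 1) * ⟪u x, v x⟫) = h1Inner f y v z := by
  have hp2 : 2 < p + 1 := by linarith
  have hu := h.memLp hn hp2 hq
  obtain ⟨C, hC⟩ := exists_abs_integral_rpow_mul_inner_le hn hp hq hu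
  have hinner : ∀ (v : E n → V) (x : E n), ⟪a • u x + K • ‖u x‖ ^ (p - 1) • u x, v x⟫
      = a * ⟪u x, v x⟫ + K * (‖u x‖ ^ (p - 1) * ⟪u x, v x⟫) := by
    intro v x
    rw [inner_add_left, real_inner_smul_left, real_inner_smul_left, real_inner_smul_left]
  have hsplit : ∀ (v : E n → V) (z : Fin n → E n → V), IsH1 v z →
      Integrable (fun x => ⟪a • u x + K • ‖u x‖ ^ (p - 1) • u x, v x⟫) volume ∧
      ∫ x, ⟪a • u x + K • ‖u x‖ ^ (p - 1) • u x, v x⟫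
        = a * (∫ x, ⟪u x, v x⟫) + K * (∫ x, ‖u x‖ ^ (p - 1) * ⟪u x, v x⟫) := by
    intro v z hv
    have i1 := (integrable_inner_of_memLp h.1 hv.1).const_mul a
    have i2 := (integrable_rpow_mul_inner hp hu (hv.memLp hn hp2 hq)).const_mul K
    simp only [hinner]
    exact ⟨i1.add i2, by rw [integral_add i1 i2, integral_const_mul, integral_const_mul]⟩
  obtain ⟨f, y, hf, hy, hfy, hrep⟩ := exists_riesz
    (fun x => a • u x + K • ‖u x‖ ^ (p - 1) • u x)
    (|a| * ((∫ x, ‖u x‖ ^ 2) + 1) + |K| * C) (fun v z hv hz hvz => by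
      have hvH : IsH1 v z := ⟨hv, fun i => ⟨hz i, hvz i⟩⟩
      obtain ⟨i1, i2⟩ := hsplit v z hvH
      refine ⟨i1, fun hle => ?_⟩
      rw [i2]
      have n1 := integral_norm_sq_nonneg v
      have n2 := gradSq_nonneg z
      change (∫ x, ‖v x‖ ^ 2) + gradSq z ≤ 1 at hle
      refine (abs_add_le _ _).trans ?_
      rw [abs_mul, abs_mul]
      refine add_le_add (mul_le_mul_of_nonneg_left ?_ (abs_nonneg _))
        (mul_le_mul_of_nonneg_left (hC v z hvH (by linarith) (by linarith)) (abs_nonneg _))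
      exact (abs_integral_inner_le h.1 hv).trans (by linarith))
  refine ⟨f, y, ⟨hf, fun i => ⟨hy i, hfy i⟩⟩, fun v z hv => ?_⟩
  rw [← (hsplit v z hv).2]
  exact hrep v z hv.1 (fun i => (hv.2 i).1) fun i => (hv.2 i).2

/-- The Euler–Lagrange equation of a maximiser, tested against arbitrary functions (principle of
symmetric criticality). -/
theorem euler_lagrange [FiniteDimensional ℂ V] (hn : 2 ≤ n) {p : ℝ} (hp : 1 < p)
    (hp' : 2 < n → p < ((n : ℝ) + 2) / ((n : ℝ) - 2))
    (π : G →* (V ≃ₗᵢ[ℂ] V)) {u : E n → V} (hu : IsNonzeroH1Equiv π u)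
    (hmax : weinstein p u = weinsteinSup p π) {w : Fin n → E n → V} (h : IsH1 u w)
    {v : E n → V} {z : Fin n → E n → V} (hv : IsH1 v z) :
    (∑ i, ∫ x, ⟪w i x, z i x⟫)
        + alpha n p / beta n p * (gradSq w / ∫ x, ‖u x‖ ^ 2) * ∫ x, ⟪u x, v x⟫
      = (p + 1) / beta n p * (gradSq w / ∫ x, ‖u x‖ ^ (p + 1))
        * ∫ x, ‖u x‖ ^ (p - 1) * ⟪u x, v x⟫ := by
  have : CompleteSpace V := FiniteDimensional.complete ℂ V
  have hq := subcritical hp'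
  have hEL := fun (v : E n → V) (z : Fin n → E n → V) =>
    euler_lagrange_equivariant (v := v) (z := z) hn hp hp' π hu hmax h
  set lam := alpha n p / beta n p * (gradSq w / ∫ x, ‖u x‖ ^ 2)
  set K := (p + 1) / beta n p * (gradSq w / ∫ x, ‖u x‖ ^ (p + 1))
  -- Adding (1 - λ) ∫ ⟪u, v⟫ to both sides completes the gradient term to the full H¹ inner product.
  -- The identity for v then reads ⟨u, v⟩ = ⟨f, v⟩, and the aim is u = f.
  obtain ⟨f, y, hf, hrep⟩ := h.exists_representative hn hp hq (1 - lam) K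
  -- Let f' = π(g)⁻¹ f(g ·). Equivariance of u makes the functional invariant, so ⟨f, f'⟩ = ⟨f, f⟩,
  -- and ‖f'‖ = ‖f‖; therefore f' = f. No averaging over G is involved.
  have hfequiv : MemH1Equiv π f := by
    refine ⟨hf.memH1, fun g => ?_⟩
    have hT := hf.rotate g.1 (π g).symm
    have e1 : h1Inner f y (fun x => (π g).symm (f (rot g.1 x)))
        (fun i x => ∑ j, g.1.1 j i • (π g).symm (y j (rot g.1 x))) = h1Inner f y f y := by
      have key : ∀ x, u (rot g.1 x) = π g (u x) →
          ⟪u x, (π g).symm (f (rot g.1 x))⟫ = ⟪u (rot g.1 x), f (rot g.1 x)⟫ ∧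
          ‖u x‖ = ‖u (rot g.1 x)‖ := by
        intro x hx
        rw [hx, ← inner_map_isometry (π g) (u x), LinearIsometryEquiv.apply_symm_apply,
          LinearIsometryEquiv.norm_map]
        exact ⟨rfl, rfl⟩
      rw [← hrep _ _ hT, ← hrep _ _ hf, ← integral_comp_rot g.1 fun x => ⟪u x, f x⟫,
        ← integral_comp_rot g.1 fun x => ‖u x‖ ^ (p - 1) * ⟪u x, f x⟫]
      congr 2
      · refine integral_congr_ae ?_
        filter_upwards [hu.1.2 g] with x hx
        exact (key x hx).1
      · refine integral_congr_ae ?_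
        filter_upwards [hu.1.2 g] with x hx
        rw [(key x hx).1, (key x hx).2]
    have e2 : h1Inner (fun x => (π g).symm (f (rot g.1 x)))
        (fun i x => ∑ j, g.1.1 j i • (π g).symm (y j (rot g.1 x)))
        (fun x => (π g).symm (f (rot g.1 x)))
        (fun i x => ∑ j, g.1.1 j i • (π g).symm (y j (rot g.1 x))) = h1Inner f y f y := by
      rw [h1Inner_self, h1Inner_self, gradSq_rotate (fun i => (hf.2 i).1)]
      simp only [LinearIsometryEquiv.norm_map]
      rw [integral_comp_rot g.1 fun x => ‖f x‖ ^ 2]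
    filter_upwards [(hf.ae_eq_of_h1Inner hT (by rw [e1, e2]; linarith)).1] with x hx
    rw [hx, LinearIsometryEquiv.apply_symm_apply]
  -- Since f is equivariant, u - f is an admissible variation, and testing with it gives ⟨u - f, u -
  -- f⟩ = 0.
  have hd := h.add_smul hf (-1)
  have e3 : h1Inner u w (fun x => u x + (-1 : ℝ) • f x) (fun i x => w i x + (-1 : ℝ) • y i x)
      = h1Inner f y (fun x => u x + (-1 : ℝ) • f x) (fun i x => w i x + (-1 : ℝ) • y i x) := by
    rw [← hrep _ _ hd, h1Inner]
    linarith [hEL _ _ (hu.1.add_smul hfequiv (-1)) hd]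
  rw [h.h1Inner_add_smul h hf, hf.h1Inner_add_smul h hf, h1Inner_comm f u y w] at e3
  obtain ⟨h1, h2⟩ := h.ae_eq_of_h1Inner hf (by linarith)
  have e4 : h1Inner u w v z = h1Inner f y v z := by
    simp only [h1Inner]
    congr 1
    · refine integral_congr_ae ?_
      filter_upwards [h1] with x hx
      rw [hx]
    · refine Finset.sum_congr rfl fun i _ => integral_congr_ae ?_
      filter_upwards [h2 i] with x hx
      rw [hx]
  rw [← hrep _ _ hv, h1Inner] at e4
  linarith

end SymmetricCriticality

/-! ### The equation in the sense of distributions -/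

section Distributions

theorem isH1_test_smul [CompleteSpace V] {φ : E n → ℝ} (hφ : ContDiff ℝ ∞ φ) (hc : HasCompactSupport φ) (e : V) :
    IsH1 (fun x => φ x • e) fun i x => fderiv ℝ φ x (EuclideanSpace.single i 1) • e := by
  have hd := fun i => continuous_fderiv_single hφ i
  have hdc := fun i => hasCompactSupport_fderiv_single hc i
  refine ⟨memLp_smul_const hφ.continuous hc e, fun i =>
    ⟨memLp_smul_const (hd i) (hdc i) e, fun ψ hψ hψc => ?_⟩⟩
  have hdψ := continuous_fderiv_single hψ i
  have key : ∫ x, φ x * fderiv ℝ ψ x (EuclideanSpace.single i 1)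
      = -∫ x, fderiv ℝ φ x (EuclideanSpace.single i 1) * ψ x :=
    integral_mul_fderiv_eq_neg_fderiv_mul_of_integrable
      (((hd i).mul hψ.continuous).integrable_of_hasCompactSupport (hψc.mul_left))
      ((hφ.continuous.mul hdψ).integrable_of_hasCompactSupport hc.mul_right)
      ((hφ.continuous.mul hψ.continuous).integrable_of_hasCompactSupport hc.mul_right)
      (fun x _ => hφ.differentiable (by simp) x) fun x _ => hψ.differentiable (by simp) x
  simp only [smul_smul]
  rw [integral_smul_const, integral_smul_const, ← neg_smul]
  congr 1
  simp only [mul_comm (fderiv ℝ ψ _ _), mul_comm (ψ _)]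
  exact key

theorem contDiff_fderiv_single {φ : E n → ℝ} (hφ : ContDiff ℝ ∞ φ) (i : Fin n) :
    ContDiff ℝ ∞ fun x => fderiv ℝ φ x (EuclideanSpace.single i 1) :=
  (hφ.fderiv_right (by simp)).clm_apply contDiff_const

theorem laplacian_eq_sum_fderiv {φ : E n → ℝ} (hφ : ContDiff ℝ ∞ φ) (x : E n) :
    Laplacian.laplacian φ x = ∑ i, fderiv ℝ
      (fun y => fderiv ℝ φ y (EuclideanSpace.single i 1)) x (EuclideanSpace.single i 1) := by
  rw [InnerProductSpace.laplacian_eq_iteratedFDeriv_orthonormalBasis φ (EuclideanSpace.basisFun (Fin n) ℝ)]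
  refine Finset.sum_congr rfl fun i _ => ?_
  have hd : DifferentiableAt ℝ (fderiv ℝ φ) x :=
    (hφ.fderiv_right (m := ∞) (by simp)).differentiable (by simp) x
  rw [iteratedFDeriv_two_apply, fderiv_clm_apply hd (differentiableAt_const _)]
  simp

/-- Pointwise |u|^p ≤ 1 + |u|^(p+1). -/
theorem locallyIntegrable_rpow_smul {p : ℝ} (hp : 1 < p) {u : E n → V}
    (hu : MemLp u (ENNReal.ofReal (p + 1)) volume) :
    LocallyIntegrable (fun x => ‖u x‖ ^ (p - 1) • u x) volume := by
  have hp0 : 0 < p + 1 := by linarith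
  have hpow := hu.integrable_norm_rpow (by simpa using hp0) ENNReal.ofReal_ne_top
  rw [ENNReal.toReal_ofReal hp0.le] at hpow
  refine ((locallyIntegrable_const (1 : ℝ)).add hpow.locallyIntegrable).mono
    ((hu.1.norm.aemeasurable.pow_const _).aestronglyMeasurable.smul hu.1) (ae_of_all _ fun x => ?_)
  simp only [Pi.add_apply]
  have h0 := norm_nonneg (u x)
  rw [norm_smul, Real.norm_of_nonneg (by positivity), Real.norm_of_nonneg (by positivity)]
  have h1 : ‖u x‖ ^ (p - 1) * ‖u x‖ = ‖u x‖ ^ p := by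
    nth_rewrite 2 [← Real.rpow_one ‖u x‖]
    rw [← Real.rpow_add_of_nonneg h0 (by linarith) zero_le_one, sub_add_cancel]
  rw [h1]
  rcases le_total ‖u x‖ 1 with h | h
  · linarith [Real.rpow_le_one h0 h (by linarith : 0 ≤ p), Real.rpow_nonneg h0 (p + 1)]
  · linarith [Real.rpow_le_rpow_of_exponent_le h (by linarith : p ≤ p + 1)]

variable {G : Subgroup (Matrix.specialOrthogonalGroup (Fin n) ℝ)}

/-- Maximisers of the Weinstein functional solve the nonlinear elliptic equation. -/
theorem solvesNLS_of_maximiser [FiniteDimensional ℂ V] (hn : 2 ≤ n) {p : ℝ} (hp : 1 < p)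
    (hp' : 2 < n → p < ((n : ℝ) + 2) / ((n : ℝ) - 2))
    (π : G →* (V ≃ₗᵢ[ℂ] V)) {u : E n → V} (hu : IsNonzeroH1Equiv π u)
    (hmax : weinstein p u = weinsteinSup p π) :
    SolvesNLS p (alpha n p / beta n p * (normGrad u ^ 2 / normLq 2 u ^ 2))
      ((p + 1) / beta n p * (normGrad u ^ 2 / normLq (p + 1) u ^ (p + 1))) u := by
  have : CompleteSpace V := FiniteDimensional.complete ℂ V
  have h := hu.1.1.isH1
  have hup := h.memLp hn (by linarith) (subcritical hp')
  intro φ hφ hc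
  rw [h.normGrad_eq, Real.sq_sqrt (gradSq_nonneg _), normLq_two_sq h.1.1,
    normLq_rpow (by linarith) h.1.1]
  -- The vector identity is checked by pairing with every e in V; the pairing is the weak equation
  -- tested against φ • e.
  have hEL := fun e : V => euler_lagrange hn hp hp' π hu hmax h (isH1_test_smul hφ hc e)
  set lam := alpha n p / beta n p * (gradSq (fun i => weakPartial i u) / ∫ x, ‖u x‖ ^ 2)
  set K := (p + 1) / beta n p * (gradSq (fun i => weakPartial i u) / ∫ x, ‖u x‖ ^ (p + 1))
  have hd := fun i => continuous_fderiv_single hφ i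
  have hdc := fun i => hasCompactSupport_fderiv_single hc i
  have hlap : ∫ x, Laplacian.laplacian φ x • u x
      = -∑ i, ∫ x, fderiv ℝ φ x (EuclideanSpace.single i 1) • weakPartial i u x := by
    simp only [laplacian_eq_sum_fderiv hφ, Finset.sum_smul]
    rw [integral_finsetSum _ fun i _ => integrable_test_smul
      (continuous_fderiv_single (contDiff_fderiv_single hφ i) i)
      (hasCompactSupport_fderiv_single (hdc i) i) h.locallyIntegrable, ← Finset.sum_neg_distrib]
    exact Finset.sum_congr rfl fun i _ => (h.2 i).2 _ (contDiff_fderiv_single hφ i) (hdc i)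
  refine ext_inner_right ℝ fun e => ?_
  have h2 : ∀ i, ⟪∫ x, fderiv ℝ φ x (EuclideanSpace.single i 1) • weakPartial i u x, e⟫
      = ∫ x, ⟪weakPartial i u x, fderiv ℝ φ x (EuclideanSpace.single i 1) • e⟫ := fun i =>
    inner_integral_test_smul (hd i) (hdc i) ((h.2 i).1.locallyIntegrable (by norm_num)) e
  have h3 := inner_integral_test_smul hφ.continuous hc h.locallyIntegrable e
  have h4 : ⟪∫ x, φ x • ‖u x‖ ^ (p - 1) • u x, e⟫
      = ∫ x, ‖u x‖ ^ (p - 1) * ⟪u x, φ x • e⟫ := by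
    rw [inner_integral_test_smul hφ.continuous hc (locallyIntegrable_rpow_smul hp hup) e]
    simp only [real_inner_smul_left]
  rw [inner_zero_left, inner_add_left, inner_sub_left, real_inner_smul_left, real_inner_smul_left,
    hlap, inner_neg_left, sum_inner, h3, h4]
  simp only [h2]
  linarith [hEL e]

end Distributions

end SphericalVortex

end

/-! ### The main theorem -/

theorem proposition2p9 (n : ℕ) (hn : 2 ≤ n) (p : ℝ) (hp : 1 < p)
    (hp' : 2 < n → p < ((n : ℝ) + 2) / ((n : ℝ) - 2))
    {V : Type*} [NormedAddCommGroup V] [InnerProductSpace ℂ V] [FiniteDimensional ℂ V]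
    (G : Subgroup (Matrix.specialOrthogonalGroup (Fin n) ℝ))
    (hG : SphericalVortex.ActsTransitivelyOnSphere G)
    (π : G →* (V ≃ₗᵢ[ℂ] V)) (hπ : ∀ v : V, Continuous fun g : G => π g v)
    (hne : ∃ u : SphericalVortex.E n → V, SphericalVortex.IsNonzeroH1Equiv π u) :
    BddAbove (SphericalVortex.weinsteinValues p π) ∧
    (∃ u : SphericalVortex.E n → V, SphericalVortex.IsNonzeroH1Equiv π u ∧
      SphericalVortex.weinstein p u = SphericalVortex.weinsteinSup p π) ∧
    (∀ u : SphericalVortex.E n → V, SphericalVortex.IsNonzeroH1Equiv π u →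
      SphericalVortex.weinstein p u = SphericalVortex.weinsteinSup p π →
      SphericalVortex.SolvesNLS p
        (SphericalVortex.alpha n p / SphericalVortex.beta n p *
          (SphericalVortex.normGrad u ^ 2 / SphericalVortex.normLq 2 u ^ 2))
        ((p + 1) / SphericalVortex.beta n p *
          (SphericalVortex.normGrad u ^ 2 / SphericalVortex.normLq (p + 1) u ^ (p + 1))) u) ∧
    (∀ u : SphericalVortex.E n → V, SphericalVortex.IsNonzeroH1Equiv π u →
      SphericalVortex.weinstein p u = SphericalVortex.weinsteinSup p π →
      SphericalVortex.normLq 2 u = 1 → SphericalVortex.normGrad u = 1 →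
      SphericalVortex.SolvesNLS p
        (SphericalVortex.alpha n p / SphericalVortex.beta n p)
        ((p + 1) / (SphericalVortex.beta n p * SphericalVortex.weinsteinSup p π)) u) := by
  have hq := SphericalVortex.subcritical hp'
  refine ⟨SphericalVortex.bddAbove_weinsteinValues hn hp hq π,
    SphericalVortex.exists_maximiser hn hp hp' hG π hne,
    fun u hu hmax => SphericalVortex.solvesNLS_of_maximiser hn hp hp' π hu hmax,
    fun u hu hmax h1 h2 => ?_⟩
  have h := SphericalVortex.solvesNLS_of_maximiser hn hp hp' π hu hmax
  -- With both L² norms equal to 1 the denominator of W is 1, so the numerator is the supremum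
  -- itself.
  have hN : SphericalVortex.normLq (p + 1) u ^ (p + 1) = SphericalVortex.weinsteinSup p π := by
    rw [← hmax, SphericalVortex.weinstein, h1, h2, Real.one_rpow, Real.one_rpow, one_mul, div_one]
  rw [hN, h1, h2] at h
  simpa only [one_pow, div_one, mul_one, div_mul_div_comm] using h
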